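/- Let $k$ be a field. Let $\mathrm p:\mathbb R^3\to\mathbb R^2$ be the linear map with $\mathrm p(e_1)=(-\tfrac{\sqrt3}{2},-\tfrac12)$, $\mathrm p(e_2)=(\tfrac{\sqrt3}{2},-\tfrac12)$, $\mathrm p(e_3)=(0,1)$, and for $j=1,2,3$ let $R_j$ be the rhombus with a corner at the origin spanned by the two vectors $\mathrm p(e_l)$, $l\neq j$. The patches $\mathcal P_i$ of the Rauzy tiling are finite sets of rhombi $\mathrm p(x)+R_j$ ($x\in\mathbb Z^3$): $\mathcal P_0=\{R_1,R_2,R_3\}$, and $\mathcal P_{i+1}$ is obtained by replacing every $\mathrm p(x)+R_j$ in $\mathcal P_i$ by the rhombi of $\mathrm p(Mx)+\mathcal R(R_j)$, where $$\mathcal R(R_1)=\{R_3,\ \mathrm p(c_2)+R_1,\ \mathrm p(c_3)+R_2\},\quad \mathcal R(R_2)=\{R_1\},\quad \mathcal R(R_3)=\{R_2\},\quad M=\begin{pmatrix}0&1&0\\0&0&1\\1&-1&-1\end{pmatrix},$$ and $c_1,c_2,c_3$ are the columns of $M$; the representatives in $\mathbb Z^3$ are carried along, $\mathrm p(Mx)+\mathrm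 p(c_l)+R_m$ being represented as $\mathrm p(Mx+c_l)+R_m$. The Rauzy tiling is $\bigcup_i\mathcal P_i$. Let $Q$ be the quiver whose vertices are the vertices of the tiling and in which each edge is replaced by two opposite arrows $b,\bar b$. Paths are composed from left to right. Let $A=kQ/I$ be the Rauzy algebra, where $I$ is generated by the following relations. 1. A path of length two whose two edges are not both sides of one rhombus of the tiling is zero. 2. The two paths of length two along the sides of a rhombus which connect opposite vertices of it are equal. 3. For every vertex $z$ and every $j\in\mathbb Z/3$, $V_j(z)=\varepsilon_j(z)V_{j+1}(z)$. Here $V_j(z)=b\bar b-c\bar c$, where $b$ and $c$ are the arrows from $z$ to $z+\mathrm p(e_j)$ and to $z-\mathrm p(e_j)$, and a path is replaced by zero if there is no such arrow. The signs $\varepsilon_j(z)\in\{1,-1\}$ satisfy $\varepsilon_1(z)\varepsilon_2(z)\varepsilon_3(z)=1$. They are chosen arbitrarily at the origin, and they are determined at all other vertices by the rule that along an edge parallel to $\mathrm p(e_l)$ the signs $\varepsilon_l$ and $\varepsilon_{l-1}$ change while the third one does not. Let $i\ge 0$, let $V_i$ be the set of vertices of $\mathcal P_i$, $e_i=\sum_{v\in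 V_i}e_v$ and $A_i=e_iAe_i$. Let $z\in V_i$ and let $P_z=e_zA_i$ be the corresponding indecomposable projective right $A_i$-module. Let $S_z$ be the simple right $A_i$-module of dimension one on which $e_z$ acts as the identity and all other paths act as zero. A loop of $A_i$ at $z$ is an element $\beta=b\bar b\in A_i$ with $\beta\notin\mathrm{rad}^2(A_i)$, where $b$ is an arrow of $Q$ starting at $z$ and neither $b$ nor $\bar b$ belongs to $A_i$. If there is a loop of $A_i$ at $z$, then the heart $\mathrm{rad}(P_z)/\mathrm{soc}(P_z)$ of $P_z$ is decomposable, and it has a direct summand which is simple and isomorphic to $S_z$. -/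

import Mathlib

noncomputable section

namespace Rauzy

/-! ### The Rauzy tiling -/

/-- The planar lattice `ℒ`, in coordinates: `(m, n)` is the point `m p(e₂) + n p(e₃)`. -/
abbrev Lattice : Type := ℤ × ℤ

/-- The projection `p : ℤ³ → ℒ` in these coordinates; it is determined by `p(e₂) = (1, 0)`,
`p(e₃) = (0, 1)` and `p(e₁) = -(p(e₂) + p(e₃))`. The indices `0, 1, 2` stand for `1, 2, 3`. -/
def proj (x : Fin 3 → ℤ) : Lattice := (x 1 - x 0, x 2 - x 0)

/-- The edge direction `p(e_j)`. -/
def dir (j : Fin 3) : Lattice := proj (Pi.single j 1)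

/-- The pair `(v, j)` is the rhombus `v + R_j`, where `R_j` is the rhombus which has a corner at the
origin and is spanned by the two vectors `p(e_l)`, `l ≠ j`. -/
abbrev Tile : Type := Lattice × Fin 3

/-- The four corners of a rhombus, in cyclic order. -/
def corner (t : Tile) : Fin 4 → Lattice :=
  ![t.1, t.1 + dir (t.2 + 1), t.1 + dir (t.2 + 1) + dir (t.2 + 2), t.1 + dir (t.2 + 2)]

/-- The points `u` and `v` are the two ends of a side of the rhombus `t`. -/
def IsSide (t : Tile) (u v : Lattice) : Prop :=
  ∃ a : Fin 4, (u = corner t a ∧ v = corner t (a + 1)) ∨ (v = corner t a ∧ u = corner t (a + 1))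

/-- The matrix `M` of the recursion. -/
def recMatrix : Matrix (Fin 3) (Fin 3) ℤ := !![0, 1, 0; 0, 0, 1; 1, -1, -1]

/-- The pair `(x, j)` represents the rhombus `p(x) + R_j`. -/
abbrev LiftedTile : Type := (Fin 3 → ℤ) × Fin 3

/-- The set of rhombi which replaces `p(x) + R_j` in the next patch, translated by `p(Mx)`:
`R₁ ↦ {R₃, p(c₂) + R₁, p(c₃) + R₂}`, `R₂ ↦ {R₁}`, `R₃ ↦ {R₂}`, where `c_l` is a column of `M`. -/
def inflate (t : LiftedTile) : Finset LiftedTile :=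
  let w := recMatrix.mulVec t.1
  ![{(w, 2), (w + recMatrix.col 1, 0), (w + recMatrix.col 2, 1)}, {(w, 0)}, {(w, 1)}] t.2

/-- The recursively chosen representatives of the rhombi of the patches. -/
def liftedPatch : ℕ → Finset LiftedTile
  | 0 => Finset.univ.image fun j => (0, j)
  | i + 1 => (liftedPatch i).biUnion inflate

/-- The rhombi of the `i`-th patch. -/
def patch (i : ℕ) : Finset Tile := (liftedPatch i).image fun t => (proj t.1, t.2)

/-- The Rauzy tiling. -/
def tiling : Set Tile := {t | ∃ i, t ∈ patch i}

/-! ### The quiver of a set of rhombi -/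

/-- The vertices of the rhombi in `T`. -/
def Vertex (T : Set Tile) : Type := {v : Lattice // ∃ t ∈ T, ∃ a, v = corner t a}

/-- The points `u`, `v` are joined by an edge of a rhombus in `T`. -/
def Adj (T : Set Tile) (u v : Lattice) : Prop := ∃ t ∈ T, IsSide t u v

/-- Every edge is replaced by a pair of opposite arrows. -/
instance (T : Set Tile) : Quiver (Vertex T) where
  Hom u v := PLift (Adj T u.1 v.1)

theorem Adj.symm {T : Set Tile} {u v : Lattice} (h : Adj T u v) : Adj T v u := by
  obtain ⟨t, ht, a, h⟩ := h
  exact ⟨t, ht, a, h.symm⟩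

theorem Adj.exists_corner {T : Set Tile} {u v : Lattice} (h : Adj T u v) :
    ∃ t ∈ T, ∃ a, v = corner t a := by
  obtain ⟨t, ht, a, h | h⟩ := h
  exacts [⟨t, ht, a + 1, h.2⟩, ⟨t, ht, a, h.1⟩]

/-! ### Path algebras -/

/-- The path algebra of a quiver: the vector space with the set of all paths as a basis. -/
def PathAlgebra (k V : Type*) [Field k] [Quiver V] : Type _ :=
  (Σ a b : V, Quiver.Path a b) →₀ k

namespace PathAlgebra

section

variable {k V : Type*} [Field k] [Quiver V]

instance : AddCommGroup (PathAlgebra k V) :=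
  inferInstanceAs (AddCommGroup ((Σ a b : V, Quiver.Path a b) →₀ k))

instance : Module k (PathAlgebra k V) :=
  inferInstanceAs (Module k ((Σ a b : V, Quiver.Path a b) →₀ k))

/-- A path, as a basis element of the path algebra. -/
def ofPath {a b : V} (p : Quiver.Path a b) : PathAlgebra k V :=
  Finsupp.single (⟨a, b, p⟩ : Σ a b : V, Quiver.Path a b) (1 : k)

/-- The linear map with prescribed values on the paths. -/
def liftLinear {M : Type*} [AddCommGroup M] [Module k M]
    (φ : (Σ a b : V, Quiver.Path a b) → M) : PathAlgebra k V →ₗ[k] M :=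
  Finsupp.linearCombination k φ

theorem liftLinear_ofPath {M : Type*} [AddCommGroup M] [Module k M]
    (φ : (Σ a b : V, Quiver.Path a b) → M) {a b : V} (p : Quiver.Path a b) :
    liftLinear (k := k) φ (ofPath p) = φ ⟨a, b, p⟩ :=
  (Finsupp.linearCombination_single k (1 : k) _).trans (one_smul k _)

open Classical in
/-- The product of two paths: their concatenation, first `p` and then `q`, or zero. -/
def pathMul (p q : Σ a b : V, Quiver.Path a b) : PathAlgebra k V :=
  if h : q.1 = p.2.1 then ofPath (p.2.2.comp (q.2.2.cast h rfl)) else 0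

/-- The bilinear extension of the product of paths. -/
def mulLinear : PathAlgebra k V →ₗ[k] PathAlgebra k V →ₗ[k] PathAlgebra k V :=
  liftLinear fun p => liftLinear fun q => pathMul p q

instance : Mul (PathAlgebra k V) := ⟨fun f g => mulLinear f g⟩

theorem mul_def (f g : PathAlgebra k V) : f * g = mulLinear f g := rfl

theorem ofPath_mul {a b b' c : V} (p : Quiver.Path a b) (q : Quiver.Path b' c) :
    (ofPath p * ofPath q : PathAlgebra k V) = pathMul ⟨a, b, p⟩ ⟨b', c, q⟩ := by
  rw [mul_def, mulLinear, liftLinear_ofPath, liftLinear_ofPath]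

theorem ofPath_mul_comp {a b c : V} (p : Quiver.Path a b) (q : Quiver.Path b c) :
    (ofPath p * ofPath q : PathAlgebra k V) = ofPath (p.comp q) := by
  rw [ofPath_mul]
  simp [pathMul]

theorem ofPath_mul_ne {a b b' c : V} (p : Quiver.Path a b) (q : Quiver.Path b' c) (h : b' ≠ b) :
    (ofPath p * ofPath q : PathAlgebra k V) = 0 := by
  rw [ofPath_mul]
  simp [pathMul, h]

theorem induction {P : PathAlgebra k V → Prop} (zero : P 0)
    (add : ∀ f g, P f → P g → P (f + g))
    (smul_path : ∀ (c : k) (a b : V) (p : Quiver.Path a b), P (c • ofPath p))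
    (f : PathAlgebra k V) : P f := by
  refine Finsupp.induction_linear f zero add fun x c => ?_
  exact (Finsupp.smul_single_one x c) ▸ smul_path c x.1 x.2.1 x.2.2

theorem ofPath_mul_assoc {a b b' c c' d : V} (p : Quiver.Path a b) (q : Quiver.Path b' c)
    (r : Quiver.Path c' d) :
    (ofPath p * ofPath q * ofPath r : PathAlgebra k V) = ofPath p * (ofPath q * ofPath r) := by
  by_cases h : b' = b
  · subst h
    by_cases h' : c' = c
    · subst h'
      simp [ofPath_mul_comp]
    · rw [ofPath_mul_comp, ofPath_mul_ne _ _ h', ofPath_mul_ne _ _ h', mul_def, map_zero]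
  · rw [ofPath_mul_ne _ _ h]
    by_cases h' : c' = c
    · subst h'
      rw [ofPath_mul_comp, ofPath_mul_ne _ _ h, mul_def, map_zero, LinearMap.zero_apply]
    · rw [ofPath_mul_ne _ _ h', mul_def, mul_def, map_zero, map_zero, LinearMap.zero_apply]

instance : NonUnitalRing (PathAlgebra k V) where
  left_distrib f g h := by simp only [mul_def, map_add]
  right_distrib f g h := by simp only [mul_def, map_add, LinearMap.add_apply]
  zero_mul f := by simp only [mul_def, map_zero, LinearMap.zero_apply]
  mul_zero f := by simp only [mul_def, map_zero]
  mul_assoc f g h := by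
    induction f using PathAlgebra.induction with
    | zero => simp only [mul_def, map_zero, LinearMap.zero_apply]
    | add f f' hf hf' =>
      simp only [mul_def, map_add, LinearMap.add_apply] at hf hf' ⊢
      rw [hf, hf']
    | smul_path c a b p =>
      induction g using PathAlgebra.induction with
      | zero => simp only [mul_def, map_zero, LinearMap.zero_apply]
      | add g g' hg hg' =>
        simp only [mul_def, map_add, LinearMap.add_apply] at hg hg' ⊢
        rw [hg, hg']
      | smul_path c' a' b' q =>
        induction h using PathAlgebra.induction with
        | zero => simp only [mul_def, map_zero]
        | add h h' hh hh' =>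
          simp only [mul_def, map_add] at hh hh' ⊢
          rw [hh, hh']
        | smul_path c'' a'' b'' r =>
          have := ofPath_mul_assoc (k := k) p q r
          simp only [mul_def, map_smul, LinearMap.smul_apply] at this ⊢
          rw [this]

end

end PathAlgebra

/-! ### The algebra of a set of rhombi -/

section

variable (k : Type*) [Field k] (T : Set Tile)

/-- The loop `b b̄`, where `b` is the arrow from `z` to `z + d`; it is replaced by zero if there is
no such arrow. -/
def roundTrip (z : Vertex T) (d : Lattice) : PathAlgebra k (Vertex T) :=
  open Classical in
  if h : Adj T z.1 (z.1 + d) then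
    let w : Vertex T := ⟨z.1 + d, h.exists_corner⟩
    let b : z ⟶ w := ⟨h⟩
    let b' : w ⟶ z := ⟨h.symm⟩
    PathAlgebra.ofPath (b.toPath.comp b'.toPath)
  else 0

/-- The difference of the two paths of length two at `z` along the two opposite edges of the line
with direction `p(e_j)`. -/
def lineDiff (z : Vertex T) (j : Fin 3) : PathAlgebra k (Vertex T) :=
  roundTrip k T z (dir j) - roundTrip k T z (-dir j)

/-- The sign `ε_j` at the point `v` of the star relation which compares the lines with directions
`p(e_j)` and `p(e_{j+1})`, if the signs at the origin are `η`. When one passes along an edge with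
direction `p(e_l)`, the two signs `ε_l` and `ε_{l-1}` change, the third one does not. -/
def starSign (η : Fin 3 → ℤˣ) (v : Lattice) (j : Fin 3) : ℤˣ :=
  let s : Fin 3 → ℤˣ := ![1, v.1.negOnePow, v.2.negOnePow]
  η j * (s j * s (j + 1))

variable {T} in
/-- The two-rhombus, mirror and star relations. -/
inductive IsRelation (η : Fin 3 → ℤˣ) : PathAlgebra k (Vertex T) → Prop
  | twoRhombus {x y z : Vertex T} (a : x ⟶ y) (b : y ⟶ z)
      (h : ¬ ∃ t ∈ T, IsSide t x.1 y.1 ∧ IsSide t y.1 z.1) :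
      IsRelation η (PathAlgebra.ofPath (a.toPath.comp b.toPath))
  | mirror {x y y' z : Vertex T} (t : Tile) (ht : t ∈ T) (c : Fin 4)
      (hx : x.1 = corner t c) (hy : y.1 = corner t (c + 1))
      (hz : z.1 = corner t (c + 2)) (hy' : y'.1 = corner t (c + 3))
      (a : x ⟶ y) (b : y ⟶ z) (a' : x ⟶ y') (b' : y' ⟶ z) :
      IsRelation η (PathAlgebra.ofPath (a.toPath.comp b.toPath) -
        PathAlgebra.ofPath (a'.toPath.comp b'.toPath))
  | star (z : Vertex T) (j : Fin 3) :
      IsRelation η (lineDiff k T z j - (starSign η z.1 j : ℤ) • lineDiff k T z (j + 1))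

/-- The ideal `I` generated by the relations. -/
def relationIdeal (η : Fin 3 → ℤˣ) : TwoSidedIdeal (PathAlgebra k (Vertex T)) :=
  TwoSidedIdeal.span {r | IsRelation k η r}

/-- The rhombal algebra `kQ/I`; in general it has no identity element. -/
def RhombalAlgebra (η : Fin 3 → ℤˣ) : Type _ := (relationIdeal k T η).ringCon.Quotient

instance (η : Fin 3 → ℤˣ) : NonUnitalRing (RhombalAlgebra k T η) :=
  inferInstanceAs (NonUnitalRing (relationIdeal k T η).ringCon.Quotient)

variable {T}

/-- The quotient map `kQ → kQ/I`. -/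
def quotMap (η : Fin 3 → ℤˣ) : PathAlgebra k (Vertex T) →ₙ+* RhombalAlgebra k T η where
  toFun f := ((f : (relationIdeal k T η).ringCon.Quotient) :)
  map_zero' := rfl
  map_add' _ _ := rfl
  map_mul' _ _ := rfl

/-- The element of `kQ/I` given by a path. -/
def pathElt (η : Fin 3 → ℤˣ) {x y : Vertex T} (p : Quiver.Path x y) : RhombalAlgebra k T η :=
  quotMap k η (PathAlgebra.ofPath p)

/-- The idempotent `e_x`. -/
def vertexIdem (η : Fin 3 → ℤˣ) (x : Vertex T) : RhombalAlgebra k T η :=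
  pathElt k η (Quiver.Path.nil : Quiver.Path x x)

theorem vertexIdem_mul_self (η : Fin 3 → ℤˣ) (x : Vertex T) :
    vertexIdem k η x * vertexIdem k η x = vertexIdem k η x := by
  rw [vertexIdem, pathElt, ← map_mul, PathAlgebra.ofPath_mul_comp, Quiver.Path.comp_nil]

theorem vertexIdem_mul_ne (η : Fin 3 → ℤˣ) {x y : Vertex T} (h : y ≠ x) :
    vertexIdem k η x * vertexIdem k η y = 0 := by
  rw [vertexIdem, vertexIdem, pathElt, pathElt, ← map_mul, PathAlgebra.ofPath_mul_ne _ _ h,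
    map_zero]

/-- The idempotent `∑ e_x` over a finite set of vertices. -/
def sumIdem (η : Fin 3 → ℤˣ) (V : Finset (Vertex T)) : RhombalAlgebra k T η :=
  ∑ x ∈ V, vertexIdem k η x

theorem vertexIdem_mul_sumIdem (η : Fin 3 → ℤˣ) {V : Finset (Vertex T)} {x : Vertex T}
    (hx : x ∈ V) : vertexIdem k η x * sumIdem k η V = vertexIdem k η x := by
  rw [sumIdem, Finset.mul_sum, Finset.sum_eq_single_of_mem x hx
    fun y _ h => vertexIdem_mul_ne k η h, vertexIdem_mul_self]

theorem sumIdem_mul_vertexIdem (η : Fin 3 → ℤˣ) {V : Finset (Vertex T)} {x : Vertex T}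
    (hx : x ∈ V) : sumIdem k η V * vertexIdem k η x = vertexIdem k η x := by
  rw [sumIdem, Finset.sum_mul, Finset.sum_eq_single_of_mem x hx
    fun y _ h => vertexIdem_mul_ne k η h.symm, vertexIdem_mul_self]

theorem isIdempotentElem_sumIdem (η : Fin 3 → ℤˣ) (V : Finset (Vertex T)) :
    IsIdempotentElem (sumIdem k η V) := by
  rw [IsIdempotentElem]
  conv_lhs => rw [sumIdem, Finset.sum_mul]
  exact Finset.sum_congr rfl fun x hx => vertexIdem_mul_sumIdem k η hx

/-- The character of `kQ` which maps an element to its coefficient at the trivial path `e_z`. -/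
def pathChar (z : Vertex T) : PathAlgebra k (Vertex T) →ₗ[k] k :=
  open Classical in
  PathAlgebra.liftLinear fun p => if p = ⟨z, z, Quiver.Path.nil⟩ then 1 else 0

theorem pathChar_comp_toPath (z : Vertex T) {x y w : Vertex T} (a : x ⟶ y) (b : y ⟶ w) :
    pathChar k z (PathAlgebra.ofPath (a.toPath.comp b.toPath)) = 0 := by
  rw [pathChar, PathAlgebra.liftLinear_ofPath, if_neg]
  intro h
  have := congrArg (fun p : Σ a b : Vertex T, Quiver.Path a b => p.2.2.length) h
  simp at this

theorem pathChar_mul (z : Vertex T) (f g : PathAlgebra k (Vertex T)) :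
    pathChar k z (f * g) = pathChar k z f * pathChar k z g := by
  induction f using PathAlgebra.induction with
  | zero => simp
  | add f f' hf hf' => rw [add_mul, map_add, map_add, hf, hf', add_mul]
  | smul_path c a b p =>
    induction g using PathAlgebra.induction with
    | zero => simp
    | add g g' hg hg' => rw [mul_add, map_add, map_add, hg, hg', mul_add]
    | smul_path c' a' b' q =>
      have key : pathChar k z (PathAlgebra.ofPath p * PathAlgebra.ofPath q) =
          pathChar k z (PathAlgebra.ofPath p) * pathChar k z (PathAlgebra.ofPath q) := by
        by_cases h : a' = b
        · subst h
          rw [PathAlgebra.ofPath_mul_comp]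
          simp only [pathChar, PathAlgebra.liftLinear_ofPath]
          cases q with
          | nil =>
            by_cases hp : (⟨a, a', p⟩ : Σ a b : Vertex T, Quiver.Path a b) =
                ⟨z, z, Quiver.Path.nil⟩
            · have h1 : a' = z := congrArg (fun p => p.2.1) hp
              subst h1
              rw [Quiver.Path.comp_nil, if_pos hp, if_pos rfl, mul_one]
            · rw [Quiver.Path.comp_nil, if_neg hp, zero_mul]
          | cons q e =>
            have hlen : ∀ {x y w : Vertex T} (r : Quiver.Path x y) (e : y ⟶ w),
                (⟨x, w, r.cons e⟩ : Σ a b : Vertex T, Quiver.Path a b) ≠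
                  ⟨z, z, Quiver.Path.nil⟩ := by
              intro x y w r e h
              have := congrArg (fun p : Σ a b : Vertex T, Quiver.Path a b => p.2.2.length) h
              simp at this
            rw [Quiver.Path.comp_cons, if_neg (hlen _ _), if_neg (hlen _ _), mul_zero]
        · rw [PathAlgebra.ofPath_mul_ne _ _ h, map_zero]
          simp only [pathChar, PathAlgebra.liftLinear_ofPath]
          by_cases hp : (⟨a, b, p⟩ : Σ a b : Vertex T, Quiver.Path a b) =
              ⟨z, z, Quiver.Path.nil⟩
          · rw [if_neg (c := (⟨a', b', q⟩ : Σ a b : Vertex T, Quiver.Path a b) = _), mul_zero]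
            intro hq
            have h1 : b = z := congrArg (fun p => p.2.1) hp
            have h2 : a' = z := congrArg (fun p => p.1) hq
            exact h (h2.trans h1.symm)
          · rw [if_neg hp, zero_mul]
      simp only [PathAlgebra.mul_def, map_smul, LinearMap.smul_apply, smul_eq_mul] at key ⊢
      rw [key]
      ring

theorem pathChar_roundTrip (z w : Vertex T) (d : Lattice) :
    pathChar k z (roundTrip k T w d) = 0 := by
  rw [roundTrip]
  split_ifs
  · exact pathChar_comp_toPath k z _ _
  · exact map_zero _

theorem pathChar_relation (z : Vertex T) (η : Fin 3 → ℤˣ) {r : PathAlgebra k (Vertex T)}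
    (hr : IsRelation k η r) : pathChar k z r = 0 := by
  cases hr with
  | twoRhombus a b h => exact pathChar_comp_toPath k z a b
  | mirror => rw [map_sub, pathChar_comp_toPath, pathChar_comp_toPath, sub_zero]
  | star w j => simp [lineDiff, pathChar_roundTrip]

/-- `pathChar`, as a homomorphism of rings without identity. -/
def pathCharHom (z : Vertex T) : PathAlgebra k (Vertex T) →ₙ+* k where
  toFun := pathChar k z
  map_zero' := map_zero _
  map_add' := map_add _
  map_mul' := pathChar_mul k z

theorem pathChar_eq_of_rel (z : Vertex T) (η : Fin 3 → ℤˣ) {f g : PathAlgebra k (Vertex T)}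
    (h : (relationIdeal k T η).ringCon f g) : pathChar k z f = pathChar k z g := by
  have hle : relationIdeal k T η ≤ TwoSidedIdeal.ker (pathCharHom k z) :=
    TwoSidedIdeal.span_le.2 fun r hr => (TwoSidedIdeal.mem_ker _).2 (pathChar_relation k z η hr)
  have := (TwoSidedIdeal.mem_ker _).1 (hle ((TwoSidedIdeal.rel_iff _ f g).1 h))
  rw [map_sub] at this
  exact sub_eq_zero.1 this

/-- The character of `kQ/I` which maps `e_z` to `1` and every other path to `0`. -/
def vertexChar (η : Fin 3 → ℤˣ) (z : Vertex T) : RhombalAlgebra k T η →ₙ+* k where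
  toFun := Quotient.lift (pathChar k z) fun _ _ h => pathChar_eq_of_rel k z η h
  map_zero' := map_zero (pathChar k z)
  map_add' := by
    rintro ⟨f⟩ ⟨g⟩
    exact map_add (pathChar k z) f g
  map_mul' := by
    rintro ⟨f⟩ ⟨g⟩
    exact pathChar_mul k z f g

theorem vertexChar_vertexIdem (η : Fin 3 → ℤˣ) (z x : Vertex T) [Decidable (x = z)] :
    vertexChar k η z (vertexIdem k η x) = if x = z then 1 else 0 := by
  change pathChar k z (PathAlgebra.ofPath Quiver.Path.nil) = _
  rw [pathChar, PathAlgebra.liftLinear_ofPath]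
  by_cases h : x = z
  · subst h
    simp
  · rw [if_neg h, if_neg]
    exact fun h' => h (congrArg (fun p : Σ a b : Vertex T, Quiver.Path a b => p.1) h')

theorem vertexChar_sumIdem (η : Fin 3 → ℤˣ) {V : Finset (Vertex T)} {z : Vertex T}
    (hz : z ∈ V) : vertexChar k η z (sumIdem k η V) = 1 := by
  classical
  rw [sumIdem, map_sum, Finset.sum_eq_single_of_mem z hz, vertexChar_vertexIdem, if_pos rfl]
  intro x _ h
  rw [vertexChar_vertexIdem, if_neg h]

end

/-! ### Finite-dimensional Rauzy algebras -/

open Classical in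
/-- The set `V_i` of the vertices of the `i`-th patch. -/
def patchVertices (i : ℕ) : Finset (Vertex tiling) :=
  Finset.subtype _ ((patch i).biUnion fun t => Finset.univ.image (corner t))

section

variable (k : Type*) [Field k] (η : Fin 3 → ℤˣ) (i : ℕ)

/-- The finite-dimensional Rauzy algebra `A_i = e_i A e_i`, where `A` is the Rauzy algebra and `e_i`
is the sum of the idempotents of the vertices in `V_i`. -/
def FinRauzyAlgebra : Type _ :=
  (isIdempotentElem_sumIdem k η (patchVertices i)).Corner

instance : Ring (FinRauzyAlgebra k η i) :=
  inferInstanceAs (Ring (isIdempotentElem_sumIdem k η (patchVertices i)).Corner)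

variable {k η i}

/-- The inclusion of `A_i` in `A`. -/
def FinRauzyAlgebra.incl : FinRauzyAlgebra k η i →ₙ+* RhombalAlgebra k tiling η where
  toFun a := a.1
  map_zero' := rfl
  map_add' _ _ := rfl
  map_mul' _ _ := rfl

variable (k η)

/-- The idempotent `e_z` of `A_i`, for a vertex `z` in `V_i`. -/
def finVertexIdem {z : Vertex tiling} (hz : z ∈ patchVertices i) : FinRauzyAlgebra k η i :=
  ⟨vertexIdem k η z, (Subsemigroup.mem_corner_iff (isIdempotentElem_sumIdem k η _)).2
    ⟨sumIdem_mul_vertexIdem k η hz, vertexIdem_mul_sumIdem k η hz⟩⟩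

/-- The projective right module `P_z = e_z A_i`. -/
def projModule {z : Vertex tiling} (hz : z ∈ patchVertices i) :
    Submodule (FinRauzyAlgebra k η i)ᵐᵒᵖ (FinRauzyAlgebra k η i) :=
  Submodule.span _ {finVertexIdem k η hz}

/-- The character of `A_i` which maps `e_z` to `1` and every other path to `0`. -/
def finVertexChar {z : Vertex tiling} (hz : z ∈ patchVertices i) : FinRauzyAlgebra k η i →+* k where
  toFun a := vertexChar k η z a.incl
  map_one' := vertexChar_sumIdem k η hz
  map_zero' := map_zero _
  map_add' a b := by rw [map_add, map_add]
  map_mul' a b := by rw [map_mul, map_mul]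

/-- The simple right module `S_z` of dimension one: `e_z` acts as the identity, and all other paths
act as zero. -/
def VertexSimple {z : Vertex tiling} (_ : z ∈ patchVertices i) (_ : Fin 3 → ℤˣ) : Type _ := k

instance {z : Vertex tiling} (hz : z ∈ patchVertices i) : AddCommGroup (VertexSimple k hz η) :=
  inferInstanceAs (AddCommGroup k)

instance {z : Vertex tiling} (hz : z ∈ patchVertices i) :
    Module (FinRauzyAlgebra k η i)ᵐᵒᵖ (VertexSimple k hz η) :=
  Module.compHom k ((finVertexChar k η hz).fromOpposite fun _ _ => mul_comm _ _)

variable {k η}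

/-- The element `β` of `A_i` is a loop at the vertex `z`: it is the product of an arrow of `A` from
`z` to some vertex and the opposite arrow, these arrows are not in `A_i`, and `β` is not in the
square of the radical of `A_i`. -/
def IsLoopAt (z : Vertex tiling) (β : FinRauzyAlgebra k η i) : Prop :=
  ∃ (x : Vertex tiling) (b : z ⟶ x) (b' : x ⟶ z),
    β.incl = pathElt k η b.toPath * pathElt k η b'.toPath ∧
    (∀ a : FinRauzyAlgebra k η i, a.incl ≠ pathElt k η b.toPath) ∧
    (∀ a : FinRauzyAlgebra k η i, a.incl ≠ pathElt k η b'.toPath) ∧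
    β ∉ Ring.jacobson (FinRauzyAlgebra k η i) * Ring.jacobson (FinRauzyAlgebra k η i)

end

/-! ### Hearts -/

section

variable (R M : Type*) [Ring R] [AddCommGroup M] [Module R M]

/-- The socle: the sum of the simple submodules. -/
def socle : Submodule R M := sSup {N | IsSimpleModule R N}

/-- The heart `rad(M)/soc(M)`. -/
abbrev Heart : Type _ := Module.jacobson R M ⧸ (socle R M).submoduleOf (Module.jacobson R M)

/-- The module is the direct sum of two nonzero submodules. -/
def IsDecomposable : Prop := ∃ N N' : Submodule R M, IsCompl N N' ∧ N ≠ ⊥ ∧ N' ≠ ⊥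

end

end Rauzy

end

/-!
The theorem follows from a linear form on the closed paths of length four at `z` and from the
geometry of the edges at `z` which leave the patch.

*The tiling as a stepped plane.* Let `λ` be the real root of `λ³ + λ² + λ = 1`. The linear form
`height` on `ℤ³` with coefficients `(1, λ + λ², λ)` satisfies `height (M x) = λ * height x`, hence all
representatives of rhombi are faces `(x, j)` with `0 ≤ height x < weight j`, that is, faces of a
stepped plane. Every point `v` of the planar lattice lifts to the stepped plane, and the height
`planeHeight v` of this lift decides which edges and rhombi there are at `v`
(`tileAt_mem_steppedPlane`). The tiling contains all faces of the stepped plane at each of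
its vertices (`mem_tiling_of_corner_eq`);
this is proved by going back to the parents of two neighbouring faces, which reduces it to a finite
check. In the same way one sees that a vertex of a patch which has both neighbours on a line has one
of these in the patch (`InPatch.add_or_sub`).

*Paths of length five.* Edges of different lines commute in the algebra, straight paths of length two
are zero, and so are paths which involve all three lines. The star relations allow one to reverse
loops, and this kills all paths of length five (`pathElt_eq_zero`). So `A_i` is filtered by the length
of paths, its elements of positive degree form a nilpotent ideal, the radical of `P_z` is its part
of positive degree (`mem_jacobson_projModule`), and the socle is the part which is annihilated by
elements of positive degree (`mem_socle_projModule`).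

*The linear form.* On a closed path of length four at `z` the form `fourForm` is a sign if the path
belongs to one rhombus, and a number which depends on the rhombi at the edge `b` for the path
`b b̄ b b̄`. At every edge, the signed count of the rhombi which are spanned by it and an edge of
another line does not depend on that line (`spanInd_sub_spanInd`), and for this reason the form
respects the star relations and induces a linear form `algForm` on the algebra.

*Loops.* If there is a loop at `z`, then on each line exactly one of the edges at `z` leaves the patch:
by the above at most one does, and if none does on some line, then the star relations
express the loop by products of elements of the radical (`exists_leaves_of_isLoopAt`). These three
edges do not have the same sign, since `z` lies on a rhombus of the patch. So one of them, `b`, has a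
sign different from that of the other two, and then both rhombi at `b` are spanned by `b` and one of
these (`exists_isolated`). Therefore `β = b b̄` is annihilated by the arrows of the patch, and the
value of the form at `β²` is `-1`. The map `r ↦ algForm (r β)` is a homomorphism from the radical of
`P_z` to `S_z` which vanishes on the socle, and it does not vanish at `β`. So the heart is the direct
sum of the span of the class of `β`, which is isomorphic to `S_z`, and of the kernel of this
homomorphism (`heart_of_closed_path`). The kernel is not zero: it contains the class of an
arrow of the patch.
-/

noncomputable section

namespace Rauzy

/-! ### Heights -/

theorem exists_lam : ∃ l : ℝ, 0.5436 ≤ l ∧ l ≤ 0.5437 ∧ l ^ 3 + l ^ 2 + l = 1 := by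
  have hc : ContinuousOn (fun l : ℝ => l ^ 3 + l ^ 2 + l) (Set.Icc 0.5436 0.5437) := by fun_prop
  obtain ⟨l, hl, h⟩ := intermediate_value_Icc (by norm_num) hc
    (show (1 : ℝ) ∈ Set.Icc _ _ by constructor <;> norm_num)
  exact ⟨l, hl.1, hl.2, h⟩

/-- The real root `λ` of `λ³ + λ² + λ = 1`, an eigenvalue of the matrix `M`. -/
def lam : ℝ := exists_lam.choose

theorem lam_lower : 0.5436 ≤ lam := exists_lam.choose_spec.1

theorem lam_upper : lam ≤ 0.5437 := exists_lam.choose_spec.2.1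

theorem lam_cube : lam ^ 3 = 1 - lam - lam ^ 2 := by
  have := exists_lam.choose_spec.2.2
  change lam ^ 3 + lam ^ 2 + lam = 1 at this
  linarith

theorem lam_sq_lower : 0.2954 ≤ lam ^ 2 := by nlinarith [lam_lower]

theorem lam_sq_upper : lam ^ 2 ≤ 0.2957 := by nlinarith [lam_lower, lam_upper]

/-- The left eigenvector `(1, λ + λ², λ)` of `M` for the eigenvalue `λ`. -/
def weight : Fin 3 → ℝ := ![1, lam + lam ^ 2, lam]

theorem weight_pos (j : Fin 3) : 0 < weight j := by
  have := lam_lower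
  fin_cases j <;> simp [weight] <;> positivity

/-- The sum of the three weights, which is the height of `(1, 1, 1)`. -/
def total : ℝ := weight 0 + weight 1 + weight 2

theorem total_pos : 0 < total := add_pos (add_pos (weight_pos 0) (weight_pos 1)) (weight_pos 2)

theorem total_eq (j : Fin 3) : total = weight j + weight (j + 1) + weight (j + 2) := by
  fin_cases j <;> simp [total] <;> ring

/-- The linear form on `ℤ³` which is given by the weights. The matrix `M` multiplies it by `λ`. -/
def height (x : Fin 3 → ℤ) : ℝ := x 0 * weight 0 + x 1 * weight 1 + x 2 * weight 2

theorem height_add (x y : Fin 3 → ℤ) : height (x + y) = height x + height y := by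
  simp [height]; ring

theorem height_sub (x y : Fin 3 → ℤ) : height (x - y) = height x - height y := by
  simp [height]; ring

theorem height_single (j : Fin 3) : height (Pi.single j 1) = weight j := by
  fin_cases j <;> simp [height]

theorem proj_add (x y : Fin 3 → ℤ) : proj (x + y) = proj x + proj y := by
  ext <;> simp [proj] <;> ring

theorem recMatrix_mulVec (x : Fin 3 → ℤ) :
    recMatrix.mulVec x = ![x 1, x 2, x 0 - x 1 - x 2] := by
  ext i
  fin_cases i <;> simp [recMatrix, Matrix.mulVec, dotProduct, Fin.sum_univ_three]
  ring

theorem recMatrix_col_one : recMatrix.col 1 = ![1, 0, -1] := by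
  ext i
  fin_cases i <;> simp [recMatrix]

theorem recMatrix_col_two : recMatrix.col 2 = ![0, 1, -1] := by
  ext i
  fin_cases i <;> simp [recMatrix]

theorem height_mulVec (x : Fin 3 → ℤ) : height (recMatrix.mulVec x) = lam * height x := by
  rw [recMatrix_mulVec]
  simp [height, weight]
  linear_combination (- (x 1 : ℝ)) * lam_cube

/-! ### The stepped plane -/

/-- The rhombus `(x, j)` of `ℤ³` is a face of the stepped plane of the points of height
between `0` and `total`. -/
def InStep (t : LiftedTile) : Prop := 0 ≤ height t.1 ∧ height t.1 < weight t.2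

/-- The inverse of the matrix `M`. -/
def recInv (x : Fin 3 → ℤ) : Fin 3 → ℤ := ![x 0 + x 1 + x 2, x 0, x 1]

theorem recInv_sub (x y : Fin 3 → ℤ) : recInv (x - y) = recInv x - recInv y := by
  ext i
  fin_cases i <;> simp [recInv]
  ring

theorem recMatrix_mulVec_recInv (x : Fin 3 → ℤ) : recMatrix.mulVec (recInv x) = x := by
  rw [recMatrix_mulVec]
  ext i
  fin_cases i <;> simp [recInv]
  ring

theorem recInv_mulVec (x : Fin 3 → ℤ) : recInv (recMatrix.mulVec x) = x := by
  rw [recMatrix_mulVec]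
  ext i
  fin_cases i <;> simp [recInv]

theorem height_eq_lam_mul (x : Fin 3 → ℤ) : height x = lam * height (recInv x) := by
  rw [← height_mulVec, recMatrix_mulVec_recInv]

/-- The substitution preserves the stepped plane, since `M` contracts heights by `λ`. -/
theorem inStep_of_mem_inflate {s t : LiftedTile} (hs : InStep s) (h : t ∈ inflate s) :
    InStep t := by
  obtain ⟨x, j⟩ := s
  have h1 := lam_lower
  have h2 := lam_upper
  have h3 := lam_sq_lower
  obtain ⟨hx0, hx1⟩ := hs
  have hw := height_mulVec x
  simp only at hx0 hx1
  have hl0 : 0 ≤ lam * height x := by positivity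
  have hl1 : lam * height x < lam * weight j := by gcongr
  rw [← hw] at hl0 hl1
  have hc1 : height (recMatrix.col 1) = 1 - lam := by
    rw [recMatrix_col_one]; simp [height, weight]; ring
  have hc2 : height (recMatrix.col 2) = lam ^ 2 := by
    rw [recMatrix_col_two]; simp [height, weight]
  have h4 := lam_cube
  fin_cases j <;> simp [inflate] at h
  · simp [weight] at hl1
    rcases h with rfl | rfl | rfl <;> simp [InStep, height_add, hc1, hc2, weight] <;>
      constructor <;> linarith
  · simp [weight] at hl1
    subst h
    simp [InStep, weight]
    constructor <;> nlinarith
  · simp [weight] at hl1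
    subst h
    simp [InStep, weight]
    constructor <;> nlinarith

theorem inStep_of_mem_liftedPatch {i : ℕ} {t : LiftedTile} (h : t ∈ liftedPatch i) :
    InStep t := by
  induction i generalizing t with
  | zero =>
    simp only [liftedPatch, Finset.mem_image, Finset.mem_univ, true_and] at h
    obtain ⟨j, rfl⟩ := h
    simpa [InStep, height] using weight_pos j
  | succ i ih =>
    simp only [liftedPatch, Finset.mem_biUnion] at h
    obtain ⟨s, hs, h⟩ := h
    exact inStep_of_mem_inflate (ih hs) h

theorem mem_liftedPatch_succ {i : ℕ} {s t : LiftedTile} (hs : s ∈ liftedPatch i)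
    (h : t ∈ inflate s) : t ∈ liftedPatch (i + 1) :=
  Finset.mem_biUnion.2 ⟨s, hs, h⟩

/-- The union of the lifted patches. -/
def liftedTiling : Set LiftedTile := {t | ∃ i, t ∈ liftedPatch i}

theorem mem_liftedTiling_of_mem_inflate {s t : LiftedTile} (hs : s ∈ liftedTiling)
    (h : t ∈ inflate s) : t ∈ liftedTiling := by
  obtain ⟨i, hi⟩ := hs
  exact ⟨i + 1, mem_liftedPatch_succ hi h⟩

theorem inflate_zero (x : Fin 3 → ℤ) : inflate (x, 0) =
    {(recMatrix.mulVec x, 2), (recMatrix.mulVec x + ![1, 0, -1], 0),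
      (recMatrix.mulVec x + ![0, 1, -1], 1)} := by
  rw [← recMatrix_col_one, ← recMatrix_col_two]
  rfl

theorem inflate_one (x : Fin 3 → ℤ) : inflate (x, 1) = {(recMatrix.mulVec x, 0)} := rfl

theorem inflate_two (x : Fin 3 → ℤ) : inflate (x, 2) = {(recMatrix.mulVec x, 1)} := rfl

/-- A linear form `a + bλ + cλ²` with integer coefficients, given as a triple. -/
def lamForm (a : ℤ × ℤ × ℤ) : ℝ := a.1 + a.2.1 * lam + a.2.2 * lam ^ 2

/-- A sufficient criterion for `0 ≤ a + bλ + cλ²`, which uses rational bounds of `λ`, `λ²`. -/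
def lamNonneg (a : ℤ × ℤ × ℤ) : Bool :=
  0 ≤ 10000 * a.1 + min (5436 * a.2.1) (5437 * a.2.1) + min (2954 * a.2.2) (2957 * a.2.2)

theorem lamForm_nonneg {a : ℤ × ℤ × ℤ} (h : lamNonneg a) : 0 ≤ lamForm a := by
  obtain ⟨a, b, c⟩ := a
  simp only [lamNonneg, decide_eq_true_eq] at h
  have hR : (0 : ℝ) ≤
      10000 * a + min (5436 * (b : ℝ)) (5437 * b) + min (2954 * (c : ℝ)) (2957 * c) := by
    have := (Int.cast_le (R := ℝ)).2 h
    push_cast at this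
    exact this
  have hb : min (5436 * (b : ℝ)) (5437 * b) ≤ 10000 * (b * lam) := by
    rcases le_total 0 (b : ℝ) with hb | hb
    · exact (min_le_left _ _).trans (by nlinarith [lam_lower])
    · exact (min_le_right _ _).trans (by nlinarith [lam_upper])
  have hc : min (2954 * (c : ℝ)) (2957 * c) ≤ 10000 * (c * lam ^ 2) := by
    rcases le_total 0 (c : ℝ) with hc | hc
    · exact (min_le_left _ _).trans (by nlinarith [lam_sq_lower])
    · exact (min_le_right _ _).trans (by nlinarith [lam_sq_upper])
  simp only [lamForm]
  linarith

/-- The height of an integer vector, as a linear form in `λ` and `λ²`. -/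
def heightForm (d : Fin 3 → ℤ) : ℤ × ℤ × ℤ := (d 0, d 1 + d 2, d 1)

theorem lamForm_heightForm (d : Fin 3 → ℤ) : lamForm (heightForm d) = height d := by
  simp [lamForm, heightForm, height, weight]; ring

theorem lamForm_add (a b : ℤ × ℤ × ℤ) : lamForm (a + b) = lamForm a + lamForm b := by
  simp [lamForm]; ring

theorem lamForm_sub (a b : ℤ × ℤ × ℤ) : lamForm (a - b) = lamForm a - lamForm b := by
  simp [lamForm]; ring

/-- The five ways in which a face of the stepped plane arises by inflation. The entry
`(j, (lo, hi), q, s)` says that a face `(x, j)` whose height lies between `lamForm lo` and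
`lamForm hi` arises from the face `(M⁻¹ x - s, q)`. -/
def parents : List (Fin 3 × ((ℤ × ℤ × ℤ) × (ℤ × ℤ × ℤ)) × Fin 3 × (Fin 3 → ℤ)) :=
  [(0, ((0, 0, 0), (1, -1, 0)), 1, 0), (0, ((1, -1, 0), (1, 0, 0)), 0, ![0, 1, 0]),
    (1, ((0, 0, 0), (0, 0, 1)), 2, 0), (1, ((0, 0, 1), (0, 1, 1)), 0, ![0, 0, 1]),
    (2, ((0, 0, 0), (0, 1, 0)), 0, 0)]

theorem mem_inflate_of_mem_parents {p : Fin 3 × ((ℤ × ℤ × ℤ) × (ℤ × ℤ × ℤ)) × Fin 3 × (Fin 3 → ℤ)}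
    (hp : p ∈ parents) (x : Fin 3 → ℤ) :
    (x, p.1) ∈ inflate (recInv x - p.2.2.2, p.2.2.1) := by
  have h1 : x = recMatrix.mulVec (recInv x - ![0, 1, 0]) + ![1, 0, -1] := by
    rw [recMatrix_mulVec]
    ext i
    fin_cases i <;> simp [recInv]
    ring
  have h2 : x = recMatrix.mulVec (recInv x - ![0, 0, 1]) + ![0, 1, -1] := by
    rw [recMatrix_mulVec]
    ext i
    fin_cases i <;> simp [recInv]
    ring
  simp only [parents, List.mem_cons, List.not_mem_nil, or_false] at hp
  rcases hp with rfl | rfl | rfl | rfl | rfl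
  · simp [inflate_one, recMatrix_mulVec_recInv]
  · rw [inflate_zero, ← h1]; simp
  · simp [inflate_two, recMatrix_mulVec_recInv]
  · rw [inflate_zero, ← h2]; simp
  · simp [inflate_zero, recMatrix_mulVec_recInv]

/-- Every face of the stepped plane arises by inflation from a face of the stepped plane. -/
theorem exists_mem_parents {t : LiftedTile} (ht : InStep t) :
    ∃ p ∈ parents, p.1 = t.2 ∧ lamForm p.2.1.1 ≤ height t.1 ∧ height t.1 < lamForm p.2.1.2 ∧
      InStep (recInv t.1 - p.2.2.2, p.2.2.1) := by
  obtain ⟨x, j⟩ := t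
  obtain ⟨h0, h1⟩ := ht
  have hx := height_eq_lam_mul x
  have hl := lam_lower
  have hu := lam_upper
  have hc := lam_cube
  have hlp : 0 < lam := by linarith
  have key : ∀ (y : Fin 3 → ℤ) (q : Fin 3), lam * height y ≤ height x →
      height x < lam * (height y + weight q) → InStep (recInv x - y, q) := by
    intro y q h h'
    rw [hx] at h h'
    have := le_of_mul_le_mul_left h hlp
    have := lt_of_mul_lt_mul_left h' hlp.le
    constructor <;> simp only [height_sub] <;> linarith
  have e0 : height 0 = 0 := by simp [height]
  have e1 : height ![0, 1, 0] = lam + lam ^ 2 := by simp [height, weight]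
  have e2 : height ![0, 0, 1] = lam := by simp [height, weight]
  fin_cases j
  · simp [weight] at h0 h1
    rcases lt_or_ge (height x) (1 - lam) with h | h
    · refine ⟨_, List.mem_cons_self, rfl, by simpa [lamForm] using h0, ?_,
        key 0 _ (by simpa [e0] using h0) ?_⟩
      · simp [lamForm]; linarith
      · simp [e0, weight]; nlinarith
    · refine ⟨_, List.mem_cons_of_mem _ List.mem_cons_self, rfl, ?_, ?_, key ![0, 1, 0] 0 ?_ ?_⟩
      · simp [lamForm]; linarith
      · simp [lamForm]; linarith
      · simp [e1]; nlinarith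
      · simp [e1, weight]; nlinarith
  · simp [weight] at h0 h1
    rcases lt_or_ge (height x) (lam ^ 2) with h | h
    · refine ⟨(1, ((0, 0, 0), (0, 0, 1)), 2, 0), by simp [parents], rfl,
        by simpa [lamForm] using h0, ?_, key 0 _ (by simpa [e0] using h0) ?_⟩
      · simp [lamForm]; linarith
      · simp [e0, weight]; nlinarith
    · refine ⟨(1, ((0, 0, 1), (0, 1, 1)), 0, ![0, 0, 1]), by simp [parents], rfl, ?_, ?_,
        key ![0, 0, 1] 0 ?_ ?_⟩
      · simp [lamForm]; linarith
      · simp [lamForm]; linarith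
      · simp [e2]; nlinarith
      · simp [e2, weight]; nlinarith
  · simp [weight] at h0 h1
    refine ⟨(2, ((0, 0, 0), (0, 1, 0)), 0, 0), by simp [parents], rfl,
        by simpa [lamForm] using h0, ?_, key 0 _ (by simpa [e0] using h0) ?_⟩
    · simp [lamForm]; linarith
    · simp [e0, weight]; nlinarith

/-- The bounds in an entry of `parents` are those which put the parent into the stepped plane. -/
theorem lamForm_parents {p : Fin 3 × ((ℤ × ℤ × ℤ) × (ℤ × ℤ × ℤ)) × Fin 3 × (Fin 3 → ℤ)}
    (hp : p ∈ parents) : lamForm p.2.1.1 = lam * height p.2.2.2 ∧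
      lamForm p.2.1.2 = lam * (height p.2.2.2 + weight p.2.2.1) := by
  have hc := lam_cube
  simp only [parents, List.mem_cons, List.not_mem_nil, or_false] at hp
  rcases hp with rfl | rfl | rfl | rfl | rfl <;> simp [lamForm, height, weight] <;>
    first | linarith | exact ⟨by linarith, by linarith⟩

/-- Every face that arises by inflation arises in one of the five ways. -/
theorem exists_parents_of_mem_inflate {s t : LiftedTile} (h : t ∈ inflate s) (hs : InStep s) :
    ∃ p ∈ parents, p.1 = t.2 ∧ s = (recInv t.1 - p.2.2.2, p.2.2.1) ∧
      lamForm p.2.1.1 ≤ height t.1 ∧ height t.1 < lamForm p.2.1.2 := by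
  suffices ∃ p ∈ parents, p.1 = t.2 ∧ s = (recInv t.1 - p.2.2.2, p.2.2.1) by
    obtain ⟨p, hp, hpt, rfl⟩ := this
    refine ⟨p, hp, hpt, rfl, ?_⟩
    obtain ⟨h0, h1⟩ := hs
    have hl : 0 < lam := by linarith [lam_lower]
    rw [(lamForm_parents hp).1, (lamForm_parents hp).2, height_eq_lam_mul t.1]
    simp only [height_sub] at h0 h1
    exact ⟨mul_le_mul_of_nonneg_left (by linarith) hl.le,
      mul_lt_mul_of_pos_left (by linarith) hl⟩
  obtain ⟨x, j⟩ := s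
  have h1 : x = recInv (recMatrix.mulVec x + ![1, 0, -1]) - ![0, 1, 0] := by
    rw [recMatrix_mulVec]
    ext i
    fin_cases i <;> simp [recInv]
    ring
  have h2 : x = recInv (recMatrix.mulVec x + ![0, 1, -1]) - ![0, 0, 1] := by
    rw [recMatrix_mulVec]
    ext i
    fin_cases i <;> simp [recInv]
    ring
  fin_cases j
  · replace h : t ∈ inflate (x, 0) := h
    simp only [inflate_zero, Finset.mem_insert, Finset.mem_singleton] at h
    rcases h with rfl | rfl | rfl
    · exact ⟨(2, ((0, 0, 0), (0, 1, 0)), 0, 0), by simp [parents], rfl, by simp [recInv_mulVec]⟩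
    · exact ⟨(0, ((1, -1, 0), (1, 0, 0)), 0, ![0, 1, 0]), by simp [parents], rfl,
        Prod.ext h1 rfl⟩
    · exact ⟨(1, ((0, 0, 1), (0, 1, 1)), 0, ![0, 0, 1]), by simp [parents], rfl,
        Prod.ext h2 rfl⟩
  · obtain rfl := Finset.mem_singleton.1 h
    exact ⟨(0, ((0, 0, 0), (1, -1, 0)), 1, 0), by simp [parents], rfl, by simp [recInv_mulVec]⟩
  · obtain rfl := Finset.mem_singleton.1 h
    exact ⟨(1, ((0, 0, 0), (0, 0, 1)), 2, 0), by simp [parents], rfl, by simp [recInv_mulVec]⟩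

/-! ### The tiling contains all faces around its vertices -/

/-- The corners of the face `(0, j)`, in the same cyclic order as in `corner`. -/
def offset (j : Fin 3) : Fin 4 → Fin 3 → ℤ :=
  ![0, Pi.single (j + 1) 1, Pi.single (j + 1) 1 + Pi.single (j + 2) 1, Pi.single (j + 2) 1]

/-- The vectors `d` for which the faces `(x, j)` and `(x + d, j')` have a corner in common, and two
further vectors, which are needed for `mem_nearby_of_parents`. -/
def nearby (j j' : Fin 3) : List (Fin 3 → ℤ) :=
  ((List.finRange 4).flatMap fun a => (List.finRange 4).map fun b => offset j a - offset j' b) ++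
    if j = 0 ∧ j' = 0 then [![1, -1, 1], ![-1, 1, -1]] else []

set_option maxRecDepth 100000 in
/-- A finite check: if two faces of the stepped plane differ by a vector of `nearby`, then so do their
parents. The first two alternatives exclude the heights which `parents` prescribes. -/
theorem nearby_parents_check : ∀ p ∈ parents, ∀ p' ∈ parents, ∀ d ∈ nearby p.1 p'.1,
    lamNonneg (p'.2.1.1 - heightForm d - p.2.1.2) ∨
    lamNonneg (p.2.1.1 + heightForm d - p'.2.1.2) ∨
    recInv d - p'.2.2.2 + p.2.2.2 ∈ nearby p.2.2.1 p'.2.2.1 := by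
  decide

set_option maxRecDepth 100000 in
/-- A finite check: a face `(d, j')` near a face `(0, j)` has negative height, or is too high for the
stepped plane, or belongs to the fourth patch. The inequality `-100 h - 1 ≥ 0` serves as a strict
form of `h < 0`. -/
theorem nearby_zero_check : ∀ j j' : Fin 3, ∀ d ∈ nearby j j',
    lamNonneg (-(100 • heightForm d) - (1, 0, 0)) ∨
    lamNonneg (heightForm d - ![(1, 0, 0), (0, 1, 1), (0, 1, 0)] j') ∨
    (d, j') ∈ liftedPatch 4 := by
  decide

theorem offset_eq_of_nearby {j j' : Fin 3} {a b : Fin 4} {d : Fin 3 → ℤ}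
    (h : offset j a = d + offset j' b) : d ∈ nearby j j' := by
  refine List.mem_append_left _ (List.mem_flatMap.2 ⟨a, List.mem_finRange a, ?_⟩)
  exact List.mem_map.2 ⟨b, List.mem_finRange b, by rw [h]; abel⟩

/-- Nearby faces have nearby parents. -/
theorem mem_nearby_of_parents {t t' : LiftedTile}
    {p p' : Fin 3 × ((ℤ × ℤ × ℤ) × (ℤ × ℤ × ℤ)) × Fin 3 × (Fin 3 → ℤ)}
    (hp : p ∈ parents) (hp' : p' ∈ parents) (ht : p.1 = t.2) (ht' : p'.1 = t'.2)
    (h1 : lamForm p.2.1.1 ≤ height t.1) (h2 : height t.1 < lamForm p.2.1.2)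
    (h1' : lamForm p'.2.1.1 ≤ height t'.1) (h2' : height t'.1 < lamForm p'.2.1.2)
    (hd : t'.1 - t.1 ∈ nearby t.2 t'.2) :
    (recInv t'.1 - p'.2.2.2) - (recInv t.1 - p.2.2.2) ∈ nearby p.2.2.1 p'.2.2.1 := by
  rcases nearby_parents_check p hp p' hp' _ (ht ▸ ht' ▸ hd) with h | h | h
  · have := lamForm_nonneg h
    rw [lamForm_sub, lamForm_sub, lamForm_heightForm, height_sub] at this
    linarith
  · have := lamForm_nonneg h
    rw [lamForm_sub, lamForm_add, lamForm_heightForm, height_sub] at this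
    linarith
  · rw [recInv_sub] at h
    convert h using 1
    abel

/-- A face of the stepped plane near a face of some patch belongs to some patch: passing to the
parents reduces the number of the patch until it is zero. -/
theorem mem_liftedTiling_of_nearby {i : ℕ} {t t' : LiftedTile} (ht : t ∈ liftedPatch i)
    (ht' : InStep t') (hd : t'.1 - t.1 ∈ nearby t.2 t'.2) : t' ∈ liftedTiling := by
  induction i generalizing t t' with
  | zero =>
    simp only [liftedPatch, Finset.mem_image, Finset.mem_univ, true_and] at ht
    obtain ⟨j, rfl⟩ := ht
    obtain ⟨x, j'⟩ := t'
    simp only [sub_zero] at hd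
    obtain ⟨h0, h1⟩ := ht'
    rcases nearby_zero_check j j' x hd with h | h | h
    · have := lamForm_nonneg h
      have e : lamForm (-(100 • heightForm x) - (1, 0, 0)) = -(100 * height x) - 1 := by
        rw [← lamForm_heightForm]
        simp [lamForm]
        ring
      rw [e] at this
      simp only at h0
      linarith
    · have := lamForm_nonneg h
      have e : lamForm (![(1, 0, 0), (0, 1, 1), (0, 1, 0)] j') = weight j' := by
        fin_cases j' <;> simp [lamForm, weight]
      rw [lamForm_sub, lamForm_heightForm, e] at this
      simp only at h1
      linarith
    · exact ⟨4, h⟩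
  | succ i ih =>
    simp only [liftedPatch, Finset.mem_biUnion] at ht
    obtain ⟨s, hs, hst⟩ := ht
    obtain ⟨p, hp, hpt, rfl, h1, h2⟩ :=
      exists_parents_of_mem_inflate hst (inStep_of_mem_liftedPatch hs)
    obtain ⟨p', hp', hpt', h1', h2', hs'⟩ := exists_mem_parents ht'
    have hst' := mem_inflate_of_mem_parents hp' t'.1
    rw [hpt'] at hst'
    exact mem_liftedTiling_of_mem_inflate
      (ih hs hs' (mem_nearby_of_parents hp hp' hpt hpt' h1 h2 h1' h2' hd)) hst'

/-! ### Opposite neighbours in a patch -/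

/-- The points of `ℤ³` which are corners of the faces of the `i`-th patch. -/
def liftedVertices (i : ℕ) : Set (Fin 3 → ℤ) :=
  {x | ∃ t ∈ liftedPatch i, ∃ a, x = t.1 + offset t.2 a}

theorem add_offset_mem {i : ℕ} {x : Fin 3 → ℤ} {j : Fin 3} (h : (x, j) ∈ liftedPatch i)
    (a : Fin 4) {y : Fin 3 → ℤ} (hy : y = x + offset j a) : y ∈ liftedVertices i :=
  ⟨_, h, a, hy⟩

theorem liftedPatch_zero_mem (j : Fin 3) : ((0, j) : LiftedTile) ∈ liftedPatch 0 :=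
  Finset.mem_image_of_mem _ (Finset.mem_univ j)

theorem eq_zero_of_mem_liftedPatch_zero {t : LiftedTile} (h : t ∈ liftedPatch 0) : t.1 = 0 := by
  simp only [liftedPatch, Finset.mem_image, Finset.mem_univ, true_and] at h
  obtain ⟨j, rfl⟩ := h
  rfl

theorem exists_of_mem_liftedPatch_succ {i : ℕ} {t : LiftedTile} (h : t ∈ liftedPatch (i + 1)) :
    ∃ s ∈ liftedPatch i, t ∈ inflate s :=
  Finset.mem_biUnion.1 h

theorem inflate_zero_mem {i : ℕ} {y : Fin 3 → ℤ} (h : (y, 0) ∈ liftedPatch i) :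
    (recMatrix.mulVec y, 2) ∈ liftedPatch (i + 1) ∧
      (recMatrix.mulVec y + ![1, 0, -1], 0) ∈ liftedPatch (i + 1) ∧
      (recMatrix.mulVec y + ![0, 1, -1], 1) ∈ liftedPatch (i + 1) := by
  refine ⟨mem_liftedPatch_succ h ?_, mem_liftedPatch_succ h ?_, mem_liftedPatch_succ h ?_⟩ <;>
    rw [inflate_zero] <;> simp only [Finset.mem_insert, Finset.mem_singleton, true_or, or_true]

theorem inflate_one_mem {i : ℕ} {y : Fin 3 → ℤ} (h : (y, 1) ∈ liftedPatch i) :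
    (recMatrix.mulVec y, 0) ∈ liftedPatch (i + 1) :=
  mem_liftedPatch_succ h (Finset.mem_singleton_self _)

theorem inflate_two_mem {i : ℕ} {y : Fin 3 → ℤ} (h : (y, 2) ∈ liftedPatch i) :
    (recMatrix.mulVec y, 1) ∈ liftedPatch (i + 1) :=
  mem_liftedPatch_succ h (Finset.mem_singleton_self _)

theorem exists_of_mem_succ_zero {i : ℕ} {x : Fin 3 → ℤ} (h : (x, 0) ∈ liftedPatch (i + 1)) :
    (∃ y, (y, 0) ∈ liftedPatch i ∧ x = recMatrix.mulVec y + ![1, 0, -1]) ∨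
      ∃ y, (y, 1) ∈ liftedPatch i ∧ x = recMatrix.mulVec y := by
  obtain ⟨⟨y, q⟩, hs, hst⟩ := exists_of_mem_liftedPatch_succ h
  fin_cases q
  · exact .inl ⟨y, hs, by simpa only [inflate_zero, Finset.mem_insert, Finset.mem_singleton,
      Prod.mk.injEq, Fin.reduceEq, and_false, or_false, false_or, and_true] using
        (show (x, 0) ∈ inflate (y, 0) from hst)⟩
  · exact .inr ⟨y, hs, by simpa only [inflate_one, Finset.mem_singleton, Prod.mk.injEq,
      and_true] using (show (x, 0) ∈ inflate (y, 1) from hst)⟩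
  · exact absurd (show (x, 0) ∈ inflate (y, 2) from hst) (by simp [inflate_two])

theorem exists_of_mem_succ_one {i : ℕ} {x : Fin 3 → ℤ} (h : (x, 1) ∈ liftedPatch (i + 1)) :
    (∃ y, (y, 0) ∈ liftedPatch i ∧ x = recMatrix.mulVec y + ![0, 1, -1]) ∨
      ∃ y, (y, 2) ∈ liftedPatch i ∧ x = recMatrix.mulVec y := by
  obtain ⟨⟨y, q⟩, hs, hst⟩ := exists_of_mem_liftedPatch_succ h
  fin_cases q
  · exact .inl ⟨y, hs, by simpa only [inflate_zero, Finset.mem_insert, Finset.mem_singleton,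
      Prod.mk.injEq, Fin.reduceEq, and_false, or_false, false_or, and_true] using
        (show (x, 1) ∈ inflate (y, 0) from hst)⟩
  · exact absurd (show (x, 1) ∈ inflate (y, 1) from hst) (by simp [inflate_one])
  · exact .inr ⟨y, hs, by simpa only [inflate_two, Finset.mem_singleton, Prod.mk.injEq,
      and_true] using (show (x, 1) ∈ inflate (y, 2) from hst)⟩

theorem exists_of_mem_succ_two {i : ℕ} {x : Fin 3 → ℤ} (h : (x, 2) ∈ liftedPatch (i + 1)) :
    ∃ y, (y, 0) ∈ liftedPatch i ∧ x = recMatrix.mulVec y := by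
  obtain ⟨⟨y, q⟩, hs, hst⟩ := exists_of_mem_liftedPatch_succ h
  fin_cases q
  · exact ⟨y, hs, by simpa only [inflate_zero, Finset.mem_insert, Finset.mem_singleton,
      Prod.mk.injEq, Fin.reduceEq, and_false, or_false, false_or, and_true] using
        (show (x, 2) ∈ inflate (y, 0) from hst)⟩
  · exact absurd (show (x, 2) ∈ inflate (y, 1) from hst) (by simp [inflate_one])
  · exact absurd (show (x, 2) ∈ inflate (y, 2) from hst) (by simp [inflate_two])

theorem vec_eq {x y : Fin 3 → ℤ} (h0 : x 0 = y 0) (h1 : x 1 = y 1) (h2 : x 2 = y 2) : x = y := by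
  ext i
  fin_cases i <;> assumption

/-- The opposite neighbours of the two middle corners of a face, in the direction which is no side of
the face: the case of a face of the third type. The required vertex belongs to another face with
the same parent. -/
theorem sub_two_mem {i : ℕ} {x : Fin 3 → ℤ} (h : (x, 2) ∈ liftedPatch (i + 1))
    {c : Fin 3} (hc : c ≠ 2) : x + Pi.single c 1 - Pi.single 2 1 ∈ liftedVertices (i + 1) := by
  obtain ⟨y, hy, rfl⟩ := exists_of_mem_succ_two h
  obtain ⟨-, h0, h1⟩ := inflate_zero_mem hy
  fin_cases c
  · exact add_offset_mem h0 0 (vec_eq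
      (by simp [offset, -Matrix.add_cons, -Matrix.cons_add])
      (by simp [offset, -Matrix.add_cons, -Matrix.cons_add])
      (by simp [offset, -Matrix.add_cons, -Matrix.cons_add]; ring))
  · exact add_offset_mem h1 0 (vec_eq
      (by simp [offset, -Matrix.add_cons, -Matrix.cons_add])
      (by simp [offset, -Matrix.add_cons, -Matrix.cons_add])
      (by simp [offset, -Matrix.add_cons, -Matrix.cons_add]; ring))
  · exact absurd rfl hc

/-- The case of a face of the second type. If its parent is of the third type, then the
required vertex is found among the faces with the same grandparent. -/
theorem sub_one_mem {i : ℕ} {x : Fin 3 → ℤ} (h : (x, 1) ∈ liftedPatch (i + 1))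
    {c : Fin 3} (hc : c ≠ 1) (hx : height (x + Pi.single c 1) < total - weight 1)
    (hx' : weight 1 ≤ height (x + Pi.single c 1)) :
    x + Pi.single c 1 + Pi.single 1 1 ∈ liftedVertices (i + 1) ∨
      x + Pi.single c 1 - Pi.single 1 1 ∈ liftedVertices (i + 1) := by
  obtain ⟨y, hy, rfl⟩ | ⟨y, hy, rfl⟩ := exists_of_mem_succ_one h
  · obtain ⟨h2, h0, -⟩ := inflate_zero_mem hy
    right
    fin_cases c
    · exact add_offset_mem h0 0 (vec_eq
        (by simp [offset, -Matrix.add_cons, -Matrix.cons_add])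
        (by simp [offset, -Matrix.add_cons, -Matrix.cons_add])
        (by simp [offset, -Matrix.add_cons, -Matrix.cons_add]))
    · exact absurd rfl hc
    · exact add_offset_mem h2 0 (vec_eq
        (by simp [offset, -Matrix.add_cons, -Matrix.cons_add])
        (by simp [offset, -Matrix.add_cons, -Matrix.cons_add])
        (by simp [offset, -Matrix.add_cons, -Matrix.cons_add]))
  · have hyS := inStep_of_mem_liftedPatch hy
    fin_cases c
    · cases i with
      | zero =>
        left
        obtain rfl : y = 0 := eq_zero_of_mem_liftedPatch_zero hy
        refine add_offset_mem (inflate_zero_mem (liftedPatch_zero_mem 0)).1 2 ?_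
        simp [offset]
      | succ i =>
        right
        obtain ⟨v, hv, rfl⟩ := exists_of_mem_succ_two hy
        refine add_offset_mem (inflate_one_mem (inflate_zero_mem hv).2.2) 0 ?_
        simp only [recMatrix_mulVec]
        exact vec_eq
            (by simp [offset, -Matrix.add_cons, -Matrix.cons_add])
            (by simp [offset, -Matrix.add_cons, -Matrix.cons_add]; ring)
            (by simp [offset, -Matrix.add_cons, -Matrix.cons_add]; ring)
    · exact absurd rfl hc
    · -- Here the height of the point is too small.
      exfalso
      have := hyS.2
      rw [height_add, height_mulVec, height_single] at hx'
      simp [weight] at this hx'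
      nlinarith [lam_lower]

/-- The case of a face of the first type. If its parent is of the second type, then the
required vertex is found among the faces with the same grandparent. -/
theorem sub_zero_mem {i : ℕ} {x : Fin 3 → ℤ} (h : (x, 0) ∈ liftedPatch (i + 1))
    {c : Fin 3} (hc : c ≠ 0) (hx : height (x + Pi.single c 1) < total - weight 0)
    (hx' : weight 0 ≤ height (x + Pi.single c 1)) :
    x + Pi.single c 1 - Pi.single 0 1 ∈ liftedVertices (i + 1) := by
  have hl := lam_lower
  have hcube := lam_cube
  obtain ⟨y, hy, rfl⟩ | ⟨y, hy, rfl⟩ := exists_of_mem_succ_zero h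
  · obtain ⟨h2, -, h1⟩ := inflate_zero_mem hy
    fin_cases c
    · exact absurd rfl hc
    · exact add_offset_mem h1 0 (vec_eq
        (by simp [offset, -Matrix.add_cons, -Matrix.cons_add])
        (by simp [offset, -Matrix.add_cons, -Matrix.cons_add])
        (by simp [offset, -Matrix.add_cons, -Matrix.cons_add]))
    · exact add_offset_mem h2 0 (vec_eq
        (by simp [offset, -Matrix.add_cons, -Matrix.cons_add])
        (by simp [offset, -Matrix.add_cons, -Matrix.cons_add])
        (by simp [offset, -Matrix.add_cons, -Matrix.cons_add]))
  · have hyS := (inStep_of_mem_liftedPatch hy).2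
    rw [height_add, height_mulVec, height_single] at hx'
    fin_cases c
    · exact absurd rfl hc
    · simp [weight] at hyS hx'
      have hy2 : lam ^ 2 ≤ height y := by nlinarith
      cases i with
      | zero =>
        obtain rfl : y = 0 := eq_zero_of_mem_liftedPatch_zero hy
        simp [height] at hy2
        nlinarith
      | succ i =>
        obtain ⟨v, hv, rfl⟩ | ⟨v, hv, rfl⟩ := exists_of_mem_succ_one hy
        · refine add_offset_mem (inflate_two_mem (inflate_zero_mem hv).1) 0 ?_
          simp only [recMatrix_mulVec]
          exact vec_eq
              (by simp [offset, -Matrix.add_cons, -Matrix.cons_add])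
              (by simp [offset, -Matrix.add_cons, -Matrix.cons_add])
              (by simp [offset, -Matrix.add_cons, -Matrix.cons_add]; ring)
        · have := (inStep_of_mem_liftedPatch hv).2
          rw [height_mulVec] at hy2
          simp [weight] at this
          nlinarith
    · -- Here the height of the point is too small.
      exfalso
      simp [weight] at hyS hx'
      nlinarith

theorem single_add_single : ∀ {c n : Fin 3}, c ≠ n →
    (Pi.single c 1 + Pi.single n 1 : Fin 3 → ℤ) = offset (-(n + c)) 2 := by
  decide

/-- If a vertex of the patch has both neighbours in direction `e_j` in the stepped plane, then one
of these is a vertex of the patch. -/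
theorem add_or_sub_mem {i : ℕ} {z : Fin 3 → ℤ} (hz : z ∈ liftedVertices i) {j : Fin 3}
    (h1 : weight j ≤ height z) (h2 : height z < total - weight j) :
    z + Pi.single j 1 ∈ liftedVertices i ∨ z - Pi.single j 1 ∈ liftedVertices i := by
  obtain ⟨⟨x, n⟩, hx, a, rfl⟩ := hz
  have hS := inStep_of_mem_liftedPatch hx
  have hS0 := hS.1
  have hS1 := hS.2
  have key : ∀ b : Fin 4, offset n a + Pi.single j 1 = offset n b ∨
      offset n a - Pi.single j 1 = offset n b →
      x + offset n a + Pi.single j 1 ∈ liftedVertices i ∨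
      x + offset n a - Pi.single j 1 ∈ liftedVertices i := by
    rintro b (h | h)
    · exact .inl (add_offset_mem hx b (by rw [add_assoc, h]))
    · exact .inr (add_offset_mem hx b (by rw [add_sub_assoc, h]))
  by_cases hj : n = j
  · subst hj
    have htot := total_eq n
    -- Of the four corners, the first is too low and the third is too high.
    obtain ⟨c, hc, ha⟩ : ∃ c, c ≠ n ∧ offset n a = Pi.single c 1 := by
      fin_cases a
      · simp [offset] at h1
        simp at hS1
        linarith
      · exact ⟨n + 1, by simp, rfl⟩
      · simp [offset] at h2
        simp only [height_add, height_single] at h2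
        simp at hS0
        linarith
      · exact ⟨n + 2, by simp, rfl⟩
    simp only [ha] at h1 h2 ⊢
    cases i with
    | zero =>
      left
      obtain rfl : x = 0 := eq_zero_of_mem_liftedPatch_zero hx
      exact add_offset_mem (liftedPatch_zero_mem (-(n + c))) 2
        (by rw [zero_add, zero_add, single_add_single hc])
    | succ i =>
      fin_cases n
      · exact .inr (sub_zero_mem hx hc h2 h1)
      · exact sub_one_mem hx hc h2 h1
      · exact .inr (sub_two_mem hx hc)
  · have : ∃ b : Fin 4, offset n a + Pi.single j 1 = offset n b ∨
        offset n a - Pi.single j 1 = offset n b := by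
      clear key hS hS0 hS1 h1 h2 hx
      decide +revert
    obtain ⟨b, hb⟩ := this
    exact key b hb

/-! ### Directions and heights in the plane -/

/-- The six directions of edges: `(j, true)` stands for `p(e_j)` and `(j, false)` for `-p(e_j)`. -/
abbrev Direction : Type := Fin 3 × Bool

namespace Direction

/-- The opposite direction. -/
def opp (d : Direction) : Direction := (d.1, !d.2)

/-- The vector of a direction. -/
def vec (d : Direction) : Lattice := if d.2 then dir d.1 else -dir d.1

/-- The change of the height along an edge. -/
def wt (d : Direction) : ℝ := if d.2 then weight d.1 else -weight d.1

/-- The vector `-p(e_j)` for the direction `-p(e_j)`, and zero for `p(e_j)`. -/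
def negPart (d : Direction) : Lattice := if d.2 then 0 else -dir d.1

@[simp] theorem opp_opp (d : Direction) : d.opp.opp = d := by simp [opp]

@[simp] theorem opp_fst (d : Direction) : d.opp.1 = d.1 := rfl

theorem vec_opp (d : Direction) : d.opp.vec = -d.vec := by
  obtain ⟨j, _ | _⟩ := d <;> simp [opp, vec]

theorem wt_opp (d : Direction) : d.opp.wt = -d.wt := by
  obtain ⟨j, _ | _⟩ := d <;> simp [opp, wt]

theorem eq_or_eq_opp {d d' : Direction} (h : d.1 = d'.1) : d' = d ∨ d' = d.opp := by
  obtain ⟨j, b⟩ := d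
  obtain ⟨j', b'⟩ := d'
  obtain rfl : j = j' := h
  cases b <;> cases b' <;> simp [opp]

theorem vec_injective : Function.Injective vec := by
  intro d d' h
  revert d d'
  decide

end Direction

open Direction

/-- The height in `[0, total)` of the unique point of the stepped plane above a point of the
lattice. -/
def planeHeight (v : Lattice) : ℝ :=
  toIcoMod total_pos 0 (v.1 * weight 1 + v.2 * weight 2)

theorem planeHeight_nonneg (v : Lattice) : 0 ≤ planeHeight v :=
  (toIcoMod_mem_Ico' total_pos _).1

theorem planeHeight_lt (v : Lattice) : planeHeight v < total :=
  (toIcoMod_mem_Ico' total_pos _).2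

theorem planeHeight_proj {x : Fin 3 → ℤ} (h0 : 0 ≤ height x) (h1 : height x < total) :
    planeHeight (proj x) = height x := by
  refine (toIcoMod_eq_iff total_pos).2 ⟨⟨h0, by rwa [zero_add]⟩, -x 0, ?_⟩
  simp [proj, height, total]
  ring

/-- Every point of the lattice lifts to the stepped plane: one may add multiples of `(1, 1, 1)`, which
spans the kernel of the projection. -/
theorem exists_lift (v : Lattice) : ∃ x, proj x = v ∧ height x = planeHeight v := by
  have := toIcoMod_add_toIcoDiv_zsmul total_pos 0 (v.1 * weight 1 + v.2 * weight 2)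
  change planeHeight v + _ = _ at this
  set n := toIcoDiv total_pos 0 (v.1 * weight 1 + v.2 * weight 2)
  refine ⟨![-n, v.1 - n, v.2 - n], ?_, ?_⟩
  · ext <;> simp [proj]
  · rw [zsmul_eq_mul] at this
    simp [height]
    rw [total] at this
    linarith

theorem planeHeight_add {v : Lattice} {d : Direction} (h0 : 0 ≤ planeHeight v + d.wt)
    (h1 : planeHeight v + d.wt < total) : planeHeight (v + d.vec) = planeHeight v + d.wt := by
  obtain ⟨x, rfl, hx⟩ := exists_lift v
  rw [← hx] at h0 h1 ⊢
  obtain ⟨j, _ | _⟩ := d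
  · have := planeHeight_proj (x := x - Pi.single j 1)
    rw [height_sub, height_single] at this
    simp only [wt, vec, Bool.false_eq_true, if_false] at h0 h1 ⊢
    rw [← sub_eq_add_neg] at h0 h1
    rw [← sub_eq_add_neg, ← sub_eq_add_neg, ← this h0 h1, dir]
    congr 1
    ext <;> simp [proj] <;> ring
  · have := planeHeight_proj (x := x + Pi.single j 1)
    rw [height_add, height_single, proj_add] at this
    exact this h0 h1

theorem eq_of_proj_eq {x y : Fin 3 → ℤ} (h : proj x = proj y) (hx : 0 ≤ height x)
    (hx' : height x < total) (hy : 0 ≤ height y) (hy' : height y < total) : x = y := by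
  have h1 := congrArg Prod.fst h
  have h2 := congrArg Prod.snd h
  simp only [proj] at h1 h2
  have hh : height x = height y := by
    rw [← planeHeight_proj hx hx', h, planeHeight_proj hy hy']
  have e1 : ((x 1 - x 0 : ℤ) : ℝ) = ((y 1 - y 0 : ℤ) : ℝ) := by rw [h1]
  have e2 : ((x 2 - x 0 : ℤ) : ℝ) = ((y 2 - y 0 : ℤ) : ℝ) := by rw [h2]
  push_cast at e1 e2
  have h0 : ((x 0 : ℤ) : ℝ) = y 0 := by
    have ht := total_pos
    simp only [height, total] at hh ht
    have : ((x 0 : ℝ) - y 0) * (weight 0 + weight 1 + weight 2) = 0 := by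
      linear_combination hh - weight 1 * e1 - weight 2 * e2
    rcases mul_eq_zero.1 this with h | h
    · linarith
    · linarith
  have h0 : x 0 = y 0 := by exact_mod_cast h0
  exact vec_eq h0 (by omega) (by omega)

/-- The projection of the faces of the stepped plane to the plane. -/
def steppedPlane : Set Tile := {t | planeHeight t.1 < weight t.2}

theorem weight_lt_total (j : Fin 3) : weight j < total := by
  have := total_eq j
  have := weight_pos (j + 1)
  have := weight_pos (j + 2)
  linarith

theorem InStep.planeHeight_eq {t : LiftedTile} (h : InStep t) :
    planeHeight (proj t.1) = height t.1 :=
  planeHeight_proj h.1 (h.2.trans (weight_lt_total _))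

theorem tiling_subset : tiling ⊆ steppedPlane := by
  rintro t ⟨i, hi⟩
  obtain ⟨s, hs, rfl⟩ := Finset.mem_image.1 hi
  have hs := inStep_of_mem_liftedPatch hs
  change planeHeight (proj s.1) < _
  rw [hs.planeHeight_eq]
  exact hs.2

theorem proj_offset (x : Fin 3 → ℤ) (j : Fin 3) (a : Fin 4) :
    proj (x + offset j a) = corner (proj x, j) a := by
  rw [proj_add]
  fin_cases a <;> simp [offset, corner, dir, proj_add, add_assoc]
  ext <;> simp [proj]

theorem height_offset_nonneg (j : Fin 3) (a : Fin 4) : 0 ≤ height (offset j a) := by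
  have h1 := weight_pos (j + 1)
  have h2 := weight_pos (j + 2)
  fin_cases a <;> simp [offset, height_add, height_single] <;> first | linarith | simp [height]

theorem height_offset_le (j : Fin 3) (a : Fin 4) : height (offset j a) ≤ total - weight j := by
  have h1 := weight_pos (j + 1)
  have h2 := weight_pos (j + 2)
  have := total_eq j
  have h0 : height 0 = 0 := by simp [height]
  fin_cases a <;> simp [offset, height_add, height_single, h0] <;> linarith

theorem InStep.height_corner {t : LiftedTile} (h : InStep t) (a : Fin 4) :
    0 ≤ height (t.1 + offset t.2 a) ∧ height (t.1 + offset t.2 a) < total := by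
  have := h.1
  have := h.2
  have := height_offset_nonneg t.2 a
  have := height_offset_le t.2 a
  rw [height_add]
  constructor <;> linarith

/-- All faces of the stepped plane at a vertex of the tiling belong to the tiling. -/
theorem mem_tiling_of_corner_eq {t t' : Tile} (ht : t ∈ tiling) (ht' : t' ∈ steppedPlane)
    {a b : Fin 4} (h : corner t a = corner t' b) : t' ∈ tiling := by
  obtain ⟨i, hi⟩ := ht
  obtain ⟨s, hs, rfl⟩ := Finset.mem_image.1 hi
  have hsS := inStep_of_mem_liftedPatch hs
  obtain ⟨v', j'⟩ := t'
  obtain ⟨x', rfl, hx'⟩ := exists_lift v'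
  have hS' : InStep (x', j') :=
    ⟨hx' ▸ planeHeight_nonneg _, lt_of_eq_of_lt hx' ht'⟩
  rw [← proj_offset, ← proj_offset] at h
  have hc := hsS.height_corner a
  have hc' := hS'.height_corner b
  have := eq_of_proj_eq h hc.1 hc.2 hc'.1 hc'.2
  have hd : x' - s.1 ∈ nearby s.2 j' := by
    refine offset_eq_of_nearby (a := a) (b := b) ?_
    rw [sub_add_eq_add_sub, ← this]
    abel
  obtain ⟨m, hm⟩ := mem_liftedTiling_of_nearby hs hS' hd
  exact ⟨m, Finset.mem_image.2 ⟨_, hm, rfl⟩⟩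

/-- The point is a corner of a rhombus of the `i`-th patch. -/
def InPatch (i : ℕ) (v : Lattice) : Prop := ∃ t ∈ patch i, ∃ a, v = corner t a

/-- If a vertex of a patch has both neighbours on a line in the stepped plane, then one of
these is a vertex of the patch. -/
theorem InPatch.add_or_sub {i : ℕ} {v : Lattice} (h : InPatch i v) {j : Fin 3}
    (h1 : weight j ≤ planeHeight v) (h2 : planeHeight v + weight j < total) :
    InPatch i (v + dir j) ∨ InPatch i (v - dir j) := by
  obtain ⟨t, ht, a, rfl⟩ := h
  obtain ⟨s, hs, rfl⟩ := Finset.mem_image.1 ht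
  have hc := (inStep_of_mem_liftedPatch hs).height_corner a
  rw [← proj_offset] at h1 h2 ⊢
  rw [planeHeight_proj hc.1 hc.2] at h1 h2
  have hV : ∀ y ∈ liftedVertices i, InPatch i (proj y) := by
    rintro y ⟨r, hr, b, rfl⟩
    exact ⟨(proj r.1, r.2), Finset.mem_image_of_mem _ hr, b, proj_offset _ _ _⟩
  rcases add_or_sub_mem (z := s.1 + offset s.2 a) ⟨s, hs, a, rfl⟩ h1 (by linarith) with h | h
  · left
    have := hV _ h
    rwa [proj_add] at this
  · right
    convert hV _ h using 1
    ext <;> simp [dir, proj] <;> ring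

/-! ### The rhombi at a vertex -/

theorem corner_eq (t : Tile) (a : Fin 4) : corner t a = t.1 + corner (0, t.2) a := by
  fin_cases a <;> simp [corner, add_assoc]

/-- The side `{u, v}` of a rhombus, seen from its end `u`. -/
theorem isSide_iff {t : Tile} {u v : Lattice} :
    IsSide t u v ↔ ∃ b s : Fin 4, (s = 1 ∨ s = 3) ∧ u = corner t b ∧ v = corner t (b + s) := by
  constructor
  · rintro ⟨a, ⟨rfl, rfl⟩ | ⟨rfl, rfl⟩⟩
    · exact ⟨a, 1, .inl rfl, rfl, rfl⟩
    · refine ⟨a + 1, 3, .inr rfl, rfl, ?_⟩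
      rw [add_assoc]
      simp
  · rintro ⟨b, s, rfl | rfl, rfl, rfl⟩
    · exact ⟨b, .inl ⟨rfl, rfl⟩⟩
    · refine ⟨b + 3, .inr ⟨rfl, ?_⟩⟩
      rw [add_assoc]
      simp

theorem IsSide.symm {t : Tile} {u v : Lattice} (h : IsSide t u v) : IsSide t v u := by
  obtain ⟨a, h⟩ := h
  exact ⟨a, h.symm⟩

theorem corner_injective (t : Tile) : Function.Injective (corner t) := by
  have : ∀ (n : Fin 3) (a b : Fin 4), corner (0, n) a = corner (0, n) b → a = b := by decide
  intro a b h
  rw [corner_eq, corner_eq t b] at h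
  exact this _ _ _ (add_left_cancel h)

theorem exists_direction {t : Tile} {u v : Lattice} (h : IsSide t u v) :
    ∃ d : Direction, d.1 ≠ t.2 ∧ v = u + d.vec := by
  have key : ∀ (n : Fin 3) (b s : Fin 4), s = 1 ∨ s = 3 → ∃ d : Direction, d.1 ≠ n ∧
      corner (0, n) (b + s) = corner (0, n) b + d.vec := by decide
  obtain ⟨b, s, hs, rfl, rfl⟩ := isSide_iff.1 h
  obtain ⟨d, hd, h⟩ := key t.2 b s hs
  exact ⟨d, hd, by rw [corner_eq, h, corner_eq t b, add_assoc]⟩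

/-- The rhombus which is spanned by two directions of different lines at a point. The sum of the
three indices in `Fin 3` is zero, so that its type is the negative of the sum of the other two. -/
def tileAt (v : Lattice) (d d' : Direction) : Tile :=
  (v + d.negPart + d'.negPart, -(d.1 + d'.1))

theorem tileAt_comm (v : Lattice) (d d' : Direction) : tileAt v d d' = tileAt v d' d :=
  Prod.ext (add_right_comm _ _ _) (by rw [tileAt, tileAt, add_comm d.1])

theorem tileAt_opp (v : Lattice) (d d' : Direction) :
    tileAt (v + d.vec) d.opp d' = tileAt v d d' := by
  refine Prod.ext ?_ rfl
  obtain ⟨j, _ | _⟩ := d <;> simp [tileAt, vec, opp, Direction.negPart]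

/-- The corners of the rhombus which is spanned by two directions. -/
theorem exists_corner_tileAt (v : Lattice) {d d' : Direction} (h : d.1 ≠ d'.1) :
    ∃ c, v = corner (tileAt v d d') c ∧
      v + d.vec + d'.vec = corner (tileAt v d d') (c + 2) ∧
      ((v + d.vec = corner (tileAt v d d') (c + 1) ∧ v + d'.vec = corner (tileAt v d d') (c + 3)) ∨
      (v + d'.vec = corner (tileAt v d d') (c + 1) ∧
        v + d.vec = corner (tileAt v d d') (c + 3))) := by
  have key : ∀ d d' : Direction, d.1 ≠ d'.1 → ∃ c,
      0 = d.negPart + d'.negPart + corner (0, -(d.1 + d'.1)) c ∧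
      d.vec + d'.vec = d.negPart + d'.negPart + corner (0, -(d.1 + d'.1)) (c + 2) ∧
      ((d.vec = d.negPart + d'.negPart + corner (0, -(d.1 + d'.1)) (c + 1) ∧
        d'.vec = d.negPart + d'.negPart + corner (0, -(d.1 + d'.1)) (c + 3)) ∨
      (d'.vec = d.negPart + d'.negPart + corner (0, -(d.1 + d'.1)) (c + 1) ∧
        d.vec = d.negPart + d'.negPart + corner (0, -(d.1 + d'.1)) (c + 3))) := by decide
  have hc : ∀ c, corner (tileAt v d d') c =
      v + (d.negPart + d'.negPart + corner (0, -(d.1 + d'.1)) c) := fun c => by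
    rw [corner_eq]
    simp only [tileAt, add_assoc]
  obtain ⟨c, h0, h2, h13⟩ := key d d' h
  refine ⟨c, ?_, ?_, ?_⟩
  · rw [hc, ← h0, add_zero]
  · rw [hc, ← h2, add_assoc]
  · simp only [hc]
    exact h13.imp (fun h => ⟨by rw [← h.1], by rw [← h.2]⟩) fun h => ⟨by rw [← h.1], by rw [← h.2]⟩

theorem isSide_corner_add_one (t : Tile) (c : Fin 4) : IsSide t (corner t c) (corner t (c + 1)) :=
  ⟨c, .inl ⟨rfl, rfl⟩⟩

theorem isSide_corner_add_three (t : Tile) (c : Fin 4) :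
    IsSide t (corner t c) (corner t (c + 3)) :=
  isSide_iff.2 ⟨c, 3, .inr rfl, rfl, rfl⟩

theorem isSide_tileAt (v : Lattice) {d d' : Direction} (h : d.1 ≠ d'.1) :
    IsSide (tileAt v d d') v (v + d.vec) := by
  obtain ⟨c, h0, -, h | h⟩ := exists_corner_tileAt v h
  · have := isSide_corner_add_one (tileAt v d d') c
    rwa [← h0, ← h.1] at this
  · have := isSide_corner_add_three (tileAt v d d') c
    rwa [← h0, ← h.2] at this

theorem isSide_tileAt' (v : Lattice) {d d' : Direction} (h : d.1 ≠ d'.1) :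
    IsSide (tileAt v d d') v (v + d'.vec) :=
  tileAt_comm v d d' ▸ isSide_tileAt v h.symm

/-- Two edges of different lines at a point are both sides of at most one rhombus. -/
theorem eq_tileAt {t : Tile} {v : Lattice} {d d' : Direction} (hd : d.1 ≠ d'.1)
    (h : IsSide t v (v + d.vec)) (h' : IsSide t v (v + d'.vec)) : t = tileAt v d d' := by
  have key : ∀ (n : Fin 3) (b s s' : Fin 4), s = 1 ∨ s = 3 → s' = 1 ∨ s' = 3 →
      ∀ d d' : Direction, d.1 ≠ d'.1 → corner (0, n) b + d.vec = corner (0, n) (b + s) →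
      corner (0, n) b + d'.vec = corner (0, n) (b + s') →
      n = -(d.1 + d'.1) ∧ corner (0, n) b + d.negPart + d'.negPart = 0 := by
    decide
  obtain ⟨b, s, hs, hb, h⟩ := isSide_iff.1 h
  obtain ⟨b', s', hs', hb', h'⟩ := isSide_iff.1 h'
  obtain rfl : b = b' := corner_injective t (hb.symm.trans hb')
  rw [corner_eq] at hb
  rw [corner_eq, hb, add_assoc] at h h'
  obtain ⟨h1, h2⟩ := key t.2 b s s' hs hs' d d' hd (add_left_cancel h) (add_left_cancel h')
  refine Prod.ext ?_ h1
  rw [tileAt, hb, add_assoc, add_assoc, ← add_assoc (corner _ _), h2, add_zero]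

theorem not_isSide_opp {t : Tile} {v : Lattice} {d : Direction}
    (h : IsSide t v (v + d.vec)) (h' : IsSide t v (v + d.opp.vec)) : False := by
  have key : ∀ (n : Fin 3) (b s s' : Fin 4), s = 1 ∨ s = 3 → s' = 1 ∨ s' = 3 →
      ∀ d : Direction, corner (0, n) b + d.vec = corner (0, n) (b + s) →
      corner (0, n) b + d.opp.vec ≠ corner (0, n) (b + s') := by
    decide
  obtain ⟨b, s, hs, hb, h⟩ := isSide_iff.1 h
  obtain ⟨b', s', hs', hb', h'⟩ := isSide_iff.1 h'
  obtain rfl : b = b' := corner_injective t (hb.symm.trans hb')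
  rw [corner_eq] at hb
  rw [corner_eq, hb, add_assoc] at h h'
  exact key t.2 b s s' hs hs' d (add_left_cancel h) (add_left_cancel h')

/-- The edge in direction `d` at the vertex `v` belongs to the stepped plane. -/
def Present (v : Lattice) (d : Direction) : Prop :=
  0 ≤ planeHeight v + d.wt ∧ planeHeight v + d.wt < total

theorem total_eq' {j j' : Fin 3} (h : j ≠ j') :
    total = weight j + weight j' + weight (-(j + j')) := by
  have key : ∀ j j' : Fin 3, j ≠ j' →
      j' = j + 1 ∧ -(j + j') = j + 2 ∨ j' = j + 2 ∧ -(j + j') = j + 1 := by decide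
  rcases key j j' h with ⟨h1, h2⟩ | ⟨h1, h2⟩ <;> rw [total_eq j, h2, h1]
  ring

theorem Present.planeHeight_add {v : Lattice} {d : Direction} (h : Present v d) :
    planeHeight (v + d.vec) = planeHeight v + d.wt :=
  Rauzy.planeHeight_add h.1 h.2

theorem add_vec_add_vec_opp (v : Lattice) (d : Direction) : v + d.vec + d.opp.vec = v := by
  rw [vec_opp, add_neg_cancel_right]

theorem present_opp {v : Lattice} {d : Direction} (h : Present v d) :
    Present (v + d.vec) d.opp := by
  rw [Present, h.planeHeight_add, wt_opp, add_neg_cancel_right]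
  exact ⟨planeHeight_nonneg v, planeHeight_lt v⟩

/-- All four corners of the rhombus which is spanned by two directions at `v` lift to points of the
stepped plane, in such a way that its sides lift to edges. -/
def SpansTile (v : Lattice) (d d' : Direction) : Prop :=
  Present v d ∧ Present v d' ∧ 0 ≤ planeHeight v + d.wt + d'.wt ∧
    planeHeight v + d.wt + d'.wt < total

theorem SpansTile.symm {v : Lattice} {d d' : Direction} (h : SpansTile v d d') :
    SpansTile v d' d :=
  ⟨h.2.1, h.1, by rw [add_right_comm]; exact h.2.2⟩

theorem SpansTile.opp {v : Lattice} {d d' : Direction} (h : SpansTile v d d') :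
    SpansTile (v + d.vec) d.opp d' := by
  refine ⟨present_opp h.1, ?_, ?_⟩
  · rw [Present, h.1.planeHeight_add]
    exact h.2.2
  · rw [h.1.planeHeight_add, wt_opp, add_neg_cancel_right]
    exact h.2.1

theorem spansTile_opp_iff {v : Lattice} {d d' : Direction} :
    SpansTile (v + d.vec) d.opp d' ↔ SpansTile v d d' := by
  refine ⟨fun h => ?_, SpansTile.opp⟩
  have := h.opp
  rwa [add_vec_add_vec_opp, opp_opp] at this

/-- A rhombus belongs to the stepped plane if and only if its corners lift. -/
theorem tileAt_mem_steppedPlane {v : Lattice} {d d' : Direction} (h : d.1 ≠ d'.1) :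
    tileAt v d d' ∈ steppedPlane ↔ SpansTile v d d' := by
  have pos : ∀ (v : Lattice) (j j' : Fin 3), j ≠ j' →
      (tileAt v (j, true) (j', true) ∈ steppedPlane ↔ SpansTile v (j, true) (j', true)) := by
    intro v j j' h
    have h0 := planeHeight_nonneg v
    have ht := total_eq' h
    have hj := weight_pos j
    have hj' := weight_pos j'
    simp only [steppedPlane, tileAt, Set.mem_ofPred_eq, Direction.negPart, if_true, add_zero,
      SpansTile, Present, wt]
    constructor
    · intro h
      refine ⟨⟨?_, ?_⟩, ⟨?_, ?_⟩, ?_, ?_⟩ <;> linarith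
    · rintro ⟨-, -, -, h⟩
      linarith
  have one : ∀ (v : Lattice) (d : Direction) (j' : Fin 3), d.1 ≠ j' →
      (tileAt v d (j', true) ∈ steppedPlane ↔ SpansTile v d (j', true)) := by
    rintro v ⟨j, _ | _⟩ j' h
    · rw [← tileAt_opp, ← spansTile_opp_iff]
      exact pos _ j j' h
    · exact pos v j j' h
  obtain ⟨j', _ | _⟩ := d'
  · rw [tileAt_comm, ← tileAt_opp, tileAt_comm]
    refine (one (v + vec (j', false)) d j' h).trans ?_
    exact ⟨fun h => (spansTile_opp_iff.1 h.symm).symm, fun h => h.symm.opp.symm⟩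
  · exact one v d j' h

/-- Every rhombus with a given side at `v` is spanned by this side and a second direction. -/
theorem exists_eq_tileAt {t : Tile} {v : Lattice} {d : Direction} (h : IsSide t v (v + d.vec)) :
    ∃ d' : Direction, d.1 ≠ d'.1 ∧ t = tileAt v d d' := by
  have key : ∀ (n : Fin 3) (b s : Fin 4), s = 1 ∨ s = 3 → ∀ d : Direction,
      corner (0, n) b + d.vec = corner (0, n) (b + s) → ∃ s' : Fin 4, (s' = 1 ∨ s' = 3) ∧
        ∃ d' : Direction, d.1 ≠ d'.1 ∧ corner (0, n) b + d'.vec = corner (0, n) (b + s') := by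
    decide
  obtain ⟨b, s, hs, hb, hv⟩ := isSide_iff.1 h
  rw [corner_eq, hb, corner_eq, add_assoc] at hv
  obtain ⟨s', hs', d', hd, h'⟩ := key t.2 b s hs d (add_left_cancel hv)
  refine ⟨d', hd, eq_tileAt hd h (isSide_iff.2 ⟨b, s', hs', hb, ?_⟩)⟩
  rw [hb, corner_eq, add_assoc, h', ← corner_eq]

theorem present_of_isSide {t : Tile} (ht : t ∈ steppedPlane) {v : Lattice} {d : Direction}
    (h : IsSide t v (v + d.vec)) : Present v d := by
  obtain ⟨d', hd, rfl⟩ := exists_eq_tileAt h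
  exact ((tileAt_mem_steppedPlane hd).1 ht).1

/-- On each side of an edge at a vertex there is exactly one rhombus: its other side at
the vertex has either the same sign or the opposite sign. -/
theorem spansTile_iff_not {v : Lattice} {d : Direction} (h : Present v d) {l : Fin 3}
    (hl : d.1 ≠ l) : SpansTile v d (l, d.2) ↔ ¬ SpansTile v d (-(d.1 + l), !d.2) := by
  have ht := total_eq' hl
  have h0 := planeHeight_nonneg v
  have h1 := planeHeight_lt v
  obtain ⟨j, _ | _⟩ := d <;>
    simp only [SpansTile, Present, wt, Bool.not_true, Bool.not_false, Bool.false_eq_true,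
      if_true, if_false] at ht h ⊢ <;>
    have hj := weight_pos j <;> have hl := weight_pos l <;> have hn := weight_pos (-(j + l)) <;>
    constructor
  · rintro ⟨_, _, h, h'⟩ ⟨_, ⟨_, h2⟩, _, _⟩
    linarith
  · intro h'
    by_contra h''
    have h3 : planeHeight v + weight (-(j + l)) < total := by
      by_contra h3
      exact h'' ⟨h, ⟨by linarith, by linarith⟩, by linarith, by linarith⟩
    exact h' ⟨h, ⟨by linarith, h3⟩, by linarith, by linarith⟩
  · rintro ⟨_, _, h, h'⟩ ⟨_, ⟨h2, _⟩, _, _⟩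
    linarith
  · intro h'
    by_contra h''
    have h3 : 0 ≤ planeHeight v + -weight (-(j + l)) := by
      by_contra h3
      exact h'' ⟨h, ⟨by linarith, by linarith⟩, by linarith, by linarith⟩
    exact h' ⟨h, ⟨h3, by linarith⟩, by linarith, by linarith⟩

/-- A path whose edges are parallel to the three lines does not stay in the stepped plane for all
orders of its edges. -/
theorem not_spansTile_three {v : Lattice} {d d' d'' : Direction} (h1 : d.1 ≠ d'.1)
    (h2 : d.1 ≠ d''.1) (h3 : d'.1 ≠ d''.1) (s1 : SpansTile v d d') (s2 : SpansTile v d d'')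
    (s3 : SpansTile v d' d'')
    (h : 0 ≤ planeHeight v + d.wt + d'.wt + d''.wt ∧
      planeHeight v + d.wt + d'.wt + d''.wt < total) : False := by
  have ht : total = weight d.1 + weight d'.1 + weight d''.1 := by
    have : ∀ a b c : Fin 3, a ≠ b → a ≠ c → b ≠ c → -(a + b) = c := by decide
    rw [total_eq' h1, this _ _ _ h1 h2 h3]
  have h0 := planeHeight_nonneg v
  have h0' := planeHeight_lt v
  obtain ⟨⟨a1, a2⟩, ⟨b1, b2⟩, c1, c2⟩ := s1
  obtain ⟨-, ⟨e1, e2⟩, f1, f2⟩ := s2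
  obtain ⟨-, -, g1, g2⟩ := s3
  obtain ⟨i1, i2⟩ := h
  obtain ⟨j, _ | _⟩ := d <;> obtain ⟨j', _ | _⟩ := d' <;> obtain ⟨j'', _ | _⟩ := d'' <;>
    simp only [wt, Bool.false_eq_true, if_true, if_false] at * <;> linarith

/-! ### Arrows and words in the algebra -/

section

variable (k : Type*) [Field k] {T : Set Tile} (η : Fin 3 → ℤˣ)

theorem quotMap_eq_zero {r : PathAlgebra k (Vertex T)} (h : IsRelation k η r) :
    quotMap k η r = 0 := by
  have hr : r ∈ relationIdeal k T η := TwoSidedIdeal.subset_span h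
  exact ((relationIdeal k T η).ringCon.eq (a := r) (b := 0)).2
    (by rwa [TwoSidedIdeal.rel_iff, sub_zero])

theorem pathElt_mul {x y w : Vertex T} (p : Quiver.Path x y) (q : Quiver.Path y w) :
    pathElt k η p * pathElt k η q = pathElt k η (p.comp q) := by
  rw [pathElt, pathElt, ← map_mul, PathAlgebra.ofPath_mul_comp, pathElt]

variable (T)

/-- A corner of a rhombus, as a vertex of the quiver. -/
def mkVertex (u : Lattice) (h : ∃ t ∈ T, ∃ a, u = corner t a) : Vertex T := ⟨u, h⟩

/-- The element of the algebra given by the arrow from `u` to `v`, or zero if there is no such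
arrow. -/
def arr (u v : Lattice) : RhombalAlgebra k T η :=
  open Classical in
  if h : Adj T u v then
    pathElt k η (Quiver.Hom.toPath
      (⟨h⟩ : mkVertex T u h.symm.exists_corner ⟶ mkVertex T v h.exists_corner))
  else 0

/-- The idempotent of the vertex `u`, or zero if `u` is no vertex. -/
def vert (u : Lattice) : RhombalAlgebra k T η :=
  open Classical in
  if h : ∃ t ∈ T, ∃ a, u = corner t a then vertexIdem k η (mkVertex T u h) else 0

variable {T}

theorem pathElt_toPath {x y : Vertex T} (b : x ⟶ y) : pathElt k η b.toPath = arr k T η x.1 y.1 := by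
  rw [arr, dif_pos b.down]
  rfl

theorem vertexIdem_eq_vert (x : Vertex T) : vertexIdem k η x = vert k T η x.1 := by
  rw [vert, dif_pos x.2]
  rfl

theorem arr_of_not_adj {u v : Lattice} (h : ¬ Adj T u v) : arr k T η u v = 0 := by
  rw [arr, dif_neg h]

theorem vert_mul_arr (u v : Lattice) : vert k T η u * arr k T η u v = arr k T η u v := by
  by_cases h : Adj T u v
  · rw [arr, dif_pos h, vert, dif_pos h.symm.exists_corner, vertexIdem, pathElt_mul,
      Quiver.Path.nil_comp]
  · rw [arr_of_not_adj k η h, mul_zero]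

theorem arr_mul_vert (u v : Lattice) : arr k T η u v * vert k T η v = arr k T η u v := by
  by_cases h : Adj T u v
  · rw [arr, dif_pos h, vert, dif_pos h.exists_corner, vertexIdem, pathElt_mul,
      Quiver.Path.comp_nil]
  · rw [arr_of_not_adj k η h, zero_mul]

theorem vert_mul_vert (u : Lattice) : vert k T η u * vert k T η u = vert k T η u := by
  by_cases h : ∃ t ∈ T, ∃ a, u = corner t a
  · rw [vert, dif_pos h, vertexIdem_mul_self]
  · rw [vert, dif_neg h, zero_mul]

/-- The two-rhombus relation. -/
theorem arr_mul_arr_eq_zero {u v w : Lattice} (h : ¬ ∃ t ∈ T, IsSide t u v ∧ IsSide t v w) :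
    arr k T η u v * arr k T η v w = 0 := by
  by_cases h1 : Adj T u v
  · by_cases h2 : Adj T v w
    · rw [arr, dif_pos h1, arr, dif_pos h2, pathElt_mul]
      exact quotMap_eq_zero k η (.twoRhombus _ _ h)
    · rw [arr_of_not_adj k η h2, mul_zero]
  · rw [arr_of_not_adj k η h1, zero_mul]

theorem tileAt_mem_of_isSide {u : Lattice} {d d' : Direction} (h : d.1 ≠ d'.1) {t : Tile}
    (h1 : IsSide t u (u + d.vec)) (h2 : IsSide t (u + d.vec) (u + d.vec + d'.vec)) :
    t = tileAt u d d' := by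
  rw [← tileAt_opp]
  refine eq_tileAt h ?_ h2
  rw [add_vec_add_vec_opp]
  exact h1.symm

theorem arr_mul_arr_eq_zero_of_notMem {u : Lattice} {d d' : Direction} (h : d.1 ≠ d'.1)
    (ht : tileAt u d d' ∉ T) :
    arr k T η u (u + d.vec) * arr k T η (u + d.vec) (u + d.vec + d'.vec) = 0 := by
  refine arr_mul_arr_eq_zero k η ?_
  rintro ⟨t, htT, h1, h2⟩
  exact ht (tileAt_mem_of_isSide h h1 h2 ▸ htT)

theorem isSide_tileAt_snd (u : Lattice) {d d' : Direction} (h : d.1 ≠ d'.1) :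
    IsSide (tileAt u d d') (u + d.vec) (u + d.vec + d'.vec) := by
  rw [← tileAt_opp]
  exact isSide_tileAt' (d := d.opp) _ h

/-- The mirror relation, together with the two-rhombus relation: edges of different lines
commute. -/
theorem arr_comm (u : Lattice) {d d' : Direction} (h : d.1 ≠ d'.1) :
    arr k T η u (u + d.vec) * arr k T η (u + d.vec) (u + d.vec + d'.vec) =
      arr k T η u (u + d'.vec) * arr k T η (u + d'.vec) (u + d'.vec + d.vec) := by
  by_cases ht : tileAt u d d' ∈ T
  · have a1 : Adj T u (u + d.vec) := ⟨_, ht, isSide_tileAt u h⟩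
    have a2 : Adj T u (u + d'.vec) := ⟨_, ht, isSide_tileAt' u h⟩
    have b1 : Adj T (u + d.vec) (u + d.vec + d'.vec) := ⟨_, ht, isSide_tileAt_snd u h⟩
    have b2 : Adj T (u + d'.vec) (u + d.vec + d'.vec) :=
      ⟨_, ht, by
        rw [add_right_comm, tileAt_comm]
        exact isSide_tileAt_snd u h.symm⟩
    rw [add_right_comm u d'.vec, arr, dif_pos a1, arr, dif_pos b1, arr, dif_pos a2, arr,
      dif_pos b2, pathElt_mul, pathElt_mul]
    obtain ⟨c, h0, h2, ⟨h1, h3⟩ | ⟨h1, h3⟩⟩ := exists_corner_tileAt u h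
    · exact sub_eq_zero.1 ((map_sub (quotMap k η) _ _).symm.trans
        (quotMap_eq_zero k η (.mirror _ ht c h0 h1 h2 h3 _ _ _ _)))
    · exact (sub_eq_zero.1 ((map_sub (quotMap k η) _ _).symm.trans
        (quotMap_eq_zero k η (.mirror _ ht c h0 h1 h2 h3 _ _ _ _)))).symm
  · rw [arr_mul_arr_eq_zero_of_notMem k η h ht,
      arr_mul_arr_eq_zero_of_notMem k η h.symm (tileAt_comm u d d' ▸ ht)]

/-- The loop which goes along the edge in direction `d` and back. -/
def loopElt (T : Set Tile) (u : Lattice) (d : Direction) : RhombalAlgebra k T η :=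
  arr k T η u (u + d.vec) * arr k T η (u + d.vec) u

theorem quotMap_roundTrip (z : Vertex T) (d : Direction) :
    quotMap k η (roundTrip k T z d.vec) = loopElt k η T z.1 d := by
  by_cases h : Adj T z.1 (z.1 + d.vec)
  · rw [roundTrip, dif_pos h, loopElt, arr, dif_pos h, arr, dif_pos h.symm, pathElt_mul]
    rfl
  · rw [roundTrip, dif_neg h, map_zero, loopElt, arr_of_not_adj k η h, zero_mul]

/-- The difference of the two loops on a line. -/
def lineElt (T : Set Tile) (u : Lattice) (j : Fin 3) : RhombalAlgebra k T η :=
  loopElt k η T u (j, true) - loopElt k η T u (j, false)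

/-- The star relation. -/
theorem lineElt_eq (u : Lattice) (j : Fin 3) :
    lineElt k η T u j = (starSign η u j : ℤ) • lineElt k η T u (j + 1) := by
  by_cases h : ∃ t ∈ T, ∃ a, u = corner t a
  · have e : ∀ j, quotMap k η (lineDiff k T (mkVertex T u h) j) = lineElt k η T u j := fun j => by
      rw [lineDiff, map_sub]
      exact congrArg₂ (· - ·) (quotMap_roundTrip k η (mkVertex T u h) (j, true))
        (quotMap_roundTrip k η (mkVertex T u h) (j, false))
    have := quotMap_eq_zero k η (.star (mkVertex T u h) j)
    rw [map_sub, map_zsmul, e, e] at this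
    exact sub_eq_zero.1 this
  · have e : ∀ j, lineElt k η T u j = 0 := fun j => by
      have : ∀ v, ¬ Adj T u v := fun v hv => h hv.symm.exists_corner
      rw [lineElt, loopElt, loopElt, arr_of_not_adj k η (this _), arr_of_not_adj k η (this _)]
      simp
    rw [e, e, smul_zero]

theorem exists_lineElt_eq (u : Lattice) (j m : Fin 3) :
    ∃ c : ℤ, lineElt k η T u j = c • lineElt k η T u m := by
  have key : ∀ j m : Fin 3, m = j ∨ m = j + 1 ∨ m = j + 1 + 1 := by decide
  rcases key j m with rfl | rfl | rfl
  · exact ⟨1, (one_smul _ _).symm⟩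
  · exact ⟨_, lineElt_eq k η u j⟩
  · exact ⟨_, by rw [lineElt_eq, lineElt_eq k η u (j + 1), smul_smul]⟩

/-- The path which starts at `u` and has the given directions, as an element of the algebra; zero
if it leaves the quiver. -/
def word (T : Set Tile) : List Direction → Lattice → RhombalAlgebra k T η
  | [], u => vert k T η u
  | d :: w, u => arr k T η u (u + d.vec) * word T w (u + d.vec)

theorem vert_mul_word (w : List Direction) (u : Lattice) :
    vert k T η u * word k η T w u = word k η T w u := by
  cases w with
  | nil => exact vert_mul_vert k η u
  | cons d w => rw [word, ← mul_assoc, vert_mul_arr]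

theorem word_append (w w' : List Direction) (u : Lattice) :
    word k η T (w ++ w') u = word k η T w u * word k η T w' (u + (w.map vec).sum) := by
  induction w generalizing u with
  | nil => simp [word, vert_mul_word]
  | cons d w ih => simp [word, ih, mul_assoc, add_assoc]

theorem exists_word {x y : Vertex T} (p : Quiver.Path x y) : ∃ w : List Direction,
    w.length = p.length ∧ y.1 = x.1 + (w.map vec).sum ∧ pathElt k η p = word k η T w x.1 := by
  induction p with
  | nil => exact ⟨[], rfl, by simp, vertexIdem_eq_vert k η x⟩
  | @cons y y' p b ih =>
    obtain ⟨w, hw, hy, he⟩ := ih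
    obtain ⟨t, ht, hs⟩ := b.down
    obtain ⟨d, -, hd⟩ := exists_direction hs
    refine ⟨w ++ [d], by simp [hw], by rw [hd, hy]; simp [add_assoc], ?_⟩
    have : p.cons b = p.comp b.toPath := rfl
    rw [this, ← pathElt_mul, he, pathElt_toPath, word_append, ← hy, word, word, ← hd, arr_mul_vert]

/-! ### Words of length five vanish -/

theorem word_swap {d d' : Direction} (h : d.1 ≠ d'.1) (w : List Direction) (u : Lattice) :
    word k η T (d :: d' :: w) u = word k η T (d' :: d :: w) u := by
  simp only [word]
  rw [← mul_assoc, ← mul_assoc, arr_comm k η u h, add_right_comm]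

theorem word_straight (d : Direction) (w : List Direction) (u : Lattice) :
    word k η T (d :: d :: w) u = 0 := by
  simp only [word]
  rw [← mul_assoc, arr_mul_arr_eq_zero, zero_mul]
  rintro ⟨t, -, h1, h2⟩
  refine not_isSide_opp (d := d) h2 ?_
  rw [add_vec_add_vec_opp]
  exact h1.symm

theorem word_loop (d : Direction) (w : List Direction) (u : Lattice) :
    word k η T (d :: d.opp :: w) u = loopElt k η T u d * word k η T w u := by
  simp only [word]
  rw [add_vec_add_vec_opp, ← mul_assoc, loopElt]

/-- If the loops of one line annihilate a word, then the two loops on any other line have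
the same product with it. -/
theorem word_loop_eq (d : Direction) (m : Fin 3) (w : List Direction) (u : Lattice)
    (h : ∀ b, word k η T ((m, b) :: (m, !b) :: w) u = 0) :
    word k η T (d :: d.opp :: w) u = word k η T (d.opp :: d :: w) u := by
  have h0 : lineElt k η T u m * word k η T w u = 0 := by
    have h1 := h true
    have h2 := h false
    rw [← opp.eq_1 (m, _), word_loop] at h1 h2
    rw [lineElt, sub_mul, h1, h2, sub_zero]
  obtain ⟨c, hc⟩ := exists_lineElt_eq k η (T := T) u d.1 m
  have h1 : lineElt k η T u d.1 * word k η T w u = 0 := by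
    rw [hc, smul_mul_assoc, h0, smul_zero]
  rw [lineElt, sub_mul, ← word_loop, ← word_loop, sub_eq_zero] at h1
  obtain ⟨j, _ | _⟩ := d
  · exact h1.symm
  · exact h1

theorem word_cons_eq_zero {w : List Direction} (h : ∀ u, word k η T w u = 0) (d : Direction)
    (u : Lattice) : word k η T (d :: w) u = 0 := by
  rw [word, h, mul_zero]

theorem word_append_eq_zero {w : List Direction} (h : ∀ u, word k η T w u = 0)
    (w' : List Direction) (u : Lattice) : word k η T (w ++ w') u = 0 := by
  rw [word_append, h, zero_mul]

/-- A nonzero path only turns at the corners of rhombi. -/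
theorem spansTile_of_word_ne (hT : T ⊆ steppedPlane) {d d' : Direction} (h : d.1 ≠ d'.1)
    {w : List Direction} {u : Lattice} (hw : word k η T (d :: d' :: w) u ≠ 0) :
    SpansTile u d d' := by
  refine (tileAt_mem_steppedPlane h).1 (hT ?_)
  by_contra ht
  refine hw ?_
  simp only [word]
  rw [← mul_assoc, arr_mul_arr_eq_zero_of_notMem k η h ht, zero_mul]

/-- If a path with three edges of different lines were nonzero, then all orders of its edges would
give nonzero paths, and any two of them would span a rhombus; this is excluded by the heights. -/
theorem word_triple (hT : T ⊆ steppedPlane) {d d' d'' : Direction} (h : d.1 ≠ d'.1)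
    (h' : d.1 ≠ d''.1) (h'' : d'.1 ≠ d''.1) (w : List Direction) (u : Lattice) :
    word k η T (d :: d' :: d'' :: w) u = 0 := by
  by_contra hw
  have s1 := spansTile_of_word_ne k η hT h hw
  have hw' : word k η T (d :: d'' :: d' :: w) u ≠ 0 := by
    rwa [word, word_swap k η h''.symm, ← word]
  have s2 := spansTile_of_word_ne k η hT h' hw'
  have s3 : SpansTile u d'' d' := by
    rw [word_swap k η h', word, word_swap k η h, ← word] at hw'
    exact spansTile_of_word_ne k η hT h''.symm hw'
  refine not_spansTile_three h h' h'' s1 s2 s3.symm ?_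
  rw [word] at hw
  have s4 := spansTile_of_word_ne k η hT h'' (right_ne_zero_of_mul hw)
  have e := s1.1.planeHeight_add
  have := s4.2.2
  rwa [e] at this

theorem word_eq_zero_of_mem (hT : T ⊆ steppedPlane) {d d' : Direction} (h : d.1 ≠ d'.1)
    {w : List Direction} (hw : ∃ x ∈ w, x.1 ≠ d.1 ∧ x.1 ≠ d'.1) (u : Lattice) :
    word k η T (d :: d' :: w) u = 0 := by
  induction w generalizing d d' u with
  | nil => simp at hw
  | cons x w ih =>
    by_cases h1 : x.1 = d.1
    · rw [word, word_swap k η (h1 ▸ h.symm)]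
      refine mul_eq_zero_of_right _ (ih (h1 ▸ h) ?_ _)
      obtain ⟨y, hy, hy1, hy2⟩ := hw
      rcases List.mem_cons.1 hy with rfl | hy
      · exact absurd h1 hy1
      · exact ⟨y, hy, h1 ▸ hy1, hy2⟩
    · by_cases h2 : x.1 = d'.1
      · rw [word_swap k η h, word, word_swap k η (Ne.symm h1)]
        refine mul_eq_zero_of_right _ (ih h1 ?_ _)
        obtain ⟨y, hy, hy1, hy2⟩ := hw
        rcases List.mem_cons.1 hy with rfl | hy
        · exact absurd h2 hy2
        · exact ⟨y, hy, h2 ▸ hy2, hy1⟩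
      · exact word_triple k η hT h (Ne.symm h1) (Ne.symm h2) w u

/-- A path whose edges are not parallel to only two lines is zero. -/
theorem word_eq_zero_of_forall (hT : T ⊆ steppedPlane) {w : List Direction}
    (hw : ∀ l : Fin 3, ∃ x ∈ w, x.1 = l) (u : Lattice) : word k η T w u = 0 := by
  have key : ∀ a b : Fin 3, ∃ n, n ≠ a ∧ n ≠ b := by decide
  induction w generalizing u with
  | nil => simp at hw
  | cons a w ih =>
    by_cases h : ∃ x ∈ w, x.1 = a.1
    · refine mul_eq_zero_of_right _ (ih (fun l => ?_) _)
      obtain ⟨x, hx, rfl⟩ := hw l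
      rcases List.mem_cons.1 hx with rfl | hx
      · exact h
      · exact ⟨x, hx, rfl⟩
    · push Not at h
      cases w with
      | nil =>
        obtain ⟨n, hn, -⟩ := key a.1 a.1
        obtain ⟨x, hx, rfl⟩ := hw n
        rw [List.mem_singleton.1 hx] at hn
        exact absurd rfl hn
      | cons b w =>
        refine word_eq_zero_of_mem k η hT (h b List.mem_cons_self).symm ?_ u
        obtain ⟨n, hn, hn'⟩ := key a.1 b.1
        obtain ⟨x, hx, rfl⟩ := hw n
        rcases List.mem_cons.1 hx with rfl | hx
        · exact absurd rfl hn
        rcases List.mem_cons.1 hx with rfl | hx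
        · exact absurd rfl hn'
        exact ⟨x, hx, hn, hn'⟩

/-- By the star relation, a loop can be reversed if it is followed by an edge of another line. This
makes a path straight whose first three edges belong to one line and whose fourth does not. -/
theorem word_three_one (hT : T ⊆ steppedPlane) {a b c x : Direction} (hb : a.1 = b.1)
    (hc : a.1 = c.1) (hx : a.1 ≠ x.1) (u : Lattice) : word k η T [a, b, c, x] u = 0 := by
  rcases eq_or_eq_opp hb with rfl | rfl
  · exact word_straight k η _ _ u
  rcases eq_or_eq_opp hc with rfl | rfl
  · obtain ⟨m, hm, hm'⟩ : ∃ m, m ≠ c.1 ∧ m ≠ x.1 :=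
      (by decide : ∀ p q : Fin 3, ∃ m, m ≠ p ∧ m ≠ q) _ _
    rw [word_loop_eq k η c m, word, word_straight, mul_zero]
    exact fun s => word_cons_eq_zero k η (word_triple k η hT (d := (m, !s)) hm hm' hx []) _ u
  · rw [word, word_straight, mul_zero]

/-- The five edges of a nonzero path on one line would go forth and back. The loop at the start can be
reversed, since a loop on another line annihilates the remaining three edges. -/
theorem word_five_of_line (hT : T ⊆ steppedPlane) {a b c d e : Direction} (hb : a.1 = b.1)
    (hc : a.1 = c.1) (hd : a.1 = d.1) (he : a.1 = e.1) (u : Lattice) :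
    word k η T [a, b, c, d, e] u = 0 := by
  rcases eq_or_eq_opp hb with rfl | rfl
  · exact word_straight k η _ _ u
  obtain ⟨m, hm⟩ : ∃ m, a.1 ≠ m := (by decide : ∀ p : Fin 3, ∃ m, p ≠ m) _
  rcases eq_or_eq_opp hc with rfl | rfl
  · rw [word_loop_eq k η c m, word, word_straight, mul_zero]
    intro s
    refine word_cons_eq_zero k η (fun u => ?_) _ u
    rw [word_swap k η hm.symm, word, word_swap k η (hd ▸ hm.symm), word,
      word_swap k η (he ▸ hm.symm), ← word, ← word]
    exact word_three_one k η hT hd he hm u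
  · rw [word, word_straight, mul_zero]

/-- The edges of one line can be moved to the front. -/
theorem word_filter (l : Fin 3) (w : List Direction) (u : Lattice) :
    word k η T w u =
      word k η T (w.filter (fun x => x.1 = l) ++ w.filter (fun x => x.1 ≠ l)) u := by
  have move : ∀ (a : Direction) (L R : List Direction), (∀ x ∈ L, x.1 ≠ a.1) → ∀ u,
      word k η T (a :: (L ++ R)) u = word k η T (L ++ a :: R) u := by
    intro a L R
    induction L with
    | nil => exact fun _ _ => rfl
    | cons x L ih =>
      intro h u
      rw [List.cons_append, word_swap k η (h x List.mem_cons_self).symm, word,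
        ih fun y hy => h y (List.mem_cons_of_mem x hy), List.cons_append, word]
  induction w generalizing u with
  | nil => rfl
  | cons a w ih =>
    by_cases h : a.1 = l
    · rw [List.filter_cons_of_pos (by simpa using h), List.filter_cons_of_neg (by simpa using h),
        List.cons_append, word, ih, word]
    · rw [List.filter_cons_of_neg (by simpa using h), List.filter_cons_of_pos (by simpa using h),
        ← move, word, ih, word]
      intro x hx
      have : x.1 = l := by simpa using (List.mem_filter.1 hx).2
      exact fun h' => h (h' ▸ this)

/-- Every path of length five is zero. -/
theorem word_five (hT : T ⊆ steppedPlane) {w : List Direction} (hw : w.length = 5)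
    (u : Lattice) : word k η T w u = 0 := by
  by_cases h3 : ∀ l : Fin 3, ∃ x ∈ w, x.1 = l
  · exact word_eq_zero_of_forall k η hT h3 u
  -- Otherwise at most two lines occur, and one of these occurs three times.
  push Not at h3
  obtain ⟨n, hn⟩ := h3
  obtain ⟨l, hl⟩ : ∃ l, 3 ≤ (w.filter (fun x => x.1 = l)).length := by
    obtain ⟨l, m, hlm⟩ : ∃ l m : Fin 3, ∀ x, x ≠ n → x = l ∨ x = m := by
      clear hn
      decide +revert
    by_contra! hlt
    have h1 := hlt l
    have h2 := hlt m
    rw [← List.countP_eq_length_filter] at h1 h2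
    have h4 := List.length_eq_countP_add_countP (fun x : Direction => decide (x.1 = l)) (l := w)
    have h5 : w.countP (fun x : Direction => ¬ decide (x.1 = l)) ≤
        w.countP (fun x : Direction => decide (x.1 = m)) := by
      refine List.countP_mono_left fun x hx h => ?_
      have := hlm x.1 (hn x hx)
      simp at h ⊢
      tauto
    omega
  have hlen := List.length_eq_length_filter_add (l := w) (fun x : Direction => decide (x.1 = l))
  have hL : ∀ x ∈ w.filter (fun x => x.1 = l), x.1 = l := fun x hx => by
    simpa using (List.mem_filter.1 hx).2
  have hR : ∀ x ∈ w.filter (fun x => x.1 ≠ l), x.1 ≠ l := fun x hx => by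
    simpa using (List.mem_filter.1 hx).2
  have e : (fun x : Direction => !decide (x.1 = l)) = fun x => decide (x.1 ≠ l) := by
    ext; simp
  rw [hw, e] at hlen
  rw [word_filter k η l]
  generalize w.filter (fun x => x.1 = l) = L at *
  generalize w.filter (fun x => x.1 ≠ l) = R at *
  obtain _ | ⟨a, _ | ⟨b, _ | ⟨c, L⟩⟩⟩ := L <;>
    simp only [List.length_nil, List.length_cons] at hl hlen <;> try omega
  simp only [List.forall_mem_cons] at hL
  obtain ⟨ha, hb, hc, hL⟩ := hL
  obtain _ | ⟨x, R⟩ := R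
  · obtain _ | ⟨d, _ | ⟨f, _ | ⟨g, L⟩⟩⟩ := L <;>
      simp only [List.length_nil, List.length_cons] at hlen <;> try omega
    have hd := hL d List.mem_cons_self
    have hf := hL f (List.mem_cons_of_mem _ List.mem_cons_self)
    exact word_five_of_line k η hT (by rw [ha, hb]) (by rw [ha, hc]) (by rw [ha, hd])
      (by rw [ha, hf]) u
  · have hx := hR x List.mem_cons_self
    obtain _ | ⟨d, L⟩ := L
    · exact word_append_eq_zero k η (word_three_one k η hT (by rw [ha, hb]) (by rw [ha, hc])
        (fun h => hx (h ▸ ha))) R u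
    · simp only [List.length_cons] at hlen
      obtain rfl : L = [] := List.eq_nil_of_length_eq_zero (by omega)
      obtain rfl : R = [] := List.eq_nil_of_length_eq_zero (by omega)
      have hd := hL d List.mem_cons_self
      exact word_cons_eq_zero k η (word_three_one k η hT (by rw [hb, hc]) (by rw [hb, hd])
        (fun h => hx (h ▸ hb))) a u

theorem pathElt_eq_zero (hT : T ⊆ steppedPlane) {x y : Vertex T} (p : Quiver.Path x y)
    (hp : 5 ≤ p.length) : pathElt k η p = 0 := by
  obtain ⟨w, hw, -, he⟩ := exists_word k η p
  rw [he, ← List.take_append_drop 5 w]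
  exact word_append_eq_zero k η
    (word_five k η hT (by rw [List.length_take, hw]; omega)) _ _

end

/-! ### A linear form on the closed paths of length four -/

/-- Signs of the three lines at a point, such that the sign of the star relation which compares two
lines is the product of the signs of these lines. -/
def lineSign (η : Fin 3 → ℤˣ) (v : Lattice) : Fin 3 → ℤˣ :=
  ![1, η 0 * v.1.negOnePow, η 0 * η 1 * v.2.negOnePow]

/-- This is where the product of the three signs has to be one. -/
theorem starSign_eq {η : Fin 3 → ℤˣ} (hη : η 0 * η 1 * η 2 = 1) (v : Lattice) (j : Fin 3) :
    starSign η v j = lineSign η v j * lineSign η v (j + 1) := by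
  have h2 : η 2 = η 0 * η 1 :=
    calc η 2 = η 0 * η 1 * (η 0 * η 1) * η 2 := by rw [Int.units_mul_self, one_mul]
      _ = η 0 * η 1 := by rw [mul_assoc (η 0 * η 1), hη, mul_one]
  fin_cases j
  · simp [starSign, lineSign]
  · simp only [starSign, lineSign]
    simp
    rw [mul_mul_mul_comm, ← mul_assoc (η 0) (η 0), Int.units_mul_self, one_mul]
  · simp [starSign, lineSign, h2]

/-- Along an edge, the sign of its line changes in comparison with the other two signs. -/
theorem exists_lineSign_add (η : Fin 3 → ℤˣ) (v : Lattice) (d : Direction) : ∃ s : ℤˣ,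
    ∀ j, lineSign η (v + d.vec) j = s * (if j = d.1 then -1 else 1) * lineSign η v j := by
  have key : ∀ d : Direction, ∃ s : ℤˣ, s * (if (0 : Fin 3) = d.1 then -1 else 1) = 1 ∧
      s * (if (1 : Fin 3) = d.1 then -1 else 1) = d.vec.1.negOnePow ∧
      s * (if (2 : Fin 3) = d.1 then -1 else 1) = d.vec.2.negOnePow := by
    rintro ⟨j, b⟩
    fin_cases j
    · refine ⟨-1, ?_⟩
      cases b <;> simp [vec, dir, proj]
    · refine ⟨1, ?_⟩
      cases b <;> simp [vec, dir, proj]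
    · refine ⟨1, ?_⟩
      cases b <;> simp [vec, dir, proj]
  obtain ⟨s, h0, h1, h2⟩ := key d
  refine ⟨s, fun j => ?_⟩
  fin_cases j
  · simp only [lineSign]
    simpa using h0.symm
  · simp only [lineSign, Fin.mk_one, h1]
    simp [Int.negOnePow_add]
    ac_rfl
  · simp only [lineSign, Fin.reduceFinMk, h2]
    simp [Int.negOnePow_add]
    ac_rfl

section

variable (z : Lattice) (δ : Fin 3 → ℤˣ)

open Classical in
/-- One if the two directions span a rhombus at `z`, and zero otherwise. -/
def spanInd (d d' : Direction) : ℤ := if SpansTile z d d' then 1 else 0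

/-- The number of rhombi at an edge which are spanned by two directions of the same sign,
minus one. -/
def edgeExcess (d : Direction) : ℤ :=
  spanInd z d (d.1 + 1, d.2) + spanInd z d (d.1 + 2, d.2) - 1

/-- The value of the linear form on the product of the loops at `z` in two directions. -/
def loopForm (d d' : Direction) : ℤ :=
  if d.1 = d'.1 then if d = d' then edgeExcess z d else 0
  else δ d.1 * δ d'.1 * spanInd z d d'

variable {z}

theorem spanInd_comm (d d' : Direction) : spanInd z d d' = spanInd z d' d := by
  rw [spanInd, spanInd]
  congr 1
  exact propext ⟨SpansTile.symm, SpansTile.symm⟩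

theorem loopForm_comm (d d' : Direction) : loopForm z δ d d' = loopForm z δ d' d := by
  rw [loopForm, loopForm]
  by_cases h : d = d'
  · rw [h]
  · rw [if_neg h, if_neg (Ne.symm h), spanInd_comm, mul_comm (δ d.1 : ℤ)]
    simp only [eq_comm (a := d.1)]

/-- On any line other than that of the edge, the signed count of the rhombi at the edge is the same. -/
theorem spanInd_sub_spanInd {d : Direction} (h : Present z d) {l : Fin 3} (hl : d.1 ≠ l) :
    spanInd z d (l, d.2) - spanInd z d (l, !d.2) = edgeExcess z d := by
  have key : ∀ a b : Fin 3, a ≠ b →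
      (b = a + 1 ∧ -(a + b) = a + 2 ∨ b = a + 2 ∧ -(a + b) = a + 1) ∧
        -(a + -(a + b)) = b ∧ a ≠ -(a + b) := by decide
  obtain ⟨h1, h2, h3⟩ := key _ _ hl
  have h4 := spansTile_iff_not h h3
  rw [h2] at h4
  have h5 : spanInd z d (-(d.1 + l), d.2) = 1 - spanInd z d (l, !d.2) := by
    rw [spanInd, spanInd]
    by_cases hs : SpansTile z d (l, !d.2)
    · rw [if_pos hs, if_neg fun h => h4.1 h hs, sub_self]
    · rw [if_neg hs, if_pos (h4.2 hs), sub_zero]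
  rw [edgeExcess]
  rcases h1 with ⟨h1, h1'⟩ | ⟨h1, h1'⟩ <;> rw [← h1', ← h1, h5] <;> ring

/-- A sign, as an integer. -/
def boolSign (b : Bool) : ℤ := if b then 1 else -1

theorem sub_eq_boolSign_mul (f : Bool → ℤ) (b : Bool) :
    f true - f false = boolSign b * (f b - f !b) := by
  cases b <;> simp [boolSign]

theorem units_mul_self (u : ℤˣ) : (u : ℤ) * u = 1 := by
  rw [← Units.val_mul, Int.units_mul_self, Units.val_one]

/-- The linear form satisfies the star relation at `z`. -/
theorem loopForm_line {e : Direction} (h : Present z e) (j : Fin 3) :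
    δ j * (loopForm z δ (j, true) e - loopForm z δ (j, false) e) =
      boolSign e.2 * δ e.1 * edgeExcess z e := by
  rw [sub_eq_boolSign_mul (fun b => loopForm z δ (j, b) e) e.2]
  by_cases hj : e.1 = j
  · subst hj
    have : (e.1, !e.2) ≠ e := fun h => by simpa using congrArg Prod.snd h
    simp [loopForm, this]
    ring
  · have h1 : j ≠ e.1 := Ne.symm hj
    simp only [loopForm, h1, if_false, spanInd_comm _ e]
    rw [← mul_sub, spanInd_sub_spanInd h hj]
    linear_combination (boolSign e.2 * δ e.1 * edgeExcess z e) * units_mul_self (δ j)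

/-- The value of the linear form on a path of length four which starts at `z`, given by its
directions. It is zero unless the path is closed. If the first two edges of a closed path neither
return to `z` nor form a straight path, then the path goes around a rhombus, or along two of its
sides and back. -/
def fourForm : List Direction → ℤ
  | [a, b, c, d] =>
    if a.vec + b.vec + c.vec + d.vec = 0 then
      if b = a.opp then loopForm z δ a c else if a.1 = b.1 then 0 else loopForm z δ a b
    else 0
  | _ => 0

variable (z) in
theorem fourForm_of_length {L : List Direction} (h : L.length ≠ 4) : fourForm (z := z) δ L = 0 := by
  rw [fourForm]
  rintro a b c d rfl
  exact h rfl

/-- The closed paths of length four. -/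
theorem closed_cases {a b c d : Direction} (h : a.vec + b.vec + c.vec + d.vec = 0) :
    b = a.opp ∧ d = c.opp ∨ c = a.opp ∧ d = b.opp ∨ d = a.opp ∧ c = b.opp := by
  have key : ∀ a b c d : Direction, a.vec + b.vec + c.vec + d.vec = 0 →
    b = a.opp ∧ d = c.opp ∨ c = a.opp ∧ d = b.opp ∨ d = a.opp ∧ c = b.opp := by decide
  exact key a b c d h

theorem fourForm_loop_loop (a c : Direction) :
    fourForm (z := z) δ [a, a.opp, c, c.opp] = loopForm z δ a c := by
  rw [fourForm, if_pos, if_pos rfl]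
  simp [vec_opp]

theorem fourForm_nested {a b : Direction} (h : a.1 ≠ b.1) :
    fourForm (z := z) δ [a, b, b.opp, a.opp] = loopForm z δ a b := by
  rw [fourForm, if_pos, if_neg, if_neg h]
  · rintro rfl
    exact h a.opp_fst.symm
  · simp [vec_opp]

theorem fourForm_rhombus {a b : Direction} (h : a.1 ≠ b.1) :
    fourForm (z := z) δ [a, b, a.opp, b.opp] = loopForm z δ a b := by
  rw [fourForm, if_pos, if_neg, if_neg h]
  · rintro rfl
    exact h a.opp_fst.symm
  · simp [vec_opp]

theorem fourForm_straight (a c d : Direction) : fourForm (z := z) δ [a, a, c, d] = 0 := by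
  have : a ≠ a.opp := fun h => by simpa [opp] using congrArg Prod.snd h
  simp [fourForm, this]

theorem fourForm_of_not_closed {a b c d : Direction} (h : a.vec + b.vec + c.vec + d.vec ≠ 0) :
    fourForm (z := z) δ [a, b, c, d] = 0 := by
  rw [fourForm, if_neg h]

/-- All rhombi of the stepped plane at `z` belong to `T`. -/
def FullStar (T : Set Tile) (z : Lattice) : Prop :=
  ∀ t ∈ steppedPlane, (∃ a, z = corner t a) → t ∈ T

/-- The list of directions describes a path in the quiver of `T` which starts at `u`. -/
def IsWalk (T : Set Tile) : Lattice → List Direction → Prop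
  | _, [] => True
  | u, d :: L => Adj T u (u + d.vec) ∧ IsWalk T (u + d.vec) L

variable {T : Set Tile}

theorem isWalk_append {u : Lattice} {L R : List Direction} :
    IsWalk T u (L ++ R) ↔ IsWalk T u L ∧ IsWalk T (u + (L.map vec).sum) R := by
  induction L generalizing u with
  | nil => simp [IsWalk]
  | cons d L ih => simp [IsWalk, ih, and_assoc, add_assoc]

theorem FullStar.tileAt_mem (hz : FullStar T z) {d d' : Direction} (h : d.1 ≠ d'.1)
    (hs : SpansTile z d d') : tileAt z d d' ∈ T := by
  obtain ⟨c, hc, -⟩ := exists_corner_tileAt z h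
  exact hz _ ((tileAt_mem_steppedPlane h).2 hs) ⟨c, hc⟩

theorem spansTile_of_loopForm_ne {d d' : Direction} (h : d.1 ≠ d'.1)
    (h' : loopForm z δ d d' ≠ 0) : SpansTile z d d' := by
  by_contra hs
  simp [loopForm, h, spanInd, hs] at h'

theorem eq_or_ne_of_loopForm_ne {d d' : Direction} (h' : loopForm z δ d d' ≠ 0) :
    d = d' ∨ d.1 ≠ d'.1 := by
  by_contra! h
  simp [loopForm, h] at h'

theorem fourForm_closed {a b c d : Direction} (h : fourForm (z := z) δ [a, b, c, d] ≠ 0) :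
    a.vec + b.vec + c.vec + d.vec = 0 := by
  by_contra h'
  exact h (fourForm_of_not_closed δ h')

/-- The closed paths of length four on which the linear form does not vanish. -/
theorem fourForm_ne_zero {a b c d : Direction} (h : fourForm (z := z) δ [a, b, c, d] ≠ 0) :
    (b = a.opp ∧ d = c.opp ∧ (a = c ∨ a.1 ≠ c.1 ∧ SpansTile z a c)) ∨
    (a.1 ≠ b.1 ∧ SpansTile z a b ∧ (c = a.opp ∧ d = b.opp ∨ c = b.opp ∧ d = a.opp)) := by
  have hc := fourForm_closed δ h
  by_cases hb : b = a.opp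
  · left
    rcases closed_cases hc with h1 | h1 | h1
    · obtain ⟨rfl, rfl⟩ := h1
      rw [fourForm_loop_loop] at h
      exact ⟨rfl, rfl, (eq_or_ne_of_loopForm_ne δ h).imp_right
        fun h1 => ⟨h1, spansTile_of_loopForm_ne δ h1 h⟩⟩
    · obtain ⟨rfl, rfl⟩ := h1
      subst hb
      rw [fourForm_loop_loop] at h
      refine ⟨rfl, rfl, (eq_or_ne_of_loopForm_ne δ h).imp_right
        fun h1 => ⟨h1, spansTile_of_loopForm_ne δ h1 h⟩⟩
    · obtain ⟨rfl, rfl⟩ := h1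
      subst hb
      rw [opp_opp, fourForm_loop_loop] at h
      simp
  · right
    rw [fourForm, if_pos hc, if_neg hb] at h
    have h1 : a.1 ≠ b.1 := fun h1 => h (if_pos h1)
    rw [if_neg h1] at h
    refine ⟨h1, spansTile_of_loopForm_ne δ h1 h, ?_⟩
    rcases closed_cases hc with h2 | h2 | h2
    · exact absurd h2.1 hb
    · exact .inl h2
    · exact .inr ⟨h2.2, h2.1⟩

/-- The linear form satisfies the two-rhombus relations. -/
theorem fourForm_twoRhombus (hz : FullStar T z) (L R : List Direction) (d d' : Direction)
    (hw : IsWalk T z (L ++ d :: d' :: R))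
    (h : ¬ ∃ t ∈ T, IsSide t (z + (L.map vec).sum) (z + (L.map vec).sum + d.vec) ∧
      IsSide t (z + (L.map vec).sum + d.vec) (z + (L.map vec).sum + d.vec + d'.vec)) :
    fourForm (z := z) δ (L ++ d :: d' :: R) = 0 := by
  by_contra hne
  have hlen : (L ++ d :: d' :: R).length = 4 := by
    by_contra h
    exact hne (fourForm_of_length z δ h)
  have back : d' ≠ d.opp := by
    rintro rfl
    obtain ⟨t, ht, hs⟩ := (isWalk_append.1 hw).2.1
    exact h ⟨t, ht, hs, by rw [add_vec_add_vec_opp]; exact hs.symm⟩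
  have rhomb : ∀ a b : Direction, a.1 ≠ b.1 → SpansTile z a b →
      ¬ (IsSide (tileAt z a b) (z + (L.map vec).sum) (z + (L.map vec).sum + d.vec) ∧
        IsSide (tileAt z a b) (z + (L.map vec).sum + d.vec)
          (z + (L.map vec).sum + d.vec + d'.vec)) :=
    fun a b hab hs h' => h ⟨_, hz.tileAt_mem hab hs, h'⟩
  have sides : ∀ a b : Direction, a.1 ≠ b.1 → IsSide (tileAt z a b) z (z + a.vec) ∧
      IsSide (tileAt z a b) z (z + b.vec) ∧
      IsSide (tileAt z a b) (z + a.vec) (z + a.vec + b.vec) ∧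
      IsSide (tileAt z a b) (z + b.vec) (z + a.vec + b.vec) := fun a b hab =>
    ⟨isSide_tileAt z hab, isSide_tileAt' z hab, isSide_tileAt_snd z hab, by
      rw [add_right_comm, tileAt_comm]
      exact isSide_tileAt_snd z hab.symm⟩
  have e1 : ∀ a b : Direction, z + a.vec + b.vec + a.opp.vec = z + b.vec := fun a b => by
    rw [add_right_comm z, add_vec_add_vec_opp]
  obtain _ | ⟨a, _ | ⟨b, _ | ⟨c, L⟩⟩⟩ := L
  · obtain _ | ⟨c, _ | ⟨e, _ | ⟨f, R⟩⟩⟩ := R <;> simp at hlen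
    simp only [List.nil_append, List.map_nil, List.sum_nil, add_zero] at hne rhomb
    rcases fourForm_ne_zero δ hne with h1 | ⟨h1, h2, -⟩
    · exact back h1.1
    · exact rhomb _ _ h1 h2 ⟨(sides _ _ h1).1, (sides _ _ h1).2.2.1⟩
  · obtain _ | ⟨c, _ | ⟨e, R⟩⟩ := R <;> simp at hlen
    simp only [List.singleton_append, List.map_cons, List.map_nil, List.sum_singleton] at hne rhomb
    rcases fourForm_ne_zero δ hne with ⟨rfl, rfl, rfl | ⟨h1, h2⟩⟩ | ⟨h1, h2, ⟨rfl, rfl⟩ | ⟨rfl, rfl⟩⟩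
    · exact back (opp_opp _).symm
    · refine rhomb _ _ h1 h2 ?_
      rw [add_vec_add_vec_opp]
      exact ⟨(sides _ _ h1).1.symm, (sides _ _ h1).2.1⟩
    · refine rhomb _ _ h1 h2 ?_
      rw [e1]
      exact ⟨(sides _ _ h1).2.2.1, (sides _ _ h1).2.2.2.symm⟩
    · exact back rfl
  · obtain _ | ⟨c, R⟩ := R <;> simp at hlen
    simp only [List.cons_append, List.nil_append, List.map_cons, List.map_nil, List.sum_cons,
      List.sum_nil, add_zero, ← add_assoc] at hne rhomb
    rcases fourForm_ne_zero δ hne with ⟨rfl, rfl, -⟩ | ⟨h1, h2, ⟨rfl, rfl⟩ | ⟨rfl, rfl⟩⟩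
    · exact back rfl
    · refine rhomb _ _ h1 h2 ?_
      rw [e1, add_vec_add_vec_opp]
      exact ⟨(sides _ _ h1).2.2.2.symm, (sides _ _ h1).2.1.symm⟩
    · refine rhomb _ _ h1 h2 ?_
      rw [add_vec_add_vec_opp, add_vec_add_vec_opp]
      exact ⟨(sides _ _ h1).2.2.1.symm, (sides _ _ h1).1.symm⟩
  · simp only [List.length_append, List.length_cons] at hlen
    omega

/-- The linear form satisfies the mirror relations. -/
theorem fourForm_mirror (L R : List Direction) {d d' : Direction} (h : d.1 ≠ d'.1) :
    fourForm (z := z) δ (L ++ d :: d' :: R) = fourForm (z := z) δ (L ++ d' :: d :: R) := by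
  by_cases hlen : (L ++ d :: d' :: R).length = 4
  swap
  · rw [fourForm_of_length z δ hlen, fourForm_of_length z δ (by simpa using hlen)]
  have o1 : d' ≠ d.opp := by
    rintro rfl
    exact h (opp_fst d).symm
  have o2 : d ≠ d'.opp := by
    rintro rfl
    exact h (opp_fst d')
  obtain _ | ⟨a, _ | ⟨b, _ | ⟨c, L⟩⟩⟩ := L
  · obtain _ | ⟨c, _ | ⟨e, _ | ⟨f, R⟩⟩⟩ := R <;> simp at hlen
    simp only [List.nil_append, fourForm, if_neg o1, if_neg o2, if_neg h, if_neg h.symm,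
      add_comm d.vec, loopForm_comm δ d]
  · obtain _ | ⟨c, _ | ⟨e, R⟩⟩ := R <;> simp at hlen
    simp only [List.singleton_append]
    by_cases hc : a.vec + d.vec + d'.vec + c.vec = 0
    · rcases closed_cases hc with ⟨rfl, rfl⟩ | ⟨rfl, rfl⟩ | ⟨-, h1⟩
      · rw [fourForm_loop_loop, fourForm_rhombus]
        exact fun h' => h ((opp_fst a).trans h')
      · rw [fourForm_loop_loop, fourForm_rhombus]
        exact fun h' => h (h'.symm.trans (opp_fst a).symm)
      · exact absurd h1 o1
    · rw [fourForm_of_not_closed δ hc, fourForm_of_not_closed]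
      rwa [add_right_comm a.vec]
  · obtain _ | ⟨c, R⟩ := R <;> simp at hlen
    simp only [List.cons_append, List.nil_append]
    by_cases hc : a.vec + b.vec + d.vec + d'.vec = 0
    · have hc' := hc
      rw [add_right_comm] at hc'
      have : b ≠ a.opp := by
        rintro rfl
        rw [vec_opp, add_neg_cancel, zero_add] at hc
        refine o1 (vec_injective ?_)
        rw [vec_opp]
        exact (neg_eq_of_add_eq_zero_right hc).symm
      rw [fourForm, if_pos hc, fourForm, if_pos hc', if_neg this, if_neg this]
    · rw [fourForm_of_not_closed δ hc, fourForm_of_not_closed]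
      rwa [add_right_comm]
  · simp only [List.length_append, List.length_cons] at hlen
    omega

/-- The linear form on a path which contains a loop in direction `d` after the edges `L` and before
the edges `R`, or zero if there is no such loop. -/
def loopValue (z : Lattice) (δ : Fin 3 → ℤˣ) (T : Set Tile) (L R : List Direction)
    (d : Direction) : ℤ :=
  open Classical in
  if Adj T (z + (L.map vec).sum) (z + (L.map vec).sum + d.vec) then
    fourForm (z := z) δ (L ++ d :: d.opp :: R)
  else 0

theorem loopValue_eq (hz : FullStar T z) {L R : List Direction} (hL : IsWalk T z L)
    (hR : IsWalk T (z + (L.map vec).sum) R) (d : Direction) :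
    loopValue z δ T L R d = fourForm (z := z) δ (L ++ d :: d.opp :: R) := by
  by_cases hA : Adj T (z + (L.map vec).sum) (z + (L.map vec).sum + d.vec)
  · rw [loopValue, if_pos hA]
  rw [loopValue, if_neg hA]
  by_contra hne
  have hne := Ne.symm hne
  have hlen : (L ++ d :: d.opp :: R).length = 4 := by
    by_contra h
    exact hne (fourForm_of_length z δ h)
  obtain _ | ⟨a, _ | ⟨b, _ | ⟨c, L⟩⟩⟩ := L
  · obtain _ | ⟨c, _ | ⟨e, _ | ⟨f, R⟩⟩⟩ := R <;> simp at hlen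
    simp only [List.nil_append, List.map_nil, List.sum_nil, add_zero] at hne hA hR
    rcases fourForm_ne_zero δ hne with ⟨-, -, rfl | ⟨h1, h2⟩⟩ | ⟨h1, -⟩
    · exact hA hR.1
    · exact hA ⟨_, hz.tileAt_mem h1 h2, isSide_tileAt z h1⟩
    · exact h1 (opp_fst _).symm
  · obtain _ | ⟨c, _ | ⟨e, R⟩⟩ := R <;> simp at hlen
    simp only [List.singleton_append, List.map_cons, List.map_nil, List.sum_singleton] at hne hA
    rcases fourForm_ne_zero δ hne with ⟨rfl, -⟩ | ⟨h1, h2, -⟩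
    · rw [add_vec_add_vec_opp] at hA
      exact hA hL.1.symm
    · exact hA ⟨_, hz.tileAt_mem h1 h2, isSide_tileAt_snd z h1⟩
  · obtain _ | ⟨c, R⟩ := R <;> simp at hlen
    simp only [List.cons_append, List.nil_append, List.map_cons, List.map_nil, List.sum_cons,
      List.sum_nil, add_zero, ← add_assoc] at hne hA
    rcases fourForm_ne_zero δ hne with ⟨rfl, -, rfl | ⟨h1, h2⟩⟩ | ⟨h1, h2, ⟨rfl, h3⟩ | ⟨rfl, h3⟩⟩
    · rw [add_vec_add_vec_opp] at hA
      exact hA hL.1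
    · rw [add_vec_add_vec_opp] at hA
      exact hA ⟨_, hz.tileAt_mem h1 h2, isSide_tileAt' z h1⟩
    · rw [opp_opp] at h3
      exact h1 ((congrArg Prod.fst h3).trans (opp_fst b))
    · rw [add_vec_add_vec_opp] at hA
      exact hA hL.2.1.symm
  · simp only [List.length_append, List.length_cons] at hlen
    omega

/-- The linear form satisfies the star relations. -/
theorem loopValue_star (hT : T ⊆ steppedPlane) (hz : FullStar T z) {η : Fin 3 → ℤˣ}
    {L R : List Direction} (hL : IsWalk T z L) (hR : IsWalk T (z + (L.map vec).sum) R) :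
    ∃ s : ℤ, ∀ j, lineSign η (z + (L.map vec).sum) j *
      (loopValue z (lineSign η z) T L R (j, true) -
        loopValue z (lineSign η z) T L R (j, false)) = s := by
  simp only [loopValue_eq _ hz hL hR]
  by_cases hlen : L.length + R.length = 2
  swap
  · refine ⟨0, fun j => ?_⟩
    rw [fourForm_of_length, fourForm_of_length, sub_zero, mul_zero] <;> simp <;> omega
  have pres : ∀ {d : Direction}, Adj T z (z + d.vec) → Present z d := by
    rintro d ⟨t, ht, hs⟩
    exact present_of_isSide (hT ht) hs
  set δ := lineSign η z
  obtain _ | ⟨a, _ | ⟨b, L⟩⟩ := L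
  · obtain _ | ⟨c, _ | ⟨e, _ | ⟨f, R⟩⟩⟩ := R <;> simp at hlen
    simp only [List.nil_append, List.map_nil, List.sum_nil, add_zero] at hR ⊢
    by_cases he : e = c.opp
    · subst he
      refine ⟨boolSign c.2 * δ c.1 * edgeExcess z c, fun j => ?_⟩
      rw [fourForm_loop_loop, fourForm_loop_loop]
      exact loopForm_line δ (pres hR.1) j
    · refine ⟨0, fun j => ?_⟩
      have : c.vec + e.vec ≠ 0 := fun h => he (vec_injective (by
        rw [vec_opp]
        exact (neg_eq_of_add_eq_zero_right h).symm))
      rw [fourForm_of_not_closed, fourForm_of_not_closed, sub_zero, mul_zero] <;>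
        simpa [vec_opp, add_assoc] using this
  · obtain _ | ⟨c, _ | ⟨e, R⟩⟩ := R <;> simp at hlen <;> try omega
    simp only [List.singleton_append, List.map_cons, List.map_nil, List.sum_singleton] at hR ⊢
    by_cases he : c = a.opp
    · subst he
      obtain ⟨s, hs⟩ := exists_lineSign_add η z a
      have ha := pres hL.1
      refine ⟨s * boolSign a.2 * δ a.1 * edgeExcess z a, fun j => ?_⟩
      rw [sub_eq_boolSign_mul (fun b => fourForm δ [a, (j, b), opp (j, b), a.opp]) a.2, hs]
      by_cases hj : a.1 = j
      · subst hj
        have h1 : fourForm (z := z) δ [a, (a.1, a.2), opp (a.1, a.2), a.opp] = 0 :=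
          fourForm_straight δ a _ _
        have h2 : fourForm (z := z) δ [a, (a.1, !a.2), opp (a.1, !a.2), a.opp] =
            edgeExcess z a := by
          have : opp (a.1, !a.2) = a := opp_opp a
          rw [this]
          refine (fourForm_loop_loop δ a a).trans ?_
          rw [loopForm, if_pos rfl, if_pos rfl]
        rw [h1, h2]
        simp
        ring
      · rw [fourForm_nested δ (b := (j, a.2)) hj, fourForm_nested δ (b := (j, !a.2)) hj]
        simp only [loopForm, hj, if_false]
        rw [← mul_sub, spanInd_sub_spanInd ha hj, if_neg (Ne.symm hj)]
        push_cast
        linear_combination (s * boolSign a.2 * δ a.1 * edgeExcess z a) * units_mul_self (δ j)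
    · refine ⟨0, fun j => ?_⟩
      have : a.vec + c.vec ≠ 0 := fun h => he (vec_injective (by
        rw [vec_opp]
        exact (neg_eq_of_add_eq_zero_right h).symm))
      rw [fourForm_of_not_closed, fourForm_of_not_closed, sub_zero, mul_zero] <;>
        simpa [vec_opp, add_assoc] using this
  · obtain rfl : L = [] := List.eq_nil_of_length_eq_zero (by
      simp only [List.length_cons] at hlen
      omega)
    obtain rfl : R = [] := List.eq_nil_of_length_eq_zero (by
      simp only [List.length_cons] at hlen
      omega)
    simp only [List.cons_append, List.nil_append, List.map_cons, List.map_nil, List.sum_cons,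
      List.sum_nil, add_zero, ← add_assoc]
    by_cases he : b = a.opp
    · subst he
      refine ⟨boolSign a.2 * δ a.1 * edgeExcess z a, fun j => ?_⟩
      rw [fourForm_loop_loop, fourForm_loop_loop, loopForm_comm, loopForm_comm δ a,
        add_vec_add_vec_opp]
      exact loopForm_line δ (pres hL.1) j
    · refine ⟨0, fun j => ?_⟩
      have : a.vec + b.vec ≠ 0 := fun h => he (vec_injective (by
        rw [vec_opp]
        exact (neg_eq_of_add_eq_zero_right h).symm))
      rw [fourForm_of_not_closed, fourForm_of_not_closed, sub_zero, mul_zero] <;>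
        simpa [vec_opp, add_assoc] using this

end

/-! ### The linear form on the algebra -/

section

variable {T : Set Tile}

theorem exists_edgeDir {x y : Vertex T} (e : x ⟶ y) : ∃ d : Direction, y.1 = x.1 + d.vec := by
  obtain ⟨t, -, hs⟩ := e.down
  obtain ⟨d, -, hd⟩ := exists_direction hs
  exact ⟨d, hd⟩

/-- The direction of an arrow. -/
def edgeDir {x y : Vertex T} (e : x ⟶ y) : Direction := (exists_edgeDir e).choose

theorem edgeDir_spec {x y : Vertex T} (e : x ⟶ y) : y.1 = x.1 + (edgeDir e).vec :=
  (exists_edgeDir e).choose_spec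

theorem edgeDir_eq {x y : Vertex T} (e : x ⟶ y) {d : Direction} (h : y.1 = x.1 + d.vec) :
    edgeDir e = d :=
  vec_injective (add_left_cancel ((edgeDir_spec e).symm.trans h))

/-- The directions of the arrows of a path. -/
def pathDirs {x : Vertex T} : ∀ {y : Vertex T}, Quiver.Path x y → List Direction
  | _, .nil => []
  | _, .cons p e => pathDirs p ++ [edgeDir e]

theorem pathDirs_comp {x y w : Vertex T} (p : Quiver.Path x y) (q : Quiver.Path y w) :
    pathDirs (p.comp q) = pathDirs p ++ pathDirs q := by
  induction q with
  | nil => simp [pathDirs]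
  | cons q e ih => simp [pathDirs, ih]

theorem pathDirs_toPath {x y : Vertex T} (e : x ⟶ y) : pathDirs e.toPath = [edgeDir e] := rfl

theorem eq_add_sum_pathDirs {x y : Vertex T} (p : Quiver.Path x y) :
    y.1 = x.1 + ((pathDirs p).map vec).sum := by
  induction p with
  | nil => simp [pathDirs]
  | cons p e ih => rw [edgeDir_spec e, ih]; simp [pathDirs, add_assoc]

theorem isWalk_pathDirs {x y : Vertex T} (p : Quiver.Path x y) :
    IsWalk T x.1 (pathDirs p) := by
  induction p with
  | nil => trivial
  | cons p e ih =>
    refine isWalk_append.2 ⟨ih, ?_, trivial⟩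
    rw [← eq_add_sum_pathDirs, ← edgeDir_spec]
    exact e.down

end

section

variable (k : Type*) [Field k] {T : Set Tile} (η : Fin 3 → ℤˣ)

open Classical in
/-- The linear form on the path algebra which is given by `fourForm` on the paths which start
at `z`. -/
def pathForm (z : Lattice) : PathAlgebra k (Vertex T) →ₗ[k] k :=
  PathAlgebra.liftLinear fun p =>
    if p.1.1 = z then ((fourForm (z := z) (lineSign η z) (pathDirs p.2.2) : ℤ) : k) else 0

variable {z : Lattice}

theorem pathForm_ofPath {x y : Vertex T} (hx : x.1 = z) (p : Quiver.Path x y) :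
    pathForm k η z (PathAlgebra.ofPath p) =
      ((fourForm (z := z) (lineSign η z) (pathDirs p) : ℤ) : k) := by
  rw [pathForm, PathAlgebra.liftLinear_ofPath, if_pos hx]

theorem pathForm_ofPath_of_ne {x y : Vertex T} (hx : x.1 ≠ z) (p : Quiver.Path x y) :
    pathForm k η z (PathAlgebra.ofPath p) = 0 := by
  rw [pathForm, PathAlgebra.liftLinear_ofPath, if_neg hx]

theorem smul_mul_path (c : k) (f g : PathAlgebra k (Vertex T)) : c • f * g = c • (f * g) := by
  rw [PathAlgebra.mul_def, PathAlgebra.mul_def, map_smul, LinearMap.smul_apply]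

theorem mul_smul_path (c : k) (f g : PathAlgebra k (Vertex T)) : f * c • g = c • (f * g) := by
  rw [PathAlgebra.mul_def, PathAlgebra.mul_def, map_smul]

theorem pathForm_nil_mul {x : Vertex T} (hx : x.1 = z) (f : PathAlgebra k (Vertex T)) :
    pathForm k η z (PathAlgebra.ofPath (.nil : Quiver.Path x x) * f) = pathForm k η z f := by
  induction f using PathAlgebra.induction with
  | zero => rw [mul_zero]
  | add f g hf hg => rw [mul_add, map_add, map_add, hf, hg]
  | smul_path c a b p =>
    rw [mul_smul_path, map_smul, map_smul]
    by_cases h : a = x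
    · subst h
      rw [PathAlgebra.ofPath_mul_comp, Quiver.Path.nil_comp]
    · rw [PathAlgebra.ofPath_mul_ne _ _ h, pathForm_ofPath_of_ne, map_zero]
      exact fun h' => h (Subtype.ext (h'.trans hx.symm))

theorem fourForm_of_sum_ne {δ : Fin 3 → ℤˣ} {L : List Direction} (h : (L.map vec).sum ≠ 0) :
    fourForm (z := z) δ L = 0 := by
  by_cases hl : L.length = 4
  · obtain _ | ⟨a, _ | ⟨b, _ | ⟨c, _ | ⟨d, _ | ⟨e, L⟩⟩⟩⟩⟩ := L <;> simp at hl
    exact fourForm_of_not_closed δ (by simpa [add_assoc] using h)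
  · exact fourForm_of_length z δ hl

theorem pathForm_mul_nil {x : Vertex T} (hx : x.1 = z) (f : PathAlgebra k (Vertex T)) :
    pathForm k η z (f * PathAlgebra.ofPath (.nil : Quiver.Path x x)) = pathForm k η z f := by
  induction f using PathAlgebra.induction with
  | zero => rw [zero_mul]
  | add f g hf hg => rw [add_mul, map_add, map_add, hf, hg]
  | smul_path c a b p =>
    rw [smul_mul_path, map_smul, map_smul]
    by_cases h : x = b
    · subst h
      rw [PathAlgebra.ofPath_mul_comp, Quiver.Path.comp_nil]
    · rw [PathAlgebra.ofPath_mul_ne _ _ h, map_zero]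
      by_cases ha : a.1 = z
      · rw [pathForm_ofPath k η ha, fourForm_of_sum_ne, Int.cast_zero]
        intro h0
        refine h (Subtype.ext ?_)
        rw [hx, eq_add_sum_pathDirs p, h0, ha, add_zero]
      · rw [pathForm_ofPath_of_ne k η ha]

/-- The elements which generate an ideal in the kernel of the linear form. -/
def formIdeal (z : Lattice) : TwoSidedIdeal (PathAlgebra k (Vertex T)) :=
  .mk' {f | ∀ g h, pathForm k η z (g * f * h) = 0}
    (fun g h => by rw [mul_zero, zero_mul, map_zero])
    (fun {a b} ha hb g h => by rw [mul_add, add_mul, map_add, ha, hb, add_zero])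
    (fun {a} ha g h => by rw [mul_neg, neg_mul, map_neg, ha, neg_zero])
    (fun {a b} hb g h => by
      rw [← mul_assoc]
      exact hb _ _)
    (fun {a b} ha g h => by
      rw [← mul_assoc, mul_assoc (g * a)]
      exact ha _ _)

variable {k η} in
theorem mem_formIdeal {f : PathAlgebra k (Vertex T)} : f ∈ formIdeal k η z ↔
    ∀ g h, pathForm k η z (g * f * h) = 0 := by
  rw [formIdeal, TwoSidedIdeal.mem_mk']
  rfl

variable {k η} in
/-- It is enough to consider products with paths which fit together with the element. -/
theorem mem_formIdeal_of_paths {x y : Vertex T} {f : PathAlgebra k (Vertex T)}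
    (hx : PathAlgebra.ofPath (.nil : Quiver.Path x x) * f = f)
    (hy : f * PathAlgebra.ofPath (.nil : Quiver.Path y y) = f)
    (h : ∀ (a b : Vertex T) (_ : a.1 = z) (p : Quiver.Path a x) (q : Quiver.Path y b),
      pathForm k η z (PathAlgebra.ofPath p * f * PathAlgebra.ofPath q) = 0) :
    f ∈ formIdeal k η z := by
  refine mem_formIdeal.2 fun g g' => ?_
  induction g using PathAlgebra.induction with
  | zero => rw [zero_mul, zero_mul, map_zero]
  | add g₁ g₂ h₁ h₂ => rw [add_mul, add_mul, map_add, h₁, h₂, add_zero]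
  | smul_path c a b p =>
    rw [smul_mul_path, smul_mul_path, map_smul]
    refine smul_eq_zero_of_right _ ?_
    induction g' using PathAlgebra.induction with
    | zero => rw [mul_zero, map_zero]
    | add g₁ g₂ h₁ h₂ => rw [mul_add, map_add, h₁, h₂, add_zero]
    | smul_path c a' b' q =>
      rw [mul_smul_path, map_smul]
      refine smul_eq_zero_of_right _ ?_
      by_cases h1 : x = b
      · subst h1
        by_cases h2 : a' = y
        · subst h2
          by_cases h3 : a.1 = z
          · exact h _ _ h3 p q
          · rw [pathForm, mul_assoc]
            have : ∀ g, pathForm k η z (PathAlgebra.ofPath p * g) = 0 := fun g => by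
              induction g using PathAlgebra.induction with
              | zero => rw [mul_zero, map_zero]
              | add g₁ g₂ h₁ h₂ => rw [mul_add, map_add, h₁, h₂, add_zero]
              | smul_path c a' b' q =>
                rw [mul_smul_path, map_smul]
                refine smul_eq_zero_of_right _ ?_
                by_cases h : a' = x
                · subst h
                  rw [PathAlgebra.ofPath_mul_comp, pathForm_ofPath_of_ne k η h3]
                · rw [PathAlgebra.ofPath_mul_ne _ _ h, map_zero]
            exact this _
        · rw [← hy, ← mul_assoc, mul_assoc _ _ (PathAlgebra.ofPath q),
            PathAlgebra.ofPath_mul_ne _ _ h2, mul_zero, map_zero]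
      · rw [← hx, ← mul_assoc, PathAlgebra.ofPath_mul_ne _ _ h1, zero_mul, zero_mul, map_zero]

theorem roundTrip_of_adj {x : Vertex T} {d : Lattice} (h : Adj T x.1 (x.1 + d)) :
    roundTrip k T x d = PathAlgebra.ofPath
      ((Quiver.Hom.toPath (⟨h⟩ : x ⟶ mkVertex T (x.1 + d) h.exists_corner)).comp
        (Quiver.Hom.toPath (⟨h.symm⟩ : mkVertex T (x.1 + d) h.exists_corner ⟶ x))) :=
  dif_pos h

theorem roundTrip_of_not_adj {x : Vertex T} {d : Lattice} (h : ¬ Adj T x.1 (x.1 + d)) :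
    roundTrip k T x d = 0 :=
  dif_neg h

theorem pathForm_mul_roundTrip {x a b : Vertex T} (ha : a.1 = z) (p : Quiver.Path a x)
    (q : Quiver.Path x b) (d : Direction) :
    pathForm k η z (PathAlgebra.ofPath p * roundTrip k T x d.vec * PathAlgebra.ofPath q) =
      ((loopValue z (lineSign η z) T (pathDirs p) (pathDirs q) d : ℤ) : k) := by
  have hx := eq_add_sum_pathDirs p
  rw [ha] at hx
  by_cases h : Adj T x.1 (x.1 + d.vec)
  · rw [roundTrip_of_adj k h, PathAlgebra.ofPath_mul_comp, PathAlgebra.ofPath_mul_comp,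
      pathForm_ofPath k η ha, loopValue, if_pos (hx ▸ h), pathDirs_comp, pathDirs_comp,
      pathDirs_comp, pathDirs_toPath, pathDirs_toPath, edgeDir_eq (d := d) _ rfl,
      edgeDir_eq (d := d.opp) _ (add_vec_add_vec_opp _ _).symm]
    simp
  · rw [roundTrip_of_not_adj k h, loopValue, if_neg (hx ▸ h), mul_zero, zero_mul, map_zero,
      Int.cast_zero]

theorem nil_mul_roundTrip (x : Vertex T) (d : Lattice) :
    PathAlgebra.ofPath (.nil : Quiver.Path x x) * roundTrip k T x d = roundTrip k T x d := by
  by_cases h : Adj T x.1 (x.1 + d)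
  · rw [roundTrip_of_adj k h, PathAlgebra.ofPath_mul_comp, Quiver.Path.nil_comp]
  · rw [roundTrip_of_not_adj k h, mul_zero]

theorem roundTrip_mul_nil (x : Vertex T) (d : Lattice) :
    roundTrip k T x d * PathAlgebra.ofPath (.nil : Quiver.Path x x) = roundTrip k T x d := by
  by_cases h : Adj T x.1 (x.1 + d)
  · rw [roundTrip_of_adj k h, PathAlgebra.ofPath_mul_comp, Quiver.Path.comp_nil]
  · rw [roundTrip_of_not_adj k h, zero_mul]

theorem nil_mul_lineDiff (x : Vertex T) (j : Fin 3) :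
    PathAlgebra.ofPath (.nil : Quiver.Path x x) * lineDiff k T x j = lineDiff k T x j := by
  rw [lineDiff, mul_sub, nil_mul_roundTrip, nil_mul_roundTrip]

theorem lineDiff_mul_nil (x : Vertex T) (j : Fin 3) :
    lineDiff k T x j * PathAlgebra.ofPath (.nil : Quiver.Path x x) = lineDiff k T x j := by
  rw [lineDiff, sub_mul, roundTrip_mul_nil, roundTrip_mul_nil]

/-- The linear form vanishes on the relations. -/
theorem relation_mem_formIdeal (hT : T ⊆ steppedPlane) (hz : FullStar T z)
    (hη : η 0 * η 1 * η 2 = 1) {r : PathAlgebra k (Vertex T)} (hr : IsRelation k η r) :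
    r ∈ formIdeal k η z := by
  cases hr with
  | @twoRhombus x y w a b h =>
    refine mem_formIdeal_of_paths (x := x) (y := w)
      (by rw [PathAlgebra.ofPath_mul_comp, Quiver.Path.nil_comp])
      (by rw [PathAlgebra.ofPath_mul_comp, Quiver.Path.comp_nil]) fun s t hs p q => ?_
    have hx := eq_add_sum_pathDirs p
    have hw := isWalk_pathDirs ((p.comp (a.toPath.comp b.toPath)).comp q)
    rw [hs] at hx hw
    rw [PathAlgebra.ofPath_mul_comp, PathAlgebra.ofPath_mul_comp, pathForm_ofPath k η hs]
    simp only [pathDirs_comp, pathDirs_toPath, List.append_assoc,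
      List.nil_append, List.cons_append] at hw ⊢
    rw [fourForm_twoRhombus _ hz _ _ _ _ hw, Int.cast_zero]
    rwa [← hx, ← edgeDir_spec, ← edgeDir_spec]
  | @mirror x y y' w t ht c hx hy hw hy' a b a' b' =>
    refine mem_formIdeal_of_paths (x := x) (y := w)
      (by simp only [mul_sub, PathAlgebra.ofPath_mul_comp, Quiver.Path.nil_comp])
      (by simp only [sub_mul, PathAlgebra.ofPath_mul_comp, Quiver.Path.comp_nil])
      fun s u hs p q => ?_
    have key : ∀ (n : Fin 3) (c : Fin 4), ∃ d d' : Direction, d.1 ≠ d'.1 ∧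
        corner (0, n) (c + 1) = corner (0, n) c + d.vec ∧
        corner (0, n) (c + 2) = corner (0, n) c + d.vec + d'.vec ∧
        corner (0, n) (c + 3) = corner (0, n) c + d'.vec := by decide
    obtain ⟨d, d', hd, h1, h2, h3⟩ := key t.2 c
    have h1 : y.1 = x.1 + d.vec := by rw [hy, corner_eq, h1, hx, corner_eq t c]; abel
    have h2 : w.1 = x.1 + d.vec + d'.vec := by rw [hw, corner_eq, h2, hx, corner_eq t c]; abel
    have h3 : y'.1 = x.1 + d'.vec := by rw [hy', corner_eq, h3, hx, corner_eq t c]; abel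
    rw [mul_sub, sub_mul, map_sub]
    simp only [PathAlgebra.ofPath_mul_comp, pathForm_ofPath k η hs, pathDirs_comp, pathDirs_toPath,
      List.append_assoc, List.nil_append, List.cons_append]
    rw [edgeDir_eq a h1, edgeDir_eq a' h3, edgeDir_eq (d := d') b (by rw [h2, h1]),
      edgeDir_eq (d := d) b' (by rw [h2, h3, add_right_comm]), fourForm_mirror _ _ _ hd, sub_self]
  | star x j =>
    refine mem_formIdeal_of_paths (x := x) (y := x) ?_ ?_ fun s u hs p q => ?_
    · rw [mul_sub, mul_smul_comm, nil_mul_lineDiff, nil_mul_lineDiff]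
    · rw [sub_mul, smul_mul_assoc, lineDiff_mul_nil, lineDiff_mul_nil]
    · have hx := eq_add_sum_pathDirs p
      have hL := isWalk_pathDirs p
      have hR := isWalk_pathDirs q
      rw [hs] at hx hL
      rw [hx] at hR
      obtain ⟨v, hv⟩ := loopValue_star hT hz (η := η) hL hR
      have e : ∀ j, pathForm k η z (PathAlgebra.ofPath p * lineDiff k T x j *
          PathAlgebra.ofPath q) =
          ((lineSign η x.1 j * v : ℤ) : k) := fun j => by
        have h1 := pathForm_mul_roundTrip k η hs p q (j, true)
        have h2 := pathForm_mul_roundTrip k η hs p q (j, false)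
        have h3 := congrArg (HMul.hMul (lineSign η x.1 j : ℤ)) (hv j)
        rw [← hx, ← mul_assoc, units_mul_self, one_mul] at h3
        rw [lineDiff, mul_sub, sub_mul, map_sub]
        refine (congrArg₂ (· - ·) h1 h2).trans ?_
        rw [← Int.cast_sub, h3]
      rw [mul_sub, sub_mul, map_sub, mul_smul_comm, smul_mul_assoc, map_zsmul, e, e,
        starSign_eq hη, zsmul_eq_mul, ← Int.cast_mul, ← Int.cast_sub]
      have h := units_mul_self (lineSign η x.1 (j + 1))
      rw [Units.val_mul, mul_assoc, ← mul_assoc _ _ v, h, one_mul, sub_self, Int.cast_zero]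

theorem pathForm_eq_of_rel (hT : T ⊆ steppedPlane) (hz : FullStar T z)
    (hη : η 0 * η 1 * η 2 = 1) (hz' : ∃ t ∈ T, ∃ a, z = corner t a)
    {f g : PathAlgebra k (Vertex T)} (h : (relationIdeal k T η).ringCon f g) :
    pathForm k η z f = pathForm k η z g := by
  have hle : relationIdeal k T η ≤ formIdeal k η z :=
    TwoSidedIdeal.span_le.2 fun r hr => relation_mem_formIdeal k η hT hz hη hr
  have := mem_formIdeal.1 (hle ((TwoSidedIdeal.rel_iff _ f g).1 h))
    (PathAlgebra.ofPath (.nil : Quiver.Path (mkVertex T z hz') _))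
    (PathAlgebra.ofPath (.nil : Quiver.Path (mkVertex T z hz') _))
  rw [pathForm_mul_nil k η (z := z) rfl, pathForm_nil_mul k η (z := z) rfl, map_sub] at this
  exact sub_eq_zero.1 this

/-- The linear form on the algebra which is induced by `pathForm`. -/
def algForm (hT : T ⊆ steppedPlane) (hz : FullStar T z) (hη : η 0 * η 1 * η 2 = 1)
    (hz' : ∃ t ∈ T, ∃ a, z = corner t a) : RhombalAlgebra k T η →+ k where
  toFun := Quotient.lift (pathForm k η z) fun _ _ h => pathForm_eq_of_rel k η hT hz hη hz' h
  map_zero' := map_zero (pathForm k η z)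
  map_add' := by
    rintro ⟨f⟩ ⟨g⟩
    exact map_add (pathForm k η z) f g

theorem algForm_quotMap (hT : T ⊆ steppedPlane) (hz : FullStar T z) (hη : η 0 * η 1 * η 2 = 1)
    (hz' : ∃ t ∈ T, ∃ a, z = corner t a) (f : PathAlgebra k (Vertex T)) :
    algForm k η hT hz hη hz' (quotMap k η f) = pathForm k η z f := rfl

theorem quotMap_surjective (x : RhombalAlgebra k T η) : ∃ f, quotMap k η f = x := by
  obtain ⟨f⟩ := x
  exact ⟨f, rfl⟩

end

/-! ### The filtration by the length of paths -/

section

variable {k : Type*} [Field k] {η : Fin 3 → ℤˣ} {i : ℕ}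

theorem FinRauzyAlgebra.incl_injective :
    Function.Injective (FinRauzyAlgebra.incl : FinRauzyAlgebra k η i →ₙ+* _) :=
  fun _ _ h => Subtype.ext h

theorem vertexIdem_mul_quotMap {T : Set Tile} {x y : Vertex T} (c : k) (p : Quiver.Path x y) :
    vertexIdem k η x * quotMap k η (c • PathAlgebra.ofPath p) =
      quotMap k η (c • PathAlgebra.ofPath p) := by
  rw [vertexIdem, pathElt, ← map_mul, mul_smul_path, PathAlgebra.ofPath_mul_comp,
    Quiver.Path.nil_comp]

theorem quotMap_mul_vertexIdem {T : Set Tile} {x y : Vertex T} (c : k) (p : Quiver.Path x y) :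
    quotMap k η (c • PathAlgebra.ofPath p) * vertexIdem k η y =
      quotMap k η (c • PathAlgebra.ofPath p) := by
  rw [vertexIdem, pathElt, ← map_mul, smul_mul_path, PathAlgebra.ofPath_mul_comp,
    Quiver.Path.comp_nil]

theorem sumIdem_mul_quotMap {T : Set Tile} {V : Finset (Vertex T)} {x y : Vertex T} (hx : x ∈ V)
    (c : k) (p : Quiver.Path x y) : sumIdem k η V * quotMap k η (c • PathAlgebra.ofPath p) =
      quotMap k η (c • PathAlgebra.ofPath p) := by
  rw [← vertexIdem_mul_quotMap, ← mul_assoc, sumIdem_mul_vertexIdem k η hx]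

theorem quotMap_mul_sumIdem {T : Set Tile} {V : Finset (Vertex T)} {x y : Vertex T} (hy : y ∈ V)
    (c : k) (p : Quiver.Path x y) : quotMap k η (c • PathAlgebra.ofPath p) * sumIdem k η V =
      quotMap k η (c • PathAlgebra.ofPath p) := by
  rw [← quotMap_mul_vertexIdem, mul_assoc, vertexIdem_mul_sumIdem k η hy]

variable (η) in
/-- A multiple of a path between vertices of the patch, as an element of `A_i`. -/
def finPath {x y : Vertex tiling} (hx : x ∈ patchVertices i) (hy : y ∈ patchVertices i) (c : k)
    (p : Quiver.Path x y) : FinRauzyAlgebra k η i :=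
  ⟨quotMap k η (c • PathAlgebra.ofPath p),
    (Subsemigroup.mem_corner_iff (isIdempotentElem_sumIdem k η _)).2
      ⟨sumIdem_mul_quotMap hx c p, quotMap_mul_sumIdem hy c p⟩⟩

theorem incl_finPath {x y : Vertex tiling} (hx : x ∈ patchVertices i) (hy : y ∈ patchVertices i)
    (c : k) (p : Quiver.Path x y) :
    (finPath η hx hy c p).incl = quotMap k η (c • PathAlgebra.ofPath p) := rfl

theorem incl_finPath_one {x y : Vertex tiling} (hx : x ∈ patchVertices i)
    (hy : y ∈ patchVertices i) (p : Quiver.Path x y) :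
    (finPath η hx hy (1 : k) p).incl = pathElt k η p := by
  rw [incl_finPath, one_smul, pathElt]

theorem finPath_mul {x y w : Vertex tiling} (hx : x ∈ patchVertices i) (hy hy' : y ∈ patchVertices i)
    (hw : w ∈ patchVertices i) (c c' : k) (p : Quiver.Path x y) (q : Quiver.Path y w) :
    finPath η hx hy c p * finPath η hy' hw c' q = finPath η hx hw (c * c') (p.comp q) := by
  apply FinRauzyAlgebra.incl_injective
  rw [map_mul, incl_finPath, incl_finPath, incl_finPath, ← map_mul, smul_mul_path, mul_smul_path,
    PathAlgebra.ofPath_mul_comp, smul_smul]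

theorem finPath_mul_of_ne {x y y' w : Vertex tiling} (hx : x ∈ patchVertices i)
    (hy : y ∈ patchVertices i) (hy' : y' ∈ patchVertices i) (hw : w ∈ patchVertices i) (c c' : k)
    (p : Quiver.Path x y) (q : Quiver.Path y' w) (h : y' ≠ y) :
    finPath η hx hy c p * finPath η hy' hw c' q = 0 := by
  apply FinRauzyAlgebra.incl_injective
  rw [map_mul, incl_finPath, incl_finPath, ← map_mul, smul_mul_path, mul_smul_path,
    PathAlgebra.ofPath_mul_ne _ _ h, smul_zero, smul_zero, map_zero, map_zero]

theorem finPath_add {x y : Vertex tiling} (hx : x ∈ patchVertices i) (hy : y ∈ patchVertices i)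
    (c c' : k) (p : Quiver.Path x y) :
    finPath η hx hy (c + c') p = finPath η hx hy c p + finPath η hx hy c' p := by
  apply FinRauzyAlgebra.incl_injective
  rw [map_add, incl_finPath, incl_finPath, incl_finPath, add_smul, map_add]

theorem finPath_zero {x y : Vertex tiling} (hx : x ∈ patchVertices i) (hy : y ∈ patchVertices i)
    (p : Quiver.Path x y) : finPath η hx hy (0 : k) p = 0 := by
  apply FinRauzyAlgebra.incl_injective
  rw [incl_finPath, zero_smul, map_zero, map_zero]

theorem finVertexIdem_eq {x : Vertex tiling} (hx : x ∈ patchVertices i) :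
    finVertexIdem k η hx = finPath η hx hx 1 .nil := by
  apply FinRauzyAlgebra.incl_injective
  rw [incl_finPath_one]
  rfl

theorem finVertexChar_finPath {x y w : Vertex tiling} (hx : x ∈ patchVertices i)
    (hy : y ∈ patchVertices i) (hw : w ∈ patchVertices i) (c : k) (p : Quiver.Path x y)
    (hp : 1 ≤ p.length) : finVertexChar k η hw (finPath η hx hy c p) = 0 := by
  change pathChar k w (c • PathAlgebra.ofPath p) = 0
  rw [map_smul, pathChar, PathAlgebra.liftLinear_ofPath, if_neg, smul_zero]
  intro h
  have := congrArg (fun p : Σ a b : Vertex tiling, Quiver.Path a b => p.2.2.length) h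
  simp at this
  omega

theorem finVertexChar_finPath_nil {x : Vertex tiling} (hx hx' hx'' : x ∈ patchVertices i) (c : k) :
    finVertexChar k η hx (finPath η hx' hx'' c .nil) = c := by
  change pathChar k x (c • PathAlgebra.ofPath _) = c
  rw [map_smul, pathChar, PathAlgebra.liftLinear_ofPath, if_pos rfl, smul_eq_mul, mul_one]

theorem finVertexChar_finPath_nil_of_ne {x w : Vertex tiling} (hx hx' : x ∈ patchVertices i)
    (hw : w ∈ patchVertices i) (c : k) (h : x ≠ w) :
    finVertexChar k η hw (finPath η hx hx' c .nil) = 0 := by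
  change pathChar k w (c • PathAlgebra.ofPath _) = 0
  rw [map_smul, pathChar, PathAlgebra.liftLinear_ofPath, if_neg, smul_zero]
  exact fun h' => h (congrArg (fun p : Σ a b : Vertex tiling, Quiver.Path a b => p.1) h')

variable (k η i) in
/-- The additive subgroup of `A_i` which is generated by the multiples of paths of length at
least `n`. -/
def finDeg (n : ℕ) : AddSubgroup (FinRauzyAlgebra k η i) :=
  .closure {b | ∃ (x y : Vertex tiling) (hx : x ∈ patchVertices i) (hy : y ∈ patchVertices i)
    (c : k) (p : Quiver.Path x y), n ≤ p.length ∧ b = finPath η hx hy c p}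

theorem finPath_mem_finDeg {x y : Vertex tiling} (hx : x ∈ patchVertices i)
    (hy : y ∈ patchVertices i) (c : k) {p : Quiver.Path x y} {n : ℕ} (hp : n ≤ p.length) :
    finPath η hx hy c p ∈ finDeg k η i n :=
  AddSubgroup.subset_closure ⟨x, y, hx, hy, c, p, hp, rfl⟩

theorem finDeg_le {n : ℕ} {H : AddSubgroup (FinRauzyAlgebra k η i)}
    (h : ∀ (x y : Vertex tiling) (hx : x ∈ patchVertices i) (hy : y ∈ patchVertices i)
      (c : k) (p : Quiver.Path x y), n ≤ p.length → finPath η hx hy c p ∈ H) :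
    finDeg k η i n ≤ H := by
  refine (AddSubgroup.closure_le _).2 ?_
  rintro b ⟨x, y, hx, hy, c, p, hp, rfl⟩
  exact h x y hx hy c p hp

theorem mul_mem_finDeg {m n : ℕ} {a b : FinRauzyAlgebra k η i} (ha : a ∈ finDeg k η i m)
    (hb : b ∈ finDeg k η i n) : a * b ∈ finDeg k η i (m + n) := by
  have h1 : finDeg k η i m ≤ (finDeg k η i (m + n)).comap (AddMonoidHom.mulRight b) := by
    refine finDeg_le fun x y hx hy c p hp => ?_
    have h2 : finDeg k η i n ≤
        (finDeg k η i (m + n)).comap (AddMonoidHom.mulLeft (finPath η hx hy c p)) := by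
      refine finDeg_le fun x' y' hx' hy' c' p' hp' => ?_
      change finPath η hx hy c p * finPath η hx' hy' c' p' ∈ finDeg k η i (m + n)
      by_cases h : x' = y
      · subst h
        rw [finPath_mul]
        refine finPath_mem_finDeg _ _ _ ?_
        rw [Quiver.Path.length_comp]
        omega
      · rw [finPath_mul_of_ne _ _ _ _ _ _ _ _ h]
        exact zero_mem _
    exact h2 hb
  exact h1 ha

/-- The algebra `e_i A e_i` is spanned by the paths whose ends lie in the patch; their inner vertices
may lie outside. -/
theorem mem_finDeg_zero (b : FinRauzyAlgebra k η i) : b ∈ finDeg k η i 0 := by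
  have key : ∀ f : PathAlgebra k (Vertex tiling), ∃ a ∈ finDeg k η i 0,
      a.incl = sumIdem k η (patchVertices i) * quotMap k η f * sumIdem k η (patchVertices i) := by
    intro f
    induction f using PathAlgebra.induction with
    | zero => exact ⟨0, zero_mem _, by rw [map_zero, map_zero, mul_zero, zero_mul]⟩
    | add f g hf hg =>
      obtain ⟨a, ha, hf⟩ := hf
      obtain ⟨b, hb, hg⟩ := hg
      exact ⟨a + b, add_mem ha hb, by rw [map_add, map_add, mul_add, add_mul, hf, hg]⟩
    | smul_path c x y p =>
      by_cases hx : x ∈ patchVertices i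
      · by_cases hy : y ∈ patchVertices i
        · refine ⟨finPath η hx hy c p, finPath_mem_finDeg _ _ _ (Nat.zero_le _), ?_⟩
          rw [sumIdem_mul_quotMap hx, quotMap_mul_sumIdem hy, incl_finPath]
        · refine ⟨0, zero_mem _, ?_⟩
          have h0 : vertexIdem k η y * sumIdem k η (patchVertices i) = 0 := by
            rw [sumIdem, Finset.mul_sum]
            exact Finset.sum_eq_zero fun w hw => vertexIdem_mul_ne k η fun h => hy (h ▸ hw)
          rw [← quotMap_mul_vertexIdem, mul_assoc, mul_assoc, h0, mul_zero, mul_zero, map_zero]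
      · refine ⟨0, zero_mem _, ?_⟩
        have h0 : sumIdem k η (patchVertices i) * vertexIdem k η x = 0 := by
          rw [sumIdem, Finset.sum_mul]
          exact Finset.sum_eq_zero fun w hw => vertexIdem_mul_ne k η fun h => hx (h ▸ hw)
        rw [← vertexIdem_mul_quotMap, ← mul_assoc, h0, zero_mul, zero_mul, map_zero]
  obtain ⟨f, hf⟩ := quotMap_surjective k η b.incl
  obtain ⟨a, ha, h⟩ := key f
  obtain rfl : a = b := by
    apply FinRauzyAlgebra.incl_injective
    obtain ⟨h1, h2⟩ := (Subsemigroup.mem_corner_iff (isIdempotentElem_sumIdem k η _)).1 b.2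
    rw [h, hf]
    exact (congrArg (· * _) h1).trans h2
  exact ha

/-- Elements of degree five vanish, since all paths of length five do. -/
theorem finDeg_five_eq_zero {b : FinRauzyAlgebra k η i} (hb : b ∈ finDeg k η i 5) : b = 0 := by
  have : finDeg k η i 5 ≤ ⊥ := by
    refine finDeg_le fun x y hx hy c p hp => (AddSubgroup.mem_bot).2 ?_
    apply FinRauzyAlgebra.incl_injective
    rw [incl_finPath, ← one_mul c, ← smul_smul, one_smul, map_zero]
    have := pathElt_eq_zero k η tiling_subset p hp
    rw [← Quiver.Path.nil_comp p, ← PathAlgebra.ofPath_mul_comp, ← smul_mul_path, map_mul]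
    rw [pathElt] at this
    rw [this, mul_zero]
  exact AddSubgroup.mem_bot.1 (this hb)

/-- The difference of an element and its part of degree zero, which is read off by the
characters. -/
def finRadPart (b : FinRauzyAlgebra k η i) : FinRauzyAlgebra k η i :=
  b - ∑ x ∈ (patchVertices i).attach, finPath η x.2 x.2 (finVertexChar k η x.2 b) .nil

theorem finRadPart_mem (b : FinRauzyAlgebra k η i) : finRadPart b ∈ finDeg k η i 1 := by
  let D : FinRauzyAlgebra k η i →+ FinRauzyAlgebra k η i :=
    { toFun := finRadPart
      map_zero' := by
        simp [finRadPart, finPath_zero]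
      map_add' := fun a b => by
        simp only [finRadPart, map_add, finPath_add, Finset.sum_add_distrib]
        abel }
  have h : finDeg k η i 0 ≤ (finDeg k η i 1).comap D := by
    refine finDeg_le fun x y hx hy c p _ => ?_
    change finRadPart (finPath η hx hy c p) ∈ finDeg k η i 1
    rw [finRadPart]
    cases p with
    | nil =>
      rw [Finset.sum_eq_single ⟨x, hx⟩]
      · rw [finVertexChar_finPath_nil, sub_self]
        exact zero_mem _
      · intro w _ hw
        rw [finVertexChar_finPath_nil_of_ne _ _ _ _ fun h => hw (Subtype.ext h.symm), finPath_zero]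
      · exact fun h => absurd (Finset.mem_attach _ _) h
    | cons p e =>
      rw [Finset.sum_eq_zero, sub_zero]
      · exact finPath_mem_finDeg _ _ _ (by simp)
      · intro w _
        rw [finVertexChar_finPath _ _ _ _ _ (by simp), finPath_zero]
  exact h (mem_finDeg_zero b)

/-- The elements of positive degree are those on which all characters vanish. -/
theorem mem_finDeg_one_iff {b : FinRauzyAlgebra k η i} :
    b ∈ finDeg k η i 1 ↔
      ∀ (x : Vertex tiling) (hx : x ∈ patchVertices i), finVertexChar k η hx b = 0 := by
  constructor
  · intro hb x hx
    have : finDeg k η i 1 ≤ (finVertexChar k η hx).toAddMonoidHom.ker :=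
      finDeg_le fun _ _ hy hw c p hp => finVertexChar_finPath hy hw hx c p hp
    exact this hb
  · intro h
    have := finRadPart_mem b
    rwa [finRadPart, Finset.sum_eq_zero, sub_zero] at this
    intro x _
    rw [h, finPath_zero]

theorem mul_mem_finDeg_one_left {j : FinRauzyAlgebra k η i} (hj : j ∈ finDeg k η i 1)
    (a : FinRauzyAlgebra k η i) : a * j ∈ finDeg k η i 1 := by
  simpa using mul_mem_finDeg (mem_finDeg_zero a) hj

theorem mul_mem_finDeg_one_right {j : FinRauzyAlgebra k η i} (hj : j ∈ finDeg k η i 1)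
    (a : FinRauzyAlgebra k η i) : j * a ∈ finDeg k η i 1 := by
  simpa using mul_mem_finDeg hj (mem_finDeg_zero a)

theorem isNilpotent_of_mem_finDeg_one {j : FinRauzyAlgebra k η i} (hj : j ∈ finDeg k η i 1) :
    IsNilpotent j := by
  have : ∀ n, j ^ n ∈ finDeg k η i n := by
    intro n
    induction n with
    | zero => exact mem_finDeg_zero _
    | succ n ih =>
      rw [pow_succ]
      exact mul_mem_finDeg ih hj
  exact ⟨5, finDeg_five_eq_zero (this 5)⟩

theorem mem_jacobson_of_forall_isNilpotent {R : Type*} [Ring R] {j : R}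
    (h : ∀ y, IsNilpotent (y * j)) : j ∈ Ring.jacobson R := by
  rw [← Ideal.jacobson_bot, Ideal.mem_jacobson_iff]
  intro y
  obtain ⟨u, hu⟩ := (h y).isUnit_one_add
  refine ⟨((u⁻¹ : Rˣ) : R), ?_⟩
  have := u.inv_mul
  rw [hu, mul_add, mul_one, ← mul_assoc] at this
  rw [Ideal.mem_bot, add_comm, this, sub_self]

theorem mem_jacobson_of_mem_finDeg_one {j : FinRauzyAlgebra k η i} (hj : j ∈ finDeg k η i 1) :
    j ∈ Ring.jacobson (FinRauzyAlgebra k η i) :=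
  mem_jacobson_of_forall_isNilpotent fun y =>
    isNilpotent_of_mem_finDeg_one (mul_mem_finDeg_one_left hj y)

theorem finPath_mul_eq {x y : Vertex tiling} (hx : x ∈ patchVertices i) (hy : y ∈ patchVertices i)
    (c : k) (p : Quiver.Path x y) (b : FinRauzyAlgebra k η i) : finPath η hx hy c p * b =
      finPath η hx hy (c * finVertexChar k η hy b) p + finPath η hx hy c p * finRadPart b := by
  rw [finRadPart, mul_sub, Finset.mul_sum, Finset.sum_eq_single ⟨y, hy⟩]
  · rw [finPath_mul, Quiver.Path.comp_nil]
    abel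
  · exact fun w _ hw => finPath_mul_of_ne _ _ _ _ _ _ _ _ fun h => hw (Subtype.ext h)
  · exact fun h => absurd (Finset.mem_attach _ _) h

theorem mul_finPath_eq {x y : Vertex tiling} (hx : x ∈ patchVertices i) (hy : y ∈ patchVertices i)
    (c : k) (p : Quiver.Path x y) (b : FinRauzyAlgebra k η i) : b * finPath η hx hy c p =
      finPath η hx hy (finVertexChar k η hx b * c) p + finRadPart b * finPath η hx hy c p := by
  rw [finRadPart, sub_mul, Finset.sum_mul, Finset.sum_eq_single ⟨x, hx⟩]
  · rw [finPath_mul, Quiver.Path.nil_comp]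
    abel
  · exact fun w _ hw => finPath_mul_of_ne _ _ _ _ _ _ _ _ fun h => hw (Subtype.ext h.symm)
  · exact fun h => absurd (Finset.mem_attach _ _) h

end

/-! ### Radical and socle of the projective modules -/

section

variable {k : Type*} [Field k] {η : Fin 3 → ℤˣ} {i : ℕ} {z : Vertex tiling}
  (hz : z ∈ patchVertices i)

theorem mem_projModule {r : FinRauzyAlgebra k η i} :
    r ∈ projModule k η hz ↔ finVertexIdem k η hz * r = r := by
  rw [projModule, Submodule.mem_span_singleton]
  constructor
  · rintro ⟨a, rfl⟩
    change finVertexIdem k η hz * (finVertexIdem k η hz * a.unop) = finVertexIdem k η hz * a.unop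
    rw [← mul_assoc, finVertexIdem_eq, finPath_mul, mul_one, Quiver.Path.comp_nil]
  · intro h
    exact ⟨MulOpposite.op r, h⟩

theorem finPath_mem_projModule {y : Vertex tiling} (hy : y ∈ patchVertices i) (c : k)
    (p : Quiver.Path z y) : finPath η hz hy c p ∈ projModule k η hz := by
  rw [mem_projModule, finVertexIdem_eq, finPath_mul, one_mul, Quiver.Path.nil_comp]

theorem finVertexIdem_mem_projModule : finVertexIdem k η hz ∈ projModule k η hz := by
  rw [finVertexIdem_eq]
  exact finPath_mem_projModule hz hz 1 .nil

theorem finVertexChar_finVertexIdem : finVertexChar k η hz (finVertexIdem k η hz) = 1 := by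
  rw [finVertexIdem_eq, finVertexChar_finPath_nil]

theorem mem_finDeg_one_iff_of_mem_projModule {r : FinRauzyAlgebra k η i}
    (hr : r ∈ projModule k η hz) : r ∈ finDeg k η i 1 ↔ finVertexChar k η hz r = 0 := by
  refine mem_finDeg_one_iff.trans ⟨fun h => h z hz, fun h x hx => ?_⟩
  by_cases hxz : z = x
  · subst hxz
    exact h
  · rw [← (mem_projModule hz).1 hr, map_mul, finVertexIdem_eq,
      finVertexChar_finPath_nil_of_ne _ _ _ _ hxz, zero_mul]

/-- The submodule of the elements of positive degree. -/
def posPart : Submodule (FinRauzyAlgebra k η i)ᵐᵒᵖ (projModule k η hz) where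
  carrier := {r | finVertexChar k η hz r.1 = 0}
  add_mem' := fun {a b} ha hb => by
    change finVertexChar k η hz (a.1 + b.1) = 0
    rw [map_add, ha, hb, add_zero]
  zero_mem' := map_zero _
  smul_mem' a r hr := by
    change finVertexChar k η hz (r.1 * a.unop) = 0
    rw [map_mul, hr, zero_mul]

theorem mem_posPart {r : projModule k η hz} : r ∈ posPart hz ↔ finVertexChar k η hz r.1 = 0 :=
  Iff.rfl

theorem eq_top_of_finVertexIdem_mem {N : Submodule (FinRauzyAlgebra k η i)ᵐᵒᵖ (projModule k η hz)}
    (h : ⟨finVertexIdem k η hz, finVertexIdem_mem_projModule hz⟩ ∈ N) : N = ⊤ := by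
  rw [eq_top_iff]
  intro r _
  have := N.smul_mem (MulOpposite.op r.1) h
  convert this using 1
  exact Subtype.ext ((mem_projModule hz).1 r.2).symm

theorem isCoatom_posPart : IsCoatom (posPart (k := k) (η := η) hz) := by
  constructor
  · intro h
    have h1 : (⟨finVertexIdem k η hz, finVertexIdem_mem_projModule hz⟩ : projModule k η hz) ∈
        posPart hz := h ▸ Submodule.mem_top
    rw [mem_posPart, finVertexChar_finVertexIdem] at h1
    exact one_ne_zero h1
  · intro N hN
    obtain ⟨hle, n, hn, hn'⟩ := SetLike.lt_iff_le_and_exists.1 hN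
    rw [mem_posPart] at hn'
    rw [eq_top_iff]
    intro r _
    have h1 := N.smul_mem (MulOpposite.op (finPath η hz hz
      ((finVertexChar k η hz n.1)⁻¹ * finVertexChar k η hz r.1) .nil)) hn
    have h2 : r - MulOpposite.op (finPath η hz hz
        ((finVertexChar k η hz n.1)⁻¹ * finVertexChar k η hz r.1) .nil) • n ∈ posPart hz := by
      rw [mem_posPart]
      change finVertexChar k η hz (r.1 - n.1 * finPath η hz hz
        ((finVertexChar k η hz n.1)⁻¹ * finVertexChar k η hz r.1) .nil) = 0
      rw [map_sub, map_mul, finVertexChar_finPath_nil, mul_inv_cancel_left₀ hn', sub_self]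
    have := add_mem (hle h2) h1
    rwa [sub_add_cancel] at this

/-- The radical of `P_z` consists of the elements of positive degree. -/
theorem mem_jacobson_projModule {r : projModule k η hz} :
    r ∈ Module.jacobson (FinRauzyAlgebra k η i)ᵐᵒᵖ (projModule k η hz) ↔
      r.1 ∈ finDeg k η i 1 := by
  rw [mem_finDeg_one_iff_of_mem_projModule hz r.2, ← mem_posPart]
  constructor
  · intro h
    exact Submodule.mem_sInf.1 h _ (isCoatom_posPart hz)
  · intro hr
    refine Submodule.mem_sInf.2 fun N hN => ?_
    by_contra hrN
    have hlt : N < N ⊔ posPart hz :=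
      SetLike.lt_iff_le_and_exists.2 ⟨le_sup_left, r, Submodule.mem_sup_right hr, hrN⟩
    have htop : (⟨finVertexIdem k η hz, finVertexIdem_mem_projModule hz⟩ : projModule k η hz) ∈
        N ⊔ posPart hz := hN.2 _ hlt ▸ Submodule.mem_top
    obtain ⟨n, hn, κ, hκ, hnκ⟩ := Submodule.mem_sup.1 htop
    have hκ' := (mem_finDeg_one_iff_of_mem_projModule hz κ.2).2 hκ
    obtain ⟨u, hu⟩ := (isNilpotent_of_mem_finDeg_one hκ').isUnit_one_sub
    -- The element `n = e_z (1 - κ)` generates the whole module.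
    have hn' : n.1 = finVertexIdem k η hz * u := by
      rw [hu, mul_sub, mul_one, (mem_projModule hz).1 κ.2, eq_sub_iff_add_eq]
      exact congrArg Subtype.val hnκ
    refine hN.1 (eq_top_of_finVertexIdem_mem hz ?_)
    have := N.smul_mem
      (MulOpposite.op ((u⁻¹ : (FinRauzyAlgebra k η i)ˣ) : FinRauzyAlgebra k η i)) hn
    convert this using 1
    refine Subtype.ext ?_
    change finVertexIdem k η hz = n.1 * ((u⁻¹ : (FinRauzyAlgebra k η i)ˣ) : FinRauzyAlgebra k η i)
    rw [hn', mul_assoc, u.mul_inv, mul_one]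

/-- The socle consists of the elements which are annihilated by the elements of positive degree. -/
theorem mem_socle_projModule {s : projModule k η hz} :
    s ∈ socle (FinRauzyAlgebra k η i)ᵐᵒᵖ (projModule k η hz) ↔
      ∀ j ∈ finDeg k η i 1, s.1 * j = 0 := by
  constructor
  · intro hs j hj
    let K : Submodule (FinRauzyAlgebra k η i)ᵐᵒᵖ (projModule k η hz) :=
      { carrier := {s | ∀ j ∈ finDeg k η i 1, s.1 * j = 0}
        add_mem' := fun {a b} ha hb j hj => by
          change (a.1 + b.1) * j = 0
          rw [add_mul, ha j hj, hb j hj, add_zero]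
        zero_mem' := fun j _ => zero_mul j
        smul_mem' := fun a r hr j hj => by
          change r.1 * a.unop * j = 0
          rw [mul_assoc]
          exact hr _ (mul_mem_finDeg_one_left hj _) }
    refine (Submodule.mem_sSup.1 hs K fun N (hN : IsSimpleModule _ N) n hn j hj => ?_) j hj
    -- Otherwise the simple module `N` is generated by `n j`, so that `n = n j a`.
    by_contra hne
    have hnj : MulOpposite.op j • (⟨n, hn⟩ : N) ≠ 0 := fun h =>
      hne (congrArg (fun x : N => x.1.1) h)
    obtain ⟨a, ha⟩ := (isSimpleModule_iff_toSpanSingleton_surjective.1 hN).2 _ hnj ⟨n, hn⟩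
    have h1 : n.1 * j * a.unop = n.1 := congrArg (fun x : N => x.1.1) ha
    obtain ⟨u, hu⟩ :=
      (isNilpotent_of_mem_finDeg_one (mul_mem_finDeg_one_right hj a.unop)).isUnit_one_sub
    have h2 : n.1 * u = 0 := by
      rw [hu, mul_sub, mul_one, ← mul_assoc, h1, sub_self]
    have h3 : n.1 = 0 := u.mul_left_eq_zero.1 h2
    exact hne (by rw [h3, zero_mul])
  · intro hs
    have key : ∀ (x : Vertex tiling) (hx : x ∈ patchVertices i),
        MulOpposite.op (finVertexIdem k η hx) • s ∈
          socle (FinRauzyAlgebra k η i)ᵐᵒᵖ (projModule k η hz) := by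
      intro x hx
      set t := MulOpposite.op (finVertexIdem k η hx) • s with ht
      by_cases h0 : t = 0
      · rw [h0]
        exact zero_mem _
      have act : ∀ a : FinRauzyAlgebra k η i, t.1 * a =
          s.1 * finPath η hx hx (finVertexChar k η hx a) .nil := by
        intro a
        change s.1 * finVertexIdem k η hx * a = _
        rw [mul_assoc, finVertexIdem_eq, finPath_mul_eq, one_mul, mul_add,
          hs _ (mul_mem_finDeg_one_left (finRadPart_mem a) _), add_zero]
      have hsimple : IsSimpleModule (FinRauzyAlgebra k η i)ᵐᵒᵖ
          (Submodule.span (FinRauzyAlgebra k η i)ᵐᵒᵖ {t}) := by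
        have ht' : t ∈ Submodule.span (FinRauzyAlgebra k η i)ᵐᵒᵖ {t} :=
          Submodule.mem_span_singleton_self t
        refine isSimpleModule_iff_toSpanSingleton_surjective.2
          ⟨⟨⟨t, ht'⟩, 0, fun h => h0 (congrArg Subtype.val h)⟩, ?_⟩
        rintro ⟨n, hn⟩ hn0 ⟨m, hm⟩
        obtain ⟨a, rfl⟩ := Submodule.mem_span_singleton.1 hn
        obtain ⟨b, rfl⟩ := Submodule.mem_span_singleton.1 hm
        have ha : finVertexChar k η hx a.unop ≠ 0 := by
          intro ha
          refine hn0 (Subtype.ext (Subtype.ext ?_))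
          change t.1 * a.unop = 0
          rw [act, ha, finPath_zero, mul_zero]
        refine ⟨MulOpposite.op (finPath η hx hx
          ((finVertexChar k η hx a.unop)⁻¹ * finVertexChar k η hx b.unop) .nil),
          Subtype.ext (Subtype.ext ?_)⟩
        change t.1 * a.unop * finPath η hx hx
          ((finVertexChar k η hx a.unop)⁻¹ * finVertexChar k η hx b.unop) .nil = t.1 * b.unop
        rw [mul_assoc, act, act, map_mul, finVertexChar_finPath_nil, mul_inv_cancel_left₀ ha]
      exact le_sSup (a := Submodule.span (FinRauzyAlgebra k η i)ᵐᵒᵖ {t}) hsimple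
        (Submodule.mem_span_singleton_self t)
    have hsum : s = ∑ x ∈ (patchVertices i).attach,
        MulOpposite.op (finVertexIdem k η x.2) • s := by
      have h1 := hs _ (finRadPart_mem 1)
      rw [finRadPart, mul_sub, mul_one, sub_eq_zero] at h1
      refine Subtype.ext (h1.trans ?_)
      rw [Finset.mul_sum, AddSubmonoidClass.coe_finsetSum]
      refine Finset.sum_congr rfl fun x _ => ?_
      rw [map_one, ← finVertexIdem_eq]
      rfl
    rw [hsum]
    exact sum_mem fun x _ => key x.1 x.2

end

/-! ### A simple direct summand of the heart -/

section

variable {k : Type*} [Field k] {η : Fin 3 → ℤˣ} {i : ℕ} {z : Vertex tiling}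

instance isSimpleModule_vertexSimple (hz : z ∈ patchVertices i) :
    IsSimpleModule (FinRauzyAlgebra k η i)ᵐᵒᵖ (VertexSimple k hz η) := by
  refine isSimpleModule_iff_toSpanSingleton_surjective.2 ⟨inferInstanceAs (Nontrivial k), ?_⟩
  intro (c : k) hc (d : k)
  refine ⟨MulOpposite.op (finPath η hz hz (d * c⁻¹) .nil), ?_⟩
  change finVertexChar k η hz (finPath η hz hz (d * c⁻¹) .nil) * c = d
  rw [finVertexChar_finPath_nil, inv_mul_cancel_right₀ hc]

theorem mem_socle_submoduleOf (hz : z ∈ patchVertices i)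
    {r : Module.jacobson (FinRauzyAlgebra k η i)ᵐᵒᵖ (projModule k η hz)} :
    r ∈ (socle (FinRauzyAlgebra k η i)ᵐᵒᵖ (projModule k η hz)).submoduleOf
      (Module.jacobson (FinRauzyAlgebra k η i)ᵐᵒᵖ (projModule k η hz)) ↔
      ∀ j ∈ finDeg k η i 1, r.1.1 * j = 0 :=
  mem_socle_projModule hz

/-- The linear form `r ↦ F (r β)` on the radical of `P_z`, for an element `β` which has
degree four after multiplication by elements of positive degree. -/
def radForm (hz : z ∈ patchVertices i) (p : Quiver.Path z z)
    (hl : ∀ j ∈ finDeg k η i 1, j * finPath η hz hz 1 p ∈ finDeg k η i 4)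
    (F : FinRauzyAlgebra k η i →+ k)
    (hF : ∀ (a : FinRauzyAlgebra k η i) (c : k), F (a * finPath η hz hz c .nil) = c * F a) :
    Module.jacobson (FinRauzyAlgebra k η i)ᵐᵒᵖ (projModule k η hz)
      →ₗ[(FinRauzyAlgebra k η i)ᵐᵒᵖ] VertexSimple k hz η where
  toFun r := (F (r.1.1 * finPath η hz hz 1 p) : k)
  map_add' r s := by
    change F ((r.1.1 + s.1.1) * finPath η hz hz 1 p) = _
    rw [add_mul, map_add]
    rfl
  map_smul' b r := by
    change F (r.1.1 * b.unop * finPath η hz hz 1 p) =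
      finVertexChar k η hz b.unop * F (r.1.1 * finPath η hz hz 1 p)
    have h0 := finDeg_five_eq_zero (mul_mem_finDeg (m := 1) (n := 4)
      ((mem_jacobson_projModule hz).1 r.2) (hl _ (finRadPart_mem b.unop)))
    have h1 : finPath η hz hz (finVertexChar k η hz b.unop) p =
        finPath η hz hz 1 p * finPath η hz hz (finVertexChar k η hz b.unop) .nil := by
      rw [finPath_mul, one_mul, Quiver.Path.comp_nil]
    rw [mul_assoc, mul_finPath_eq, mul_add, h0, add_zero, mul_one, h1, ← mul_assoc, hF]

/-- The multiples of a closed path of positive length, as elements of the radical. -/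
def radPath (η : Fin 3 → ℤˣ) (hz : z ∈ patchVertices i) (p : Quiver.Path z z) (hp : 1 ≤ p.length)
    (c : k) : Module.jacobson (FinRauzyAlgebra k η i)ᵐᵒᵖ (projModule k η hz) :=
  ⟨⟨finPath η hz hz c p, finPath_mem_projModule hz hz c p⟩,
    (mem_jacobson_projModule hz).2 (finPath_mem_finDeg hz hz c hp)⟩

/-- The homomorphism from the simple module to the heart with image spanned by the class of
a closed path. -/
def heartPath (hz : z ∈ patchVertices i) (p : Quiver.Path z z) (hp : 1 ≤ p.length)
    (hr : ∀ j ∈ finDeg k η i 1, finPath η hz hz 1 p * j ∈ finDeg k η i 4) :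
    VertexSimple k hz η →ₗ[(FinRauzyAlgebra k η i)ᵐᵒᵖ]
      Heart (FinRauzyAlgebra k η i)ᵐᵒᵖ (projModule k η hz) where
  toFun c := Submodule.Quotient.mk (radPath η hz p hp c)
  map_add' := fun (c d : k) => by
    rw [← Submodule.Quotient.mk_add]
    exact congrArg _ (Subtype.ext (Subtype.ext (finPath_add hz hz c d p)))
  map_smul' b := fun (c : k) => by
    rw [RingHom.id_apply, ← Submodule.Quotient.mk_smul, Submodule.Quotient.eq]
    refine (mem_socle_submoduleOf hz).2 fun j hj => ?_
    change (finPath η hz hz (finVertexChar k η hz b.unop * c) p -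
      finPath η hz hz c p * b.unop) * j = 0
    rw [finPath_mul_eq, mul_comm c, sub_add_cancel_left, neg_mul, neg_eq_zero]
    refine finDeg_five_eq_zero (mul_mem_finDeg (m := 4) (n := 1) ?_ hj)
    have h1 : finPath η hz hz c p = finPath η hz hz c .nil * finPath η hz hz 1 p := by
      rw [finPath_mul, mul_one, Quiver.Path.nil_comp]
    rw [h1, mul_assoc]
    simpa using mul_mem_finDeg (mem_finDeg_zero (finPath η hz hz c .nil))
      (hr _ (finRadPart_mem b.unop))

theorem exists_isCompl_of_leftInverse {R M S : Type*} [Ring R] [AddCommGroup M] [Module R M]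
    [AddCommGroup S] [Module R S] [IsSimpleModule R S] (θ : M →ₗ[R] S) (ψ : S →ₗ[R] M)
    (h : ∀ c, θ (ψ c) = c) (hθ : LinearMap.ker θ ≠ ⊥) : IsDecomposable R M ∧
      ∃ N N' : Submodule R M, IsCompl N N' ∧ IsSimpleModule R N ∧ Nonempty (N ≃ₗ[R] S) := by
  let e := LinearEquiv.ofInjective ψ (Function.LeftInverse.injective h)
  have hcompl : IsCompl (LinearMap.range ψ) (LinearMap.ker θ) := by
    have h1 : LinearMap.ker (e.toLinearMap ∘ₗ θ) = LinearMap.ker θ := LinearEquiv.ker_comp e θ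
    rw [← h1]
    refine LinearMap.isCompl_of_proj ?_
    rintro ⟨_, c, rfl⟩
    exact congrArg e (h c)
  have hsimple : IsSimpleModule R (LinearMap.range ψ) := IsSimpleModule.congr e.symm
  refine ⟨⟨_, _, hcompl, ?_, hθ⟩, _, _, hcompl, hsimple, ⟨e.symm⟩⟩
  intro h0
  have := IsSimpleModule.nontrivial R S
  obtain ⟨c, hc⟩ := exists_ne (0 : S)
  refine hc ?_
  have h1 : ψ c ∈ LinearMap.range ψ := ⟨_, rfl⟩
  rw [h0, Submodule.mem_bot] at h1
  rw [← h c, h1, map_zero]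

/-- Let `β` be a closed path of length two at `z` whose products with all elements of positive
degree have degree four, and let `F` be a linear form with value one at `β²`. Then
the class of `β` spans a direct summand of the heart of `P_z`, which is complemented by the kernel
of the linear form `r ↦ F (r β)`. -/
theorem heart_of_closed_path (hz : z ∈ patchVertices i) (p : Quiver.Path z z) (hp : p.length = 2)
    (hl : ∀ j ∈ finDeg k η i 1, j * finPath η hz hz 1 p ∈ finDeg k η i 4)
    (hr : ∀ j ∈ finDeg k η i 1, finPath η hz hz 1 p * j ∈ finDeg k η i 4)
    (F : FinRauzyAlgebra k η i →+ k)
    (hF : ∀ (a : FinRauzyAlgebra k η i) (c : k), F (a * finPath η hz hz c .nil) = c * F a)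
    (hFp : F (finPath η hz hz 1 p * finPath η hz hz 1 p) = 1)
    (a : FinRauzyAlgebra k η i) (ha : a ∈ projModule k η hz) (ha' : a ∈ finDeg k η i 1)
    (hFa : F (a * finPath η hz hz 1 p) = 0)
    (haj : ∃ j ∈ finDeg k η i 1, a * j ≠ 0) :
    IsDecomposable (FinRauzyAlgebra k η i)ᵐᵒᵖ
      (Heart (FinRauzyAlgebra k η i)ᵐᵒᵖ (projModule k η hz)) ∧
    ∃ N N' : Submodule (FinRauzyAlgebra k η i)ᵐᵒᵖ
        (Heart (FinRauzyAlgebra k η i)ᵐᵒᵖ (projModule k η hz)),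
      IsCompl N N' ∧ IsSimpleModule (FinRauzyAlgebra k η i)ᵐᵒᵖ N ∧
      Nonempty (N ≃ₗ[(FinRauzyAlgebra k η i)ᵐᵒᵖ] VertexSimple k hz η) := by
  have hp' : 1 ≤ p.length := by omega
  have hφ : (socle (FinRauzyAlgebra k η i)ᵐᵒᵖ (projModule k η hz)).submoduleOf
      (Module.jacobson (FinRauzyAlgebra k η i)ᵐᵒᵖ (projModule k η hz)) ≤
        LinearMap.ker (radForm hz p hl F hF) := by
    intro r hrs
    have h1 := (mem_socle_submoduleOf hz).1 hrs _ (finPath_mem_finDeg hz hz 1 hp')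
    change F (r.1.1 * finPath η hz hz 1 p) = 0
    rw [h1, map_zero]
  refine exists_isCompl_of_leftInverse (Submodule.liftQ _ (radForm hz p hl F hF) hφ)
    (heartPath hz p hp' hr) (fun (c : k) => ?_) fun h0 => ?_
  · change F (finPath η hz hz c p * finPath η hz hz 1 p) = c
    have : finPath η hz hz c p * finPath η hz hz 1 p =
        finPath η hz hz 1 p * finPath η hz hz 1 p * finPath η hz hz c .nil := by
      simp only [finPath_mul, Quiver.Path.comp_nil, mul_one, one_mul]
    rw [this, hF, hFp, mul_one]
  · obtain ⟨j, hj, haj⟩ := haj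
    let x : Module.jacobson (FinRauzyAlgebra k η i)ᵐᵒᵖ (projModule k η hz) :=
      ⟨⟨a, ha⟩, (mem_jacobson_projModule hz).2 ha'⟩
    have h1 : (Submodule.Quotient.mk x :
        Heart (FinRauzyAlgebra k η i)ᵐᵒᵖ (projModule k η hz)) ∈
          LinearMap.ker (Submodule.liftQ _ (radForm hz p hl F hF) hφ) := hFa
    rw [h0, Submodule.mem_bot, Submodule.Quotient.mk_eq_zero] at h1
    exact haj ((mem_socle_submoduleOf hz).1 h1 j hj)

end

/-! ### The edges at a vertex with a loop -/

theorem mem_patchVertices {i : ℕ} {x : Vertex tiling} : x ∈ patchVertices i ↔ InPatch i x.1 := by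
  classical
  rw [patchVertices]
  refine Finset.mem_subtype.trans ?_
  simp only [Finset.mem_biUnion, Finset.mem_image, Finset.mem_univ, true_and, InPatch]
  exact exists_congr fun t => and_congr_right fun _ => exists_congr fun a => eq_comm

theorem fullStar_tiling (z : Vertex tiling) : FullStar tiling z.1 := by
  obtain ⟨u, t, ht, a, hu⟩ := z
  rintro t' ht' ⟨b, hb⟩
  exact mem_tiling_of_corner_eq ht ht' (hu.symm.trans hb)

/-- At a vertex with all its rhombi, every edge of the stepped plane is an edge of the quiver. -/
theorem adj_iff_present {T : Set Tile} (hT : T ⊆ steppedPlane) {u : Lattice} (hu : FullStar T u)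
    {d : Direction} : Adj T u (u + d.vec) ↔ Present u d := by
  constructor
  · rintro ⟨t, ht, hs⟩
    exact present_of_isSide (hT ht) hs
  · intro h
    have key : ∀ a : Fin 3, a ≠ a + 1 ∧ a ≠ -(a + (a + 1)) := by decide
    by_cases hs : SpansTile u d (d.1 + 1, d.2)
    · exact ⟨_, hu.tileAt_mem (d' := (d.1 + 1, d.2)) (key d.1).1 hs, isSide_tileAt u (key d.1).1⟩
    · have h1 := not_not.1 fun h' => hs ((spansTile_iff_not h (key d.1).1).2 h')
      exact ⟨_, hu.tileAt_mem (d' := (-(d.1 + (d.1 + 1)), !d.2)) (key d.1).2 h1,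
        isSide_tileAt u (key d.1).2⟩

theorem vec_ne_zero (d : Direction) : d.vec ≠ 0 := by
  decide +revert

/-- The edge in direction `d` at `u` leaves the `i`-th patch. -/
def Leaves (i : ℕ) (u : Lattice) (d : Direction) : Prop := Present u d ∧ ¬ InPatch i (u + d.vec)

/-- Opposite edges at a vertex of the patch do not both leave the patch. -/
theorem not_leaves_opp {i : ℕ} {u : Lattice} (hu : InPatch i u) {d : Direction}
    (h : Leaves i u d) : ¬ Leaves i u d.opp := by
  have key : ∀ j, Leaves i u (j, true) → Leaves i u (j, false) → False := by
    rintro j ⟨⟨-, h2⟩, h3⟩ ⟨⟨h1, -⟩, h4⟩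
    simp only [wt, if_true, Bool.false_eq_true, if_false] at h1 h2
    rcases hu.add_or_sub (by linarith) h2 with h | h
    · exact h3 h
    · exact h4 (by rwa [sub_eq_add_neg] at h)
  intro h'
  obtain ⟨j, _ | _⟩ := d
  · exact key j h' h
  · exact key j h h'

/-- A vertex of a patch lies on a rhombus of the patch; the two edges of the rhombus do not leave
the patch. -/
theorem InPatch.exists_spansTile {i : ℕ} {u : Lattice} (hu : InPatch i u) :
    ∃ d d' : Direction, d.1 ≠ d'.1 ∧ SpansTile u d d' ∧ InPatch i (u + d.vec) ∧
      InPatch i (u + d'.vec) := by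
  obtain ⟨t, ht, a, rfl⟩ := hu
  have hside := isSide_corner_add_one t a
  obtain ⟨d, -, hd⟩ := exists_direction hside
  have hin : InPatch i (corner t a + d.vec) := ⟨t, ht, a + 1, hd.symm⟩
  rw [hd] at hside
  obtain ⟨d', hne, h⟩ := exists_eq_tileAt hside
  refine ⟨d, d', hne, (tileAt_mem_steppedPlane hne).1 (h ▸ tiling_subset ⟨i, ht⟩), hin, ?_⟩
  have hside' := isSide_tileAt' (corner t a) hne
  rw [← h] at hside'
  obtain ⟨b, s, -, -, hb⟩ := isSide_iff.1 hside'
  exact ⟨t, ht, _, hb⟩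

/-- It is impossible that three edges of the same sign leave the patch. -/
theorem exists_not_leaves {i : ℕ} {u : Lattice} (hu : InPatch i u) (b : Bool) :
    ∃ j, ¬ Leaves i u (j, b) := by
  by_contra! h
  obtain ⟨⟨j, s⟩, ⟨j', s'⟩, hne, ⟨h1, h2, h3, h4⟩, hin, hin'⟩ := hu.exists_spansTile
  have hs : s = !b := by
    by_contra hs
    obtain rfl : s = b := by simpa using hs
    exact (h j).2 hin
  have hs' : s' = !b := by
    by_contra hs
    obtain rfl : s' = b := by simpa using hs
    exact (h j').2 hin'
  subst hs hs'
  have ht := total_eq' hne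
  obtain ⟨⟨h5, h6⟩, -⟩ := h (-(j + j'))
  cases b <;> simp [wt] at h3 h4 h5 h6 ht <;> linarith

/-- Two edges of opposite signs at a vertex always span a rhombus. -/
theorem spansTile_of_present_of_ne {u : Lattice} {d d' : Direction} (h : Present u d)
    (h' : Present u d') (hs : d.2 ≠ d'.2) : SpansTile u d d' := by
  obtain ⟨j, s⟩ := d
  obtain ⟨j', s'⟩ := d'
  have h0 := weight_pos j
  have h0' := weight_pos j'
  obtain ⟨h1, h2⟩ := h
  obtain ⟨h1', h2'⟩ := h'
  cases s <;> cases s' <;> simp [wt] at hs h1 h2 h1' h2' <;>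
    refine ⟨⟨?_, ?_⟩, ⟨?_, ?_⟩, ?_, ?_⟩ <;> simp only [wt, if_true, Bool.false_eq_true, if_false] <;>
    linarith

/-- If on each line some edge leaves the patch, then there is an edge which leaves the patch such
that the two rhombi at it do not contain an edge at `u` which stays in the patch. -/
theorem exists_isolated {i : ℕ} {u : Lattice} (hu : InPatch i u)
    (h : ∀ j, ∃ b, Leaves i u (j, b)) : ∃ d : Direction, Leaves i u d ∧
      (∀ c : Direction, InPatch i (u + c.vec) → d.1 ≠ c.1 → ¬ SpansTile u d c) ∧
      (∀ l, d.1 ≠ l → ¬ SpansTile u d (l, d.2)) := by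
  choose s hs using h
  obtain ⟨n, l, m, hne, hl, hm⟩ : ∃ n l m : Fin 3, (∀ x, x ≠ n → x = l ∧ m = -(n + l) ∨
      x = m ∧ l = -(n + m)) ∧ s l = !s n ∧ s m = !s n := by
    obtain ⟨j, hj⟩ := exists_not_leaves hu true
    obtain ⟨j', hj'⟩ := exists_not_leaves hu false
    have h1 : ∃ j, s j ≠ true := ⟨j, fun h => hj (h ▸ hs j)⟩
    have h2 : ∃ j, s j ≠ false := ⟨j', fun h => hj' (h ▸ hs j')⟩
    clear * - h1 h2
    decide +revert
  have hspan : ∀ x, x ≠ n → SpansTile u (n, s n) (x, !s n) := by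
    intro x hx
    refine spansTile_of_present_of_ne (hs n).1 ?_ (by simp)
    rcases hne x hx with ⟨rfl, -⟩ | ⟨rfl, -⟩
    · exact hl ▸ (hs x).1
    · exact hm ▸ (hs x).1
  have hnot : ∀ x, n ≠ x → ¬ SpansTile u (n, s n) (x, s n) := by
    intro x hx h
    refine (spansTile_iff_not (hs n).1 hx).1 h (hspan _ ?_)
    have : ∀ n x : Fin 3, n ≠ x → -(n + x) ≠ n := by decide
    exact this n x hx
  refine ⟨(n, s n), hs n, ?_, hnot⟩
  rintro ⟨x, b⟩ hc hx h
  have hb : b ≠ s n := by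
    rintro rfl
    exact hnot x hx h
  have hb : b = !s n := by
    cases b <;> cases h' : s n <;> simp [h'] at hb ⊢
  subst hb
  rcases hne x (Ne.symm hx) with ⟨rfl, -⟩ | ⟨rfl, -⟩
  · exact (hs x).2 (hl ▸ hc)
  · exact (hs x).2 (hm ▸ hc)

section

variable {k : Type*} [Field k] {η : Fin 3 → ℤˣ} {i : ℕ} {z : Vertex tiling}

/-- A loop along an edge which does not leave the patch belongs to the square of the radical. -/
theorem exists_mem_jacobson_mul (hz : z ∈ patchVertices i) {d : Direction}
    (h : ¬ Leaves i z.1 d) : ∃ γ ∈ Ring.jacobson (FinRauzyAlgebra k η i) *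
      Ring.jacobson (FinRauzyAlgebra k η i), γ.incl = loopElt k η tiling z.1 d := by
  by_cases hA : Adj tiling z.1 (z.1 + d.vec)
  · let x : Vertex tiling := mkVertex tiling _ hA.exists_corner
    let b : z ⟶ x := ⟨hA⟩
    let b' : x ⟶ z := ⟨hA.symm⟩
    have hx : x ∈ patchVertices i := by
      rw [mem_patchVertices]
      by_contra hx
      exact h ⟨(adj_iff_present tiling_subset (fullStar_tiling z)).1 hA, hx⟩
    refine ⟨finPath η hz hx 1 b.toPath * finPath η hx hz 1 b'.toPath, ?_, ?_⟩
    · exact Ideal.mul_mem_mul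
        (mem_jacobson_of_mem_finDeg_one (finPath_mem_finDeg hz hx 1 le_rfl))
        (mem_jacobson_of_mem_finDeg_one (finPath_mem_finDeg hx hz 1 le_rfl))
    · rw [map_mul, incl_finPath_one, incl_finPath_one, pathElt_toPath, pathElt_toPath]
      rfl
  · refine ⟨0, zero_mem _, ?_⟩
    rw [map_zero, loopElt, arr_of_not_adj k η hA, zero_mul]

/-- If there is a loop at `z`, then on each line some edge leaves the patch. -/
theorem exists_leaves_of_isLoopAt (hz : z ∈ patchVertices i) {β : FinRauzyAlgebra k η i}
    (hβ : IsLoopAt z β) (j : Fin 3) : ∃ b, Leaves i z.1 (j, b) := by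
  obtain ⟨x, b, b', hincl, hb, -, hrad⟩ := hβ
  by_contra! hj
  refine hrad ?_
  have hzP := mem_patchVertices.1 hz
  have hout : Leaves i z.1 (edgeDir b) := by
    have hx := edgeDir_spec b
    refine ⟨(adj_iff_present tiling_subset (fullStar_tiling z)).1 (hx ▸ b.down), fun h => ?_⟩
    rw [← hx] at h
    exact hb (finPath η hz (mem_patchVertices.2 h) 1 b.toPath) (incl_finPath_one _ _ _)
  have hβ : β.incl = loopElt k η tiling z.1 (edgeDir b) := by
    rw [hincl, pathElt_toPath, pathElt_toPath, loopElt, ← edgeDir_spec]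
  obtain ⟨γ₁, h1, e1⟩ := exists_mem_jacobson_mul (k := k) (η := η) hz (hj true)
  obtain ⟨γ₂, h2, e2⟩ := exists_mem_jacobson_mul (k := k) (η := η) hz (hj false)
  obtain ⟨γ₃, h3, e3⟩ := exists_mem_jacobson_mul (k := k) (η := η) hz (not_leaves_opp hzP hout)
  obtain ⟨c, hc⟩ := exists_lineElt_eq k η (T := tiling) z.1 (edgeDir b).1 j
  rw [lineElt, lineElt, ← e1, ← e2, ← map_sub, ← map_zsmul] at hc
  have h12 : c • (γ₁ - γ₂) ∈ Ring.jacobson (FinRauzyAlgebra k η i) *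
      Ring.jacobson (FinRauzyAlgebra k η i) := zsmul_mem (sub_mem h1 h2) c
  generalize edgeDir b = d at *
  obtain ⟨l, _ | _⟩ := d
  · have : β = γ₃ - c • (γ₁ - γ₂) := by
      apply FinRauzyAlgebra.incl_injective
      rw [map_sub, ← hc, hβ, e3]
      exact (sub_sub_cancel _ _).symm
    rw [this]
    exact sub_mem h3 h12
  · have : β = γ₃ + c • (γ₁ - γ₂) := by
      apply FinRauzyAlgebra.incl_injective
      rw [map_add, ← hc, hβ, e3]
      exact (add_sub_cancel _ _).symm
    rw [this]
    exact add_mem h3 h12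

theorem algForm_mul_finPath_nil (hη : η 0 * η 1 * η 2 = 1) (hz : z ∈ patchVertices i)
    (a : FinRauzyAlgebra k η i) (c : k) :
    algForm k η tiling_subset (fullStar_tiling z) hη z.2 (a * finPath η hz hz c .nil).incl =
      c * algForm k η tiling_subset (fullStar_tiling z) hη z.2 a.incl := by
  obtain ⟨f, hf⟩ := quotMap_surjective k η a.incl
  rw [map_mul, incl_finPath, ← hf, ← map_mul, algForm_quotMap, algForm_quotMap, mul_smul_path,
    map_smul, pathForm_mul_nil k η rfl, smul_eq_mul]

theorem algForm_finPath (hη : η 0 * η 1 * η 2 = 1) (hz : z ∈ patchVertices i)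
    {y : Vertex tiling} (hy : y ∈ patchVertices i) (p : Quiver.Path z y) :
    algForm k η tiling_subset (fullStar_tiling z) hη z.2 (finPath η hz hy 1 p).incl =
      ((fourForm (z := z.1) (lineSign η z.1) (pathDirs p) : ℤ) : k) := by
  rw [incl_finPath_one, pathElt, algForm_quotMap, pathForm_ofPath k η rfl]

theorem exists_eq_toPath {V : Type*} [Quiver V] {x y : V} (p : Quiver.Path x y)
    (hp : p.length = 1) : ∃ e : x ⟶ y, p = e.toPath := by
  cases p with
  | nil => simp at hp
  | cons p e =>
    cases p with
    | nil => exact ⟨e, rfl⟩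
    | cons p f => simp at hp

/-- If a closed path of length two is annihilated by the arrows of the patch, then its products
with elements of positive degree have degree four. -/
theorem mul_finPath_mem_finDeg_four (hz : z ∈ patchVertices i) (p : Quiver.Path z z)
    (hp : p.length = 2) (h : ∀ v ∈ patchVertices i, ∀ f : v ⟶ z,
      pathElt k η f.toPath * pathElt k η p = 0) :
    ∀ j ∈ finDeg k η i 1, j * finPath η hz hz 1 p ∈ finDeg k η i 4 := by
  have h1 : finDeg k η i 1 ≤
      (finDeg k η i 4).comap (AddMonoidHom.mulRight (finPath η hz hz 1 p)) := by
    refine finDeg_le fun v v' hv hv' s r hr => ?_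
    change finPath η hv hv' s r * finPath η hz hz 1 p ∈ finDeg k η i 4
    by_cases hr2 : 2 ≤ r.length
    · exact mul_mem_finDeg (m := 2) (n := 2) (finPath_mem_finDeg hv hv' s hr2)
        (finPath_mem_finDeg hz hz 1 hp.ge)
    by_cases hvz : z = v'
    swap
    · rw [finPath_mul_of_ne _ _ _ _ _ _ _ _ hvz]
      exact zero_mem _
    subst hvz
    obtain ⟨f, rfl⟩ := exists_eq_toPath r (by omega)
    have h0 : finPath η hv hz (1 : k) f.toPath * finPath η hz hz 1 p = 0 := by
      apply FinRauzyAlgebra.incl_injective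
      rw [map_mul, incl_finPath_one, incl_finPath_one, h v hv f, map_zero]
    have h2 : finPath η hv hv' s f.toPath =
        finPath η hv hv s .nil * finPath η hv hz 1 f.toPath := by
      rw [finPath_mul, mul_one, Quiver.Path.nil_comp]
    rw [h2, mul_assoc, h0, mul_zero]
    exact zero_mem _
  exact fun j hj => h1 hj

theorem finPath_mul_mem_finDeg_four (hz : z ∈ patchVertices i) (p : Quiver.Path z z)
    (hp : p.length = 2) (h : ∀ v ∈ patchVertices i, ∀ f : z ⟶ v,
      pathElt k η p * pathElt k η f.toPath = 0) :
    ∀ j ∈ finDeg k η i 1, finPath η hz hz 1 p * j ∈ finDeg k η i 4 := by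
  have h1 : finDeg k η i 1 ≤
      (finDeg k η i 4).comap (AddMonoidHom.mulLeft (finPath η hz hz 1 p)) := by
    refine finDeg_le fun v v' hv hv' s r hr => ?_
    change finPath η hz hz 1 p * finPath η hv hv' s r ∈ finDeg k η i 4
    by_cases hr2 : 2 ≤ r.length
    · exact mul_mem_finDeg (m := 2) (n := 2) (finPath_mem_finDeg hz hz 1 hp.ge)
        (finPath_mem_finDeg hv hv' s hr2)
    by_cases hvz : v = z
    swap
    · rw [finPath_mul_of_ne _ _ _ _ _ _ _ _ hvz]
      exact zero_mem _
    subst hvz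
    obtain ⟨f, rfl⟩ := exists_eq_toPath r (by omega)
    have h0 : finPath η hz hz (1 : k) p * finPath η hz hv' 1 f.toPath = 0 := by
      apply FinRauzyAlgebra.incl_injective
      rw [map_mul, incl_finPath_one, incl_finPath_one, h v' hv' f, map_zero]
    have h2 : finPath η hv hv' s f.toPath =
        finPath η hz hv' 1 f.toPath * finPath η hv' hv' s .nil := by
      rw [finPath_mul, one_mul, Quiver.Path.comp_nil]
    rw [h2, ← mul_assoc, h0, zero_mul]
    exact zero_mem _
  exact fun j hj => h1 hj

end

end Rauzy

end

theorem mainTheorem6 (k : Type*) [Field k] (η : Fin 3 → ℤˣ) (hη : η 0 * η 1 * η 2 = 1)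
    (i : ℕ) (z : Rauzy.Vertex Rauzy.tiling) (hz : z ∈ Rauzy.patchVertices i)
    (hloop : ∃ β : Rauzy.FinRauzyAlgebra k η i, Rauzy.IsLoopAt z β) :
    Rauzy.IsDecomposable (Rauzy.FinRauzyAlgebra k η i)ᵐᵒᵖ
      (Rauzy.Heart (Rauzy.FinRauzyAlgebra k η i)ᵐᵒᵖ (Rauzy.projModule k η hz)) ∧
    ∃ N N' : Submodule (Rauzy.FinRauzyAlgebra k η i)ᵐᵒᵖ
        (Rauzy.Heart (Rauzy.FinRauzyAlgebra k η i)ᵐᵒᵖ (Rauzy.projModule k η hz)),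
      IsCompl N N' ∧ IsSimpleModule (Rauzy.FinRauzyAlgebra k η i)ᵐᵒᵖ N ∧
      Nonempty (N ≃ₗ[(Rauzy.FinRauzyAlgebra k η i)ᵐᵒᵖ] Rauzy.VertexSimple k hz η) := by
  open Rauzy Rauzy.Direction in
  obtain ⟨β₀, hβ₀⟩ := hloop
  have hzP := mem_patchVertices.1 hz
  have hstar := fullStar_tiling z
  obtain ⟨d, hd, hiso, hexc⟩ := exists_isolated hzP (exists_leaves_of_isLoopAt hz hβ₀)
  -- The path `β` of length two along the isolated edge.
  have hA : Adj tiling z.1 (z.1 + d.vec) := (adj_iff_present tiling_subset hstar).2 hd.1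
  let w : Vertex tiling := mkVertex tiling _ hA.exists_corner
  let b : z ⟶ w := ⟨hA⟩
  let b' : w ⟶ z := ⟨hA.symm⟩
  have eb : edgeDir b = d := edgeDir_eq b rfl
  have eb' : edgeDir b' = d.opp := edgeDir_eq b' (add_vec_add_vec_opp _ _).symm
  let p : Quiver.Path z z := b.toPath.comp b'.toPath
  have hp : pathDirs p = [d, d.opp] := by
    rw [pathDirs_comp, pathDirs_toPath, pathDirs_toPath, eb, eb']
    rfl
  have hpl : p.length = 2 := rfl
  -- No rhombus contains this edge and an edge at `z` which stays in the patch.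
  have hno : ∀ x : Lattice, InPatch i x →
      ¬ ∃ t ∈ tiling, IsSide t z.1 (z.1 + d.vec) ∧ IsSide t z.1 x := by
    rintro x hx ⟨t, ht, h1, h2⟩
    obtain ⟨c, -, rfl⟩ := exists_direction h2
    by_cases hdc : d.1 = c.1
    · rcases eq_or_eq_opp hdc with rfl | rfl
      · exact hd.2 hx
      · exact not_isSide_opp h1 h2
    · refine hiso c hx hdc ((tileAt_mem_steppedPlane hdc).1 ?_)
      rw [← eq_tileAt hdc h1 h2]
      exact tiling_subset ht
  -- An edge of a rhombus of the patch at `z`, and the other edge of this rhombus at `z`.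
  obtain ⟨c, c', hcc', hspan, hc, hc'⟩ := hzP.exists_spansTile
  have hAc : Adj tiling z.1 (z.1 + c.vec) := (adj_iff_present tiling_subset hstar).2 hspan.1
  have hAc' : Adj tiling z.1 (z.1 + c'.vec) := (adj_iff_present tiling_subset hstar).2 hspan.2.1
  let x : Vertex tiling := mkVertex tiling _ hAc.exists_corner
  let y : Vertex tiling := mkVertex tiling _ hAc'.exists_corner
  have hx : x ∈ patchVertices i := mem_patchVertices.2 hc
  let a : z ⟶ x := ⟨hAc⟩
  let a' : x ⟶ z := ⟨hAc.symm⟩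
  let e : z ⟶ y := ⟨hAc'⟩
  let e' : y ⟶ z := ⟨hAc'.symm⟩
  have ea : edgeDir a = c := edgeDir_eq a rfl
  have ea' : edgeDir a' = c.opp := edgeDir_eq a' (add_vec_add_vec_opp _ _).symm
  have ee : edgeDir e = c' := edgeDir_eq e rfl
  have ee' : edgeDir e' = c'.opp := edgeDir_eq e' (add_vec_add_vec_opp _ _).symm
  let q : Quiver.Path x z := a'.toPath.comp (e.toPath.comp e'.toPath)
  refine heart_of_closed_path hz p hpl ?_ ?_
    (-(algForm k η tiling_subset hstar hη z.2).comp
      ((FinRauzyAlgebra.incl : FinRauzyAlgebra k η i →ₙ+* _) : FinRauzyAlgebra k η i →+ _))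
    ?_ ?_ (finPath η hz hx 1 a.toPath) (finPath_mem_projModule hz hx 1 _)
    (finPath_mem_finDeg hz hx 1 le_rfl) ?_ ⟨finPath η hx hz 1 q, ?_, ?_⟩
  · refine mul_finPath_mem_finDeg_four hz p hpl fun v hv f => ?_
    rw [← pathElt_mul, pathElt_toPath, pathElt_toPath, ← mul_assoc, arr_mul_arr_eq_zero, zero_mul]
    rintro ⟨t, ht, h1, h2⟩
    exact hno _ (mem_patchVertices.1 hv) ⟨t, ht, h2, h1.symm⟩
  · refine finPath_mul_mem_finDeg_four hz p hpl fun v hv f => ?_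
    rw [← pathElt_mul, pathElt_toPath, pathElt_toPath, pathElt_toPath, mul_assoc,
      arr_mul_arr_eq_zero, mul_zero]
    rintro ⟨t, ht, h1, h2⟩
    exact hno _ (mem_patchVertices.1 hv) ⟨t, ht, h1.symm, h2⟩
  · intro r s
    change -algForm k η tiling_subset hstar hη z.2 (r * finPath η hz hz s .nil).incl =
      s * -algForm k η tiling_subset hstar hη z.2 r.incl
    rw [algForm_mul_finPath_nil, mul_neg]
  · change -algForm k η tiling_subset hstar hη z.2
      (finPath η hz hz (1 : k) p * finPath η hz hz (1 : k) p).incl = 1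
    have key : ∀ n : Fin 3, n ≠ n + 1 ∧ n ≠ n + 2 := by decide
    rw [finPath_mul, mul_one, algForm_finPath, pathDirs_comp, hp, List.cons_append,
      List.singleton_append, fourForm_loop_loop, loopForm, if_pos rfl, if_pos rfl, edgeExcess,
      spanInd, spanInd, if_neg (hexc _ (key d.1).1), if_neg (hexc _ (key d.1).2)]
    simp
  · change -algForm k η tiling_subset hstar hη z.2
      (finPath η hz hx (1 : k) a.toPath * finPath η hz hz (1 : k) p).incl = 0
    by_cases hzx : z = x
    · have h1 : z.1 = z.1 + c.vec := congrArg Subtype.val hzx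
      exact absurd (left_eq_add.1 h1) (vec_ne_zero c)
    · rw [finPath_mul_of_ne _ _ _ _ _ _ _ _ hzx, map_zero, map_zero, neg_zero]
  · exact finPath_mem_finDeg _ _ _ (by simp [q])
  · intro h0
    have h1 := congrArg (fun r : FinRauzyAlgebra k η i =>
      algForm k η tiling_subset hstar hη z.2 r.incl) h0
    simp only [map_zero] at h1
    rw [finPath_mul, mul_one, algForm_finPath, pathDirs_comp, pathDirs_comp, pathDirs_comp,
      pathDirs_toPath, pathDirs_toPath, pathDirs_toPath, pathDirs_toPath, ea, ea', ee, ee'] at h1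
    rw [List.singleton_append, List.singleton_append, List.singleton_append, fourForm_loop_loop,
      loopForm, if_neg hcc', spanInd, if_pos hspan, mul_one, ← Units.val_mul] at h1
    rcases Int.units_eq_one_or (lineSign η z.1 c.1 * lineSign η z.1 c'.1) with h2 | h2 <;>
      simp [h2] at h1
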